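/- **Setting.** Write $x=(x_1,x_2)\in\mathbb R^2$ and $\mathcal F\eta(\xi)=\int_{\mathbb R^2}e^{-i\xi\cdot x}\eta(x)\,dx$. Let $f:\mathbb R^2\to\mathbb R$ be continuous on $\mathbb R^2\setminus\{0\}$ with $f(-x)=f(x)$, and let $\mu$ be its spectral measure: a non-negative tempered measure on $\mathbb R^2$ such that, for every Schwartz function $\eta$, the product $f\eta$ is integrable and $\int f\eta\,dx=\int\mathcal F\eta\,d\mu$. Let $F=(F(\varphi))_{\varphi\in C_0^\infty(\mathbb R^3)}$ be a centred Gaussian family on a probability space $(\Omega,\mathcal A,\mathbb P)$ with covariance $$\mathbb E[F(\varphi)F(\psi)]=\int_0^\infty\!\int_{\mathbb R^2}\!\int_{\mathbb R^2}\varphi(t,x)f(x-y)\psi(t,y)\,dy\,dx\,dt .$$ For $g=g(s,y)$ put $\|g\|^2=\int_0^\infty\int_{\mathbb R^2}|\mathcal F g(s,\cdot)(\xi)|^2\,d\mu(\xi)\,ds$, so that $\mathbb E[F(\varphi)^2]=\|\varphi\|^2$. The martingale measure of the noise is $M_t(B)=F([0,t]\times B)$, for $t\ge 0$ and $B\subset\mathbb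 R^2$ bounded Borel, where $F(A)$ is the $L^2(\Omega)$-limit of $F(\varphi_n)$ for test functions $\varphi_n$ with $\|\varphi_n-\mathbf 1_A\|\to0$. For a measurable deterministic $g$ with $g(s,\cdot)\in L^1(\mathbb R^2)$ for a.e. $s>0$ and $\|g\|<\infty$, the stochastic integral $\int_0^\infty\int g\,dM$ is well defined and equal to $X\in L^2(\Omega)$ if $X$ is the $L^2(\Omega)$-limit of the integrals $\sum_i c_i\,(M_{b_i}(B_i)-M_{a_i}(B_i))$ of elementary functions $\sum_i c_i\mathbf 1_{]a_i,b_i]}(s)\mathbf 1_{B_i}(y)$ (finite sums, $0\le a_i\le b_i$, $B_i$ bounded Borel) that converge to $g$ in $\|\cdot\|$. A fundamental solution of $\partial_t^2-2\partial_t\partial_{x_1}-x_1^2\partial_{x_2}^2$ is a function $\Gamma(t,x_1,y_1,x_2)$ which, for every $y_1\in\mathbb R$, is locally integrable in $(t,x_1,x_2)\in\mathbb R^3$, vanishes for $t<0$, and satisfies $$(\partial_t^2-2\partial_t\partial_{x_1}-x_1^2\partial_{x_2}^2)\,\Gamma(\cdot,\cdot,y_1,\cdot)=\delta_{(0,y_1,0)}\quad\text{in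 }\mathcal D'(\mathbb R^3).$$ A random field solution of $$(\partial_t^2-2\partial_t\partial_{x_1}-x_1^2\partial_{x_2}^2)u=\dot F,\qquad u(0,\cdot)=0,\quad \partial_tu(0,\cdot)=0,\qquad(\ast)$$ is a process $\{u(t,x)\}_{t\ge0,\,x\in\mathbb R^2}$, jointly measurable in $(t,x,\omega)$, such that, with $\Gamma$ a fundamental solution, for all $t\ge0$ and $x\in\mathbb R^2$ the stochastic integral $$u(t,x_1,x_2)=\int_0^t\int_{\mathbb R^2}\Gamma(t-s,x_1,y_1,x_2-y_2)\,M(ds,dy_1,dy_2)\quad\text{a.s.}$$ is well defined. **Theorem 1.1.** Assume that $$\int_{\mathbb R^2}\frac{1}{1+|\xi|^{2/3}}\,d\mu(\xi)<+\infty .$$ Then the martingale measure $M$ of the noise exists, and for every version of it the equation $(\ast)$ admits a random field solution $\{u(t,x)\}_{t\ge 0,\,x\in\mathbb R^2}$ with the representation above, where $$\Gamma(t,x_1,y_1,x_2)=\frac{\sqrt3}{2\pi}\,\frac{1}{\sqrt{(y_1^3-x_1^3)(2t+x_1-y_1)-3x_2^2}}$$ if $t>0$, $y_1>x_1$ and $(y_1^3-x_1^3)(2t+x_1-y_1)-3x_2^2>0$,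 and $\Gamma(t,x_1,y_1,x_2)=0$ otherwise; in particular this $\Gamma$ is a fundamental solution of the operator. -/

import Mathlib

open MeasureTheory ProbabilityTheory Filter Topology
open scoped NNReal ENNReal

/-! Points of the plane `ℝ²` are pairs `(x₁, x₂) : ℝ × ℝ` and points of space-time `ℝ³` are triples
`(t, x₁, x₂) : ℝ × ℝ × ℝ`, both with Lebesgue measure (`volume` on the products). The norm that
`ℝ × ℝ` carries in Mathlib is the maximum norm, so the Euclidean norm `|ξ|` is written out. -/

noncomputable section

namespace DoubleChar

/-- The Euclidean norm `|ξ|` on the plane. -/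
def euclNorm (ξ : ℝ × ℝ) : ℝ := √(ξ.1 ^ 2 + ξ.2 ^ 2)

/-- The Fourier transform on the plane, `𝓕η(ξ) = ∫ exp(-i ξ·x) η(x) dx`. -/
def fourier (η : ℝ × ℝ → ℂ) (ξ : ℝ × ℝ) : ℂ :=
  ∫ x : ℝ × ℝ, Complex.exp (-Complex.I * ((ξ.1 * x.1 + ξ.2 * x.2 : ℝ) : ℂ)) * η x

/-- Real valued test functions on `ℝ³`: smooth with compact support
(here `⊤` is the top element of `ℕ∞`, that is, smoothness of class `C^∞`). -/
abbrev TestFn : Type :=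
  TestFunction (⊤ : TopologicalSpace.Opens (ℝ × ℝ × ℝ)) ℝ (⊤ : ℕ∞)

/-! ### The differential operator and its fundamental solution -/

/-- Partial derivative of a function on space-time in the direction `v`. -/
def partialD (v : ℝ × ℝ × ℝ) (φ : ℝ × ℝ × ℝ → ℝ) (p : ℝ × ℝ × ℝ) : ℝ := fderiv ℝ φ p v

/-- The operator `∂ₜ² - 2 ∂ₜ ∂_{x₁} - x₁² ∂_{x₂}²`. It coincides with its formal transpose. -/
def waveOp (φ : ℝ × ℝ × ℝ → ℝ) (p : ℝ × ℝ × ℝ) : ℝ :=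
  partialD (1, 0, 0) (partialD (1, 0, 0) φ) p
    - 2 * partialD (1, 0, 0) (partialD (0, 1, 0) φ) p
    - p.2.1 ^ 2 * partialD (0, 0, 1) (partialD (0, 0, 1) φ) p

/-- `G = G(t, x₁, y₁, x₂)` is a (causal) fundamental solution of the operator: for every `y₁`
the function `(t, x₁, x₂) ↦ G(t, x₁, y₁, x₂)` is locally integrable, vanishes for `t < 0`, and
solves `(∂ₜ² - 2 ∂ₜ ∂_{x₁} - x₁² ∂_{x₂}²) G = δ_{(0, y₁, 0)}` in the sense of distributions. -/
structure IsFundamentalSolution (G : ℝ → ℝ → ℝ → ℝ → ℝ) : Prop where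
  locallyIntegrable : ∀ y₁ : ℝ,
    LocallyIntegrable (fun p : ℝ × ℝ × ℝ => G p.1 p.2.1 y₁ p.2.2) volume
  causal : ∀ t x₁ y₁ x₂ : ℝ, t < 0 → G t x₁ y₁ x₂ = 0
  equation : ∀ (y₁ : ℝ) (φ : TestFn),
    ∫ p : ℝ × ℝ × ℝ, G p.1 p.2.1 y₁ p.2.2 * waveOp φ p = φ (0, y₁, 0)

open Classical in
/-- The explicit kernel `Γ(t, x₁, y₁, x₂)`. -/
def Gam (t x₁ y₁ x₂ : ℝ) : ℝ :=
  if 0 < t ∧ x₁ < y₁ ∧ 0 < (y₁ ^ 3 - x₁ ^ 3) * (2 * t + x₁ - y₁) - 3 * x₂ ^ 2 then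
    √3 / (2 * Real.pi) * (1 / √((y₁ ^ 3 - x₁ ^ 3) * (2 * t + x₁ - y₁) - 3 * x₂ ^ 2))
  else 0

/-! ### The noise -/

/-- `F` is a centred Gaussian family, indexed by the test functions, white in time and coloured in
space with covariance `E[F(φ) F(ψ)] = ∫_0^∞ ∫ ∫ φ(t,x) f(x-y) ψ(t,y) dy dx dt`. -/
structure IsColouredNoise {Ω : Type*} [MeasurableSpace Ω] (P : Measure Ω)
    (f : ℝ × ℝ → ℝ) (F : TestFn → Ω → ℝ) : Prop where
  gaussian : IsGaussianProcess F P
  centred : ∀ φ : TestFn, ∫ ω, F φ ω ∂P = 0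
  covariance : ∀ φ ψ : TestFn, ∫ ω, F φ ω * F ψ ω ∂P =
    ∫ t in Set.Ioi (0 : ℝ), ∫ x : ℝ × ℝ, ∫ y : ℝ × ℝ, φ (t, x) * f (x - y) * ψ (t, y)

/-- `μ` is the spectral measure of `f`: a nonnegative tempered measure on the plane with
`∫ f(x) η(x) dx = ∫ 𝓕η(ξ) dμ(ξ)` for all Schwartz functions `η`
(the integrals on the left being convergent). -/
structure IsSpectralMeasure (f : ℝ × ℝ → ℝ) (μ : Measure (ℝ × ℝ)) : Prop where
  tempered : μ.HasTemperateGrowth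
  integrable : ∀ η : SchwartzMap (ℝ × ℝ) ℂ, Integrable (fun x => (f x : ℂ) * η x) volume
  identity : ∀ η : SchwartzMap (ℝ × ℝ) ℂ,
    ∫ x, (f x : ℂ) * η x = ∫ ξ, fourier η ξ ∂μ

/-- The squared norm `∫_0^∞ ∫ |𝓕g(s,·)(ξ)|² dμ(ξ) ds` of a deterministic integrand `g = g(s, y)`,
which is the right hand side of the isometry that defines the stochastic integral. -/
def energy (μ : Measure (ℝ × ℝ)) (g : ℝ × ℝ × ℝ → ℝ) : ℝ≥0∞ :=
  ∫⁻ s in Set.Ioi (0 : ℝ), ∫⁻ ξ, ‖fourier (fun y => ((g (s, y) : ℝ) : ℂ)) ξ‖ₑ ^ 2 ∂μ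

/-- `X` is the value `F(A) = F(1_A)` of the noise on the set `A`, obtained by approximating
the indicator function of `A` by test functions: `X` is the limit in `L²(Ω)` of `F(φₙ)` for some
test functions `φₙ` that converge to `1_A` in the norm given by the covariance. -/
def IsNoiseOfSet {Ω : Type*} [MeasurableSpace Ω] (P : Measure Ω) (μ : Measure (ℝ × ℝ))
    (F : TestFn → Ω → ℝ) (A : Set (ℝ × ℝ × ℝ)) (X : Ω → ℝ) : Prop :=
  MemLp X 2 P ∧ ∃ φ : ℕ → TestFn,
    Tendsto (fun n => energy μ (fun p => φ n p - A.indicator (fun _ => (1 : ℝ)) p)) atTop (𝓝 0) ∧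
    Tendsto (fun n => eLpNorm (fun ω => F (φ n) ω - X ω) 2 P) atTop (𝓝 0)

/-- `M = (M_t(B))` is the martingale measure of the noise: `M_t(B) = F([0,t] × B)` for `t ≥ 0` and
bounded Borel sets `B` of the plane (the values for other `t`, `B` play no role). -/
def IsNoiseMartingaleMeasure {Ω : Type*} [MeasurableSpace Ω] (P : Measure Ω) (μ : Measure (ℝ × ℝ))
    (F : TestFn → Ω → ℝ) (M : ℝ → Set (ℝ × ℝ) → Ω → ℝ) : Prop :=
  ∀ t : ℝ, 0 ≤ t → ∀ B : Set (ℝ × ℝ), MeasurableSet B → Bornology.IsBounded B →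
    IsNoiseOfSet P μ F (Set.Icc 0 t ×ˢ B) (M t B)

/-! ### The stochastic integral of deterministic integrands -/

/-- A weighted box: the data of the function `c 1_{]a,b]}(s) 1_B(y)`. -/
structure Box where
  c : ℝ
  a : ℝ
  b : ℝ
  B : Set (ℝ × ℝ)
  a_nonneg : 0 ≤ a
  a_le_b : a ≤ b
  measurable_B : MeasurableSet B
  bounded_B : Bornology.IsBounded B

/-- The elementary function `∑ᵢ cᵢ 1_{]aᵢ,bᵢ]}(s) 1_{Bᵢ}(y)`. -/
def elemFun (L : List Box) (p : ℝ × ℝ × ℝ) : ℝ :=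
  (L.map fun e => (Set.Ioc e.a e.b ×ˢ e.B).indicator (fun _ => e.c) p).sum

/-- The integral `∑ᵢ cᵢ (M_{bᵢ}(Bᵢ) - M_{aᵢ}(Bᵢ))` of an elementary function. -/
def elemInt {Ω : Type*} (M : ℝ → Set (ℝ × ℝ) → Ω → ℝ) (L : List Box) (ω : Ω) : ℝ :=
  (L.map fun e => e.c * (M e.b e.B ω - M e.a e.B ω)).sum

/-- The stochastic integral `∫_0^∞ ∫ g(s,y) M(ds,dy)` of the deterministic function `g` is well
defined, with finite right hand side of the isometry, and equals `X`: the isometric extension to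
`L²(Ω)` of the integral of elementary functions. -/
structure HasStochIntegral {Ω : Type*} [MeasurableSpace Ω] (P : Measure Ω) (μ : Measure (ℝ × ℝ))
    (M : ℝ → Set (ℝ × ℝ) → Ω → ℝ) (g : ℝ × ℝ × ℝ → ℝ) (X : Ω → ℝ) : Prop where
  measurable : Measurable g
  integrable : ∀ᵐ s ∂(volume.restrict (Set.Ioi (0 : ℝ))), Integrable (fun y => g (s, y)) volume
  energy_lt_top : energy μ g < ∞
  memLp : MemLp X 2 P
  approx : ∃ L : ℕ → List Box,
    Tendsto (fun n => energy μ (fun p => elemFun (L n) p - g p)) atTop (𝓝 0) ∧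
    Tendsto (fun n => eLpNorm (fun ω => elemInt M (L n) ω - X ω) 2 P) atTop (𝓝 0)

/-- The integrand `(s, y) ↦ 1_{[0,t]}(s) G(t-s, x₁, y₁, x₂-y₂)`. -/
def solIntegrand (G : ℝ → ℝ → ℝ → ℝ → ℝ) (t : ℝ) (x : ℝ × ℝ) : ℝ × ℝ × ℝ → ℝ :=
  (Set.Icc 0 t ×ˢ (Set.univ : Set (ℝ × ℝ))).indicator
    fun p => G (t - p.1) x.1 p.2.1 (x.2 - p.2.2)

/-- `u` is a random field solution, with kernel `G`, of the equation
`(∂ₜ² - 2 ∂ₜ ∂_{x₁} - x₁² ∂_{x₂}²) u = Ḟ` with zero initial data, where `M` is the martingale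
measure of the noise: `G` is a fundamental solution of the operator, for all `t ≥ 0` and `x` one has
`u(t,x) = ∫_0^t ∫ G(t-s, x₁, y₁, x₂-y₂) M(ds,dy)` as a well defined stochastic integral, and
`u` is a (jointly) measurable process. -/
structure IsRandomFieldSolution {Ω : Type*} [MeasurableSpace Ω] (P : Measure Ω)
    (μ : Measure (ℝ × ℝ)) (M : ℝ → Set (ℝ × ℝ) → Ω → ℝ) (G : ℝ → ℝ → ℝ → ℝ → ℝ)
    (u : ℝ≥0 → ℝ × ℝ → Ω → ℝ) : Prop where
  fundamental : IsFundamentalSolution G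
  representation : ∀ (t : ℝ≥0) (x : ℝ × ℝ), HasStochIntegral P μ M (solIntegrand G t x) (u t x)
  measurable : Measurable fun q : (ℝ≥0 × (ℝ × ℝ)) × Ω => u q.1.1 q.1.2 q.2

end DoubleChar

end

noncomputable section

namespace DoubleChar

/-! The stochastic integral is an isometry, so the existence of the solution rests on one
deterministic estimate: the integrand built from the kernel has finite energy. Three ingredients
carry the theorem.

The kernel. In its last variable `Gam` is an arcsine density of radius `rad` and mass 1/2, so z =
rad cos θ turns it into the constant 1/(2π) on (0, π) (`integral_Gam_smul`). In the characteristic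
coordinates β = y₁ - x₁ and α = 2t - β the radius splits as `charFactor` times √α. The integral of
the operator applied to a test function then becomes an integral of exact derivatives in α, β and θ,
and the only surviving boundary term is 4π φ(0, y₁, 0) (`integral_charPath_waveOp`). This gives
`isFundamentalSolution_Gam`.

The decay. The same substitution writes the spatial Fourier transform of the kernel at time r, up to
a factor of constant modulus, as an integral `oscInt` of a Bessel function against a character. Let
h be its modulus. Then h is bounded, h |ξ₂|^(1/2) is bounded by the decay of the Bessel integral,
and h |ξ₁| ≤ C (1 + |ξ₂|) by integration by parts. Multiplying the last bound by h² and using the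
second gives h³ |ξ| ≤ C, hence h² ≤ C / (1 + |ξ|^(2/3)), uniformly in 0 < r ≤ T
(`exists_norm_oscInt_sq_mul_le`). This weight is the one in the hypothesis on μ.

The integral. `spec` sends an integrand to L²(ds μ(dξ)), with squared norm equal to the energy. The
spectral identity identifies the covariance of the noise with the inner product there
(`covariance_eq_inner`), so the noise extends to a continuous linear map J. Every version of M_t(B)
equals J of the corresponding indicator almost surely, and u(t, x) is J of the kernel. What remains
is density: bounded functions with bounded support are limits of test functions and of elementary
functions, by an energy bound in terms of sup and L¹ norms (`exists_lintegral_ft_sq_le`) and a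
monotone class argument; the unbounded kernel is reached by mollifying in space
(`mem_specPreimage_elem_of_slices`). Joint measurability comes from choosing, measurably in (t, x),
nearby points of a countable dense set (`exists_measurable_version`). -/

/-! ### The explicit kernel -/

/-- Half of the length of the support of `x₂ ↦ Gam t x₁ y₁ x₂`. -/
def rad (t x₁ y₁ : ℝ) : ℝ := √((y₁ ^ 3 - x₁ ^ 3) * (2 * t + x₁ - y₁) / 3)

theorem Gam_nonneg (t x₁ y₁ x₂ : ℝ) : 0 ≤ Gam t x₁ y₁ x₂ := by
  unfold Gam
  split_ifs <;> positivity

theorem cube_sub_pos {x y : ℝ} (h : x < y) : 0 < y ^ 3 - x ^ 3 :=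
  sub_pos.2 ((Odd.strictMono_pow (by decide : Odd 3)) h)

theorem rad_pos {t x₁ y₁ : ℝ} (h₁ : x₁ < y₁) (h₂ : y₁ < x₁ + 2 * t) : 0 < rad t x₁ y₁ := by
  have h := cube_sub_pos h₁
  have : 0 < 2 * t + x₁ - y₁ := by linarith
  unfold rad
  positivity

/-- Since y₁³ - x₁³ > 0, positivity of the radicand forces 2t + x₁ - y₁ > 0. The support therefore
lies in the strip x₁ < y₁ < x₁ + 2t, which is empty for t ≤ 0; causality follows. -/
theorem Gam_eq_zero_of_not {t x₁ y₁ : ℝ} (h : ¬ (x₁ < y₁ ∧ y₁ < x₁ + 2 * t)) (x₂ : ℝ) :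
    Gam t x₁ y₁ x₂ = 0 := by
  unfold Gam
  rw [if_neg]
  rintro ⟨_, h₁, h₂⟩
  have h₃ := cube_sub_pos h₁
  have h₄ : 0 < (y₁ ^ 3 - x₁ ^ 3) * (2 * t + x₁ - y₁) := by nlinarith [sq_nonneg x₂]
  exact h ⟨h₁, by linarith [(mul_pos_iff_of_pos_left h₃).1 h₄]⟩

theorem Gam_causal (t x₁ y₁ x₂ : ℝ) (h : t < 0) : Gam t x₁ y₁ x₂ = 0 :=
  Gam_eq_zero_of_not (fun h' => by linarith [h'.1, h'.2]) x₂

/-- Factoring 3 out of the radicand cancels the √3 of the normalisation and exhibits the arcsine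
profile of radius `rad`. -/
theorem Gam_of_mem {t x₁ y₁ : ℝ} (h₁ : x₁ < y₁) (h₂ : y₁ < x₁ + 2 * t) (z : ℝ) :
    Gam t x₁ y₁ z = (Set.Ioo (-rad t x₁ y₁) (rad t x₁ y₁)).indicator
      (fun z => (2 * Real.pi)⁻¹ / √(rad t x₁ y₁ ^ 2 - z ^ 2)) z := by
  have h := cube_sub_pos h₁
  have h' : 0 < 2 * t + x₁ - y₁ := by linarith
  have hR := rad_pos h₁ h₂
  have hsq : rad t x₁ y₁ ^ 2 = (y₁ ^ 3 - x₁ ^ 3) * (2 * t + x₁ - y₁) / 3 :=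
    Real.sq_sqrt (by positivity)
  have hA : (y₁ ^ 3 - x₁ ^ 3) * (2 * t + x₁ - y₁) - 3 * z ^ 2
      = 3 * (rad t x₁ y₁ ^ 2 - z ^ 2) := by rw [hsq]; ring
  unfold Gam
  rw [hA]
  by_cases hz : z ∈ Set.Ioo (-rad t x₁ y₁) (rad t x₁ y₁)
  · have hz' : 0 < rad t x₁ y₁ ^ 2 - z ^ 2 := by nlinarith [hz.1, hz.2]
    rw [Set.indicator_of_mem hz, if_pos ⟨by linarith, h₁, by positivity⟩,
      Real.sqrt_mul (by norm_num)]
    have : √3 ≠ 0 := by positivity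
    field_simp
  · rw [Set.indicator_of_notMem hz, if_neg]
    rintro ⟨_, _, h₃⟩
    have h₄ : z ^ 2 < rad t x₁ y₁ ^ 2 := by linarith
    exact hz (abs_lt.1 (abs_lt_of_sq_lt_sq h₄ hR.le))

theorem measurable_Gam :
    Measurable fun p : ℝ × ℝ × ℝ × ℝ => Gam p.1 p.2.1 p.2.2.1 p.2.2.2 := by
  unfold Gam
  refine Measurable.ite ?_ (by fun_prop) measurable_const
  have h₁ : MeasurableSet {p : ℝ × ℝ × ℝ × ℝ | 0 < p.1} := measurableSet_lt (by fun_prop) (by fun_prop)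
  have h₂ : MeasurableSet {p : ℝ × ℝ × ℝ × ℝ | p.2.1 < p.2.2.1} :=
    measurableSet_lt (by fun_prop) (by fun_prop)
  have h₃ : MeasurableSet {p : ℝ × ℝ × ℝ × ℝ |
      0 < (p.2.2.1 ^ 3 - p.2.1 ^ 3) * (2 * p.1 + p.2.1 - p.2.2.1) - 3 * p.2.2.2 ^ 2} :=
    measurableSet_lt (by fun_prop) (by fun_prop)
  exact h₁.inter (h₂.inter h₃)

/-! ### The substitution z = R cos θ in the last variable -/

theorem image_mul_cos {R : ℝ} (hR : 0 < R) :
    (fun θ => R * Real.cos θ) '' Set.Ioo 0 Real.pi = Set.Ioo (-R) R := by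
  ext z
  simp only [Set.mem_image, Set.mem_Ioo]
  constructor
  · rintro ⟨θ, ⟨h0, hπ⟩, rfl⟩
    have h1 : Real.cos θ < 1 := by
      rw [← Real.cos_zero]; exact Real.cos_lt_cos_of_nonneg_of_le_pi le_rfl hπ.le h0
    have h2 : -1 < Real.cos θ := by
      rw [← Real.cos_pi]; exact Real.cos_lt_cos_of_nonneg_of_le_pi h0.le le_rfl hπ
    constructor <;> nlinarith
  · rintro ⟨h1, h2⟩
    have h3 : z / R < 1 := (div_lt_one hR).2 h2
    have h4 : -1 < z / R := by rw [lt_div_iff₀ hR]; linarith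
    refine ⟨Real.arccos (z / R), ⟨Real.arccos_pos.2 h3, ?_⟩, ?_⟩
    · refine lt_of_le_of_ne (Real.arccos_le_pi _) fun h => ?_
      rw [Real.arccos_eq_pi] at h
      linarith
    · rw [Real.cos_arccos h4.le h3.le]; field_simp

/-- The Jacobian R sin θ cancels the inverse square root singularity at the edge of the support, so
the kernel becomes a uniform density in θ. Later integrals against the kernel use it in this form.
-/
theorem Gam_mul_cos {t x₁ y₁ θ : ℝ} (h₁ : x₁ < y₁) (h₂ : y₁ < x₁ + 2 * t)
    (hθ : θ ∈ Set.Ioo 0 Real.pi) :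
    |rad t x₁ y₁ * -Real.sin θ| * Gam t x₁ y₁ (rad t x₁ y₁ * Real.cos θ)
      = (2 * Real.pi)⁻¹ := by
  have hR := rad_pos h₁ h₂
  have hs := Real.sin_pos_of_mem_Ioo hθ
  have hm : rad t x₁ y₁ * Real.cos θ ∈ Set.Ioo (-rad t x₁ y₁) (rad t x₁ y₁) := by
    rw [← image_mul_cos hR]; exact ⟨θ, hθ, rfl⟩
  have hq : rad t x₁ y₁ ^ 2 - (rad t x₁ y₁ * Real.cos θ) ^ 2
      = (rad t x₁ y₁ * Real.sin θ) ^ 2 := by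
    have := Real.sin_sq_add_cos_sq θ
    linear_combination (-(rad t x₁ y₁) ^ 2) * this
  rw [Gam_of_mem h₁ h₂, Set.indicator_of_mem hm, hq, Real.sqrt_sq (by positivity), mul_neg,
    abs_neg, abs_of_pos (by positivity)]
  field_simp

section
variable {E : Type*} [NormedAddCommGroup E] [NormedSpace ℝ E]

theorem hasDerivWithinAt_mul_cos (R : ℝ) (s : Set ℝ) (θ : ℝ) :
    HasDerivWithinAt (fun θ => R * Real.cos θ) (R * -Real.sin θ) s θ :=
  ((Real.hasDerivAt_cos θ).const_mul R).hasDerivWithinAt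

theorem injOn_mul_cos {R : ℝ} (hR : 0 < R) :
    Set.InjOn (fun θ => R * Real.cos θ) (Set.Ioo 0 Real.pi) := fun _ ha _ hb h =>
  Real.injOn_cos (Set.Ioo_subset_Icc_self ha) (Set.Ioo_subset_Icc_self hb)
    (mul_left_cancel₀ hR.ne' h)

theorem Gam_smul_eq_indicator {t x₁ y₁ : ℝ} (h₁ : x₁ < y₁) (h₂ : y₁ < x₁ + 2 * t) (h : ℝ → E) :
    (fun z => Gam t x₁ y₁ z • h z) = (Set.Ioo (-rad t x₁ y₁) (rad t x₁ y₁)).indicator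
      (fun z => Gam t x₁ y₁ z • h z) := by
  symm
  rw [Set.indicator_eq_self]
  intro z hz
  by_contra hz'
  apply hz
  simp only [Gam_of_mem h₁ h₂, Set.indicator_of_notMem hz', zero_smul]

/-- Averaging against the kernel in the last variable. -/
theorem integral_Gam_smul {t x₁ y₁ : ℝ} (h₁ : x₁ < y₁) (h₂ : y₁ < x₁ + 2 * t) (h : ℝ → E) :
    ∫ z, Gam t x₁ y₁ z • h z
      = (2 * Real.pi)⁻¹ • ∫ θ in Set.Ioo 0 Real.pi, h (rad t x₁ y₁ * Real.cos θ) := by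
  have hR := rad_pos h₁ h₂
  rw [Gam_smul_eq_indicator h₁ h₂, integral_indicator measurableSet_Ioo, ← image_mul_cos hR,
    integral_image_eq_integral_abs_deriv_smul measurableSet_Ioo
      (fun θ _ => hasDerivWithinAt_mul_cos _ _ θ) (injOn_mul_cos hR), ← integral_smul]
  refine setIntegral_congr_fun measurableSet_Ioo fun θ hθ => ?_
  simp only [smul_smul, Gam_mul_cos h₁ h₂ hθ]

theorem integrable_Gam_smul {t x₁ y₁ : ℝ} (h₁ : x₁ < y₁) (h₂ : y₁ < x₁ + 2 * t) {h : ℝ → E}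
    (hh : IntegrableOn (fun θ => h (rad t x₁ y₁ * Real.cos θ)) (Set.Ioo 0 Real.pi)) :
    Integrable fun z => Gam t x₁ y₁ z • h z := by
  have hR := rad_pos h₁ h₂
  rw [Gam_smul_eq_indicator h₁ h₂, integrable_indicator_iff measurableSet_Ioo, ← image_mul_cos hR,
    integrableOn_image_iff_integrableOn_abs_deriv_smul measurableSet_Ioo
      (fun θ _ => hasDerivWithinAt_mul_cos _ _ θ) (injOn_mul_cos hR)]
  refine IntegrableOn.congr_fun (hh.smul (2 * Real.pi)⁻¹) (fun θ hθ => ?_) measurableSet_Ioo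
  simp only [Pi.smul_apply, smul_smul, Gam_mul_cos h₁ h₂ hθ]

end

theorem integrable_Gam (t x₁ y₁ : ℝ) : Integrable fun z => Gam t x₁ y₁ z := by
  by_cases h : x₁ < y₁ ∧ y₁ < x₁ + 2 * t
  · have := integrable_Gam_smul (h := fun _ => (1 : ℝ)) h.1 h.2
      (integrableOn_const (by simp))
    simpa using this
  · simp [Gam_eq_zero_of_not h]

theorem integral_Gam (t x₁ y₁ : ℝ) :
    ∫ z, Gam t x₁ y₁ z = (Set.Ioo x₁ (x₁ + 2 * t)).indicator (fun _ => (1 / 2 : ℝ)) y₁ := by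
  by_cases h : x₁ < y₁ ∧ y₁ < x₁ + 2 * t
  · have := integral_Gam_smul (h := fun _ => (1 : ℝ)) h.1 h.2
    simp only [smul_eq_mul, mul_one] at this
    rw [this, Set.indicator_of_mem (by exact h)]
    have hpi := Real.pi_pos
    simp [hpi.le]
    field_simp
  · rw [Set.indicator_of_notMem (by exact h)]
    simp [Gam_eq_zero_of_not h]

theorem lintegral_Gam (t x₁ y₁ : ℝ) :
    ∫⁻ z, ‖Gam t x₁ y₁ z‖ₑ
      = (Set.Ioo x₁ (x₁ + 2 * t)).indicator (fun _ => ENNReal.ofReal (1 / 2)) y₁ := by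
  have : ∀ z, ‖Gam t x₁ y₁ z‖ₑ = ENNReal.ofReal (Gam t x₁ y₁ z) := fun z =>
    Real.enorm_of_nonneg (Gam_nonneg _ _ _ _)
  simp_rw [this]
  rw [← ofReal_integral_eq_lintegral_ofReal (integrable_Gam t x₁ y₁)
    (Eventually.of_forall fun z => Gam_nonneg _ _ _ _), integral_Gam]
  by_cases h : y₁ ∈ Set.Ioo x₁ (x₁ + 2 * t)
  · rw [Set.indicator_of_mem h, Set.indicator_of_mem h]
  · rw [Set.indicator_of_notMem h, Set.indicator_of_notMem h, ENNReal.ofReal_zero]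

theorem locallyIntegrable_Gam (y₁ : ℝ) :
    LocallyIntegrable (fun p : ℝ × ℝ × ℝ => Gam p.1 p.2.1 y₁ p.2.2) volume := by
  have hm : Measurable fun p : ℝ × ℝ × ℝ => Gam p.1 p.2.1 y₁ p.2.2 :=
    measurable_Gam.comp (f := fun p : ℝ × ℝ × ℝ => (p.1, p.2.1, y₁, p.2.2)) (by fun_prop)
  -- Only t and x₁ have to be confined: each slice in x₂ has total mass at most 1/2.
  have key : ∀ N : ℝ, IntegrableOn (fun p : ℝ × ℝ × ℝ => Gam p.1 p.2.1 y₁ p.2.2)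
      (Set.Icc (-N) N ×ˢ Set.Icc (-N) N ×ˢ Set.univ) volume := by
    intro N
    refine ⟨hm.aestronglyMeasurable, ?_⟩
    rw [hasFiniteIntegral_iff_enorm]
    calc ∫⁻ p in Set.Icc (-N) N ×ˢ Set.Icc (-N) N ×ˢ Set.univ, ‖Gam p.1 p.2.1 y₁ p.2.2‖ₑ
        = ∫⁻ t in Set.Icc (-N) N, ∫⁻ x in Set.Icc (-N) N, ∫⁻ z, ‖Gam t x y₁ z‖ₑ := by
          rw [Measure.volume_eq_prod, ← Measure.prod_restrict, lintegral_prod _ (by fun_prop)]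
          refine lintegral_congr fun t => ?_
          rw [Measure.volume_eq_prod, ← Measure.prod_restrict, lintegral_prod _ ?_]
          · simp
          · exact (hm.comp (measurable_const.prodMk measurable_id)).enorm.aemeasurable
      _ ≤ ∫⁻ t in Set.Icc (-N) N, ∫⁻ x in Set.Icc (-N) N, 1 := by
          gcongr with t x
          rw [lintegral_Gam]
          by_cases h : y₁ ∈ Set.Ioo x (x + 2 * t)
          · rw [Set.indicator_of_mem h]
            exact ENNReal.ofReal_le_one.2 (by norm_num)
          · rw [Set.indicator_of_notMem h]; exact zero_le
      _ < ∞ := by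
          simp only [lintegral_const, Measure.restrict_apply MeasurableSet.univ, Set.univ_inter,
            one_mul, Real.volume_Icc]
          exact ENNReal.mul_lt_top ENNReal.ofReal_lt_top ENNReal.ofReal_lt_top
  intro p
  refine ⟨Set.Icc (-(|p.1| + |p.2.1| + 1)) (|p.1| + |p.2.1| + 1) ×ˢ
    Set.Icc (-(|p.1| + |p.2.1| + 1)) (|p.1| + |p.2.1| + 1) ×ˢ Set.univ, ?_, key _⟩
  have h1 := neg_abs_le p.1
  have h2 := le_abs_self p.1
  have h3 := neg_abs_le p.2.1
  have h4 := le_abs_self p.2.1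
  have h5 := abs_nonneg p.1
  have h6 := abs_nonneg p.2.1
  exact prod_mem_nhds (Icc_mem_nhds (by linarith) (by linarith))
    (prod_mem_nhds (Icc_mem_nhds (by linarith) (by linarith)) univ_mem)

/-! ### Partial derivatives of test functions -/

section Partial
variable {φ : ℝ × ℝ × ℝ → ℝ}

theorem contDiff_partialD (hφ : ContDiff ℝ (⊤ : ℕ∞) φ) (v : ℝ × ℝ × ℝ) :
    ContDiff ℝ (⊤ : ℕ∞) (partialD v φ) :=
  (hφ.fderiv_right (m := (⊤ : ℕ∞)) (by simp)).clm_apply contDiff_const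

theorem hasCompactSupport_partialD (hc : HasCompactSupport φ) (v : ℝ × ℝ × ℝ) :
    HasCompactSupport (partialD v φ) := hc.fderiv_apply ℝ v

theorem partialD_comm (hφ : ContDiff ℝ (⊤ : ℕ∞) φ) (u v p : ℝ × ℝ × ℝ) :
    partialD u (partialD v φ) p = partialD v (partialD u φ) p := by
  have hd : DifferentiableAt ℝ (fderiv ℝ φ) p :=
    ((hφ.fderiv_right (m := (⊤ : ℕ∞)) (by simp)).differentiable (by simp)).differentiableAt
  have h : ∀ a b : ℝ × ℝ × ℝ, partialD a (partialD b φ) p = fderiv ℝ (fderiv ℝ φ) p a b := by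
    intro a b
    change fderiv ℝ (fun q => fderiv ℝ φ q b) p a = _
    rw [fderiv_clm_apply hd (differentiableAt_const b)]
    simp
  rw [h, h]
  exact (hφ.contDiffAt.isSymmSndFDerivAt (by simp; exact WithTop.coe_le_coe.2 (le_top : (2 : ℕ∞) ≤ ⊤))).eq u v

theorem fderiv_eq_partialD (φ : ℝ × ℝ × ℝ → ℝ) (p : ℝ × ℝ × ℝ) (a b c : ℝ) :
    fderiv ℝ φ p (a, b, c)
      = a * partialD (1, 0, 0) φ p + b * partialD (0, 1, 0) φ p + c * partialD (0, 0, 1) φ p := by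
  have : ((a, b, c) : ℝ × ℝ × ℝ)
      = a • ((1, 0, 0) : ℝ × ℝ × ℝ) + b • ((0, 1, 0) : ℝ × ℝ × ℝ) + c • ((0, 0, 1) : ℝ × ℝ × ℝ) := by
    simp
  rw [this, map_add, map_add, map_smul, map_smul, map_smul]
  rfl

/-- The half-space is described through 2t because 2t = α + β in characteristic coordinates; a
single length L > K then cuts off both α and β. -/
theorem partialD_vanish {K : ℝ} (hK : ∀ p : ℝ × ℝ × ℝ, K < 2 * p.1 → φ p = 0) (v : ℝ × ℝ × ℝ)
    (p : ℝ × ℝ × ℝ) (hp : K < 2 * p.1) : partialD v φ p = 0 := by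
  have ho : IsOpen {q : ℝ × ℝ × ℝ | K < 2 * q.1} := isOpen_lt (by fun_prop) (by fun_prop)
  have : φ =ᶠ[𝓝 p] fun _ => 0 := by
    filter_upwards [ho.mem_nhds hp] with q hq using hK q hq
  rw [partialD, this.fderiv_eq]
  simp

/-- With ∂ₜ innermost, the first two terms are first derivatives of ∂ₜφ, ready to be read as a
derivative along β. -/
theorem waveOp_eq (hφ : ContDiff ℝ (⊤ : ℕ∞) φ) (p : ℝ × ℝ × ℝ) :
    waveOp φ p = partialD (1, 0, 0) (partialD (1, 0, 0) φ) p
      - 2 * partialD (0, 1, 0) (partialD (1, 0, 0) φ) p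
      - p.2.1 ^ 2 * partialD (0, 0, 1) (partialD (0, 0, 1) φ) p := by
  rw [waveOp, partialD_comm hφ (1, 0, 0) (0, 1, 0)]

theorem continuous_waveOp (hφ : ContDiff ℝ (⊤ : ℕ∞) φ) : Continuous (waveOp φ) := by
  have h := fun u v => (contDiff_partialD (contDiff_partialD hφ v) u).continuous
  exact ((h _ _).sub (continuous_const.mul (h _ _))).sub
    ((by fun_prop : Continuous fun p : ℝ × ℝ × ℝ => p.2.1 ^ 2).mul (h _ _))

theorem hasCompactSupport_waveOp (hc : HasCompactSupport φ) : HasCompactSupport (waveOp φ) := by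
  have h := fun u v => hasCompactSupport_partialD (hasCompactSupport_partialD hc v) u
  exact ((h _ _).sub ((h _ _).mul_left (f := fun _ => (2 : ℝ)))).sub
    ((h _ _).mul_left (f := fun p : ℝ × ℝ × ℝ => p.2.1 ^ 2))

theorem waveOp_vanish {K : ℝ} (hK : ∀ p : ℝ × ℝ × ℝ, K < 2 * p.1 → φ p = 0)
    (p : ℝ × ℝ × ℝ) (hp : K < 2 * p.1) : waveOp φ p = 0 := by
  have h := fun u v => partialD_vanish (partialD_vanish hK v) u p hp
  simp [waveOp, h]

end Partial

/-! ### Characteristic coordinates -/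

/-- The factor of `rad` depending on the characteristic coordinate `β = y₁ - x₁` only. -/
def charFactor (y β : ℝ) : ℝ := √((y ^ 3 - (y - β) ^ 3) / 3)

/-- The derivative of `charFactor` in `β`. -/
def charFactor' (y β : ℝ) : ℝ := (y - β) ^ 2 / (2 * charFactor y β)

theorem continuous_charFactor (y : ℝ) : Continuous (charFactor y) := by
  unfold charFactor; fun_prop

theorem measurable_charFactor' (y : ℝ) : Measurable (charFactor' y) := by
  have := (continuous_charFactor y).measurable
  unfold charFactor'
  fun_prop

theorem charFactor_zero (y : ℝ) : charFactor y 0 = 0 := by simp [charFactor]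

theorem charFactor_pos {β : ℝ} (y : ℝ) (hβ : 0 < β) : 0 < charFactor y β := by
  have := cube_sub_pos (show y - β < y by linarith)
  unfold charFactor
  positivity

theorem charFactor'_nonneg (y β : ℝ) : 0 ≤ charFactor' y β := by
  unfold charFactor' charFactor
  positivity

/-- The derivative of `charFactor` squared is (y - β)², which is x₁² along the path: the variable
coefficient of the operator. This is why the kernel contains cubes. -/
theorem charFactor_mul_charFactor' (y : ℝ) {β : ℝ} (hβ : 0 < β) :
    2 * (charFactor y β * charFactor' y β) = (y - β) ^ 2 := by
  have := charFactor_pos y hβ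
  unfold charFactor'
  field_simp

theorem hasDerivAt_charFactor (y : ℝ) {β : ℝ} (hβ : 0 < β) :
    HasDerivAt (charFactor y) (charFactor' y β) β := by
  have h := cube_sub_pos (show y - β < y by linarith)
  have h1 : HasDerivAt (fun β => (y ^ 3 - (y - β) ^ 3) / 3) ((y - β) ^ 2) β := by
    have := ((((hasDerivAt_id β).const_sub y).pow 3).const_sub (y ^ 3)).div_const 3
    convert! this using 1
    simp
  exact h1.sqrt (by positivity)

/-- For y ≠ 0 the derivative blows up like β^(-1/2) at the origin. It is still integrable, being the
nonnegative derivative of a continuous function. -/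
theorem integrableOn_charFactor' (y L : ℝ) : IntegrableOn (charFactor' y) (Set.Ioc 0 L) :=
  intervalIntegral.integrableOn_deriv_of_nonneg (continuous_charFactor y).continuousOn
    (fun _ hx => hasDerivAt_charFactor y hx.1) fun _ _ => charFactor'_nonneg _ _

/-- The change of variables to characteristic coordinates. -/
def charPath (y β α θ : ℝ) : ℝ × ℝ × ℝ :=
  ((α + β) / 2, y - β, charFactor y β * √α * Real.cos θ)

theorem continuous_charPath (y : ℝ) :
    Continuous fun q : ℝ × ℝ × ℝ => charPath y q.1 q.2.1 q.2.2 := by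
  have := continuous_charFactor y
  unfold charPath
  fun_prop

theorem rad_eq (y : ℝ) {β : ℝ} (α : ℝ) (hβ : 0 < β) :
    rad ((α + β) / 2) (y - β) y = charFactor y β * √α := by
  have := cube_sub_pos (show y - β < y by linarith)
  rw [rad, charFactor, ← Real.sqrt_mul (by positivity)]
  congr 1
  ring

section Deriv
variable {g : ℝ × ℝ × ℝ → ℝ}

/-- Applied to g = ∂ₜφ and doubled, this derivative reproduces the terms ∂ₜ² - 2∂ₜ∂_{x₁} of the
operator, up to a term in ∂_{x₂}∂ₜφ. -/
theorem hasDerivAt_comp_charPath_beta (hg : Differentiable ℝ g) (y : ℝ) {β : ℝ} (hβ : 0 < β)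
    (α θ : ℝ) :
    HasDerivAt (fun β => g (charPath y β α θ))
      (1 / 2 * partialD (1, 0, 0) g (charPath y β α θ) - partialD (0, 1, 0) g (charPath y β α θ)
        + charFactor' y β * √α * Real.cos θ * partialD (0, 0, 1) g (charPath y β α θ)) β := by
  have h1 : HasDerivAt (fun β => charPath y β α θ)
      ((1 / 2, -1, charFactor' y β * √α * Real.cos θ) : ℝ × ℝ × ℝ) β := by
    refine HasDerivAt.prodMk ?_ (HasDerivAt.prodMk ?_ ?_)
    · exact ((hasDerivAt_id β).const_add α).div_const 2
    · exact (hasDerivAt_id β).const_sub y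
    · exact ((hasDerivAt_charFactor y hβ).mul_const _).mul_const _
  have h2 := (hg (charPath y β α θ)).hasFDerivAt.comp_hasDerivAt β h1
  rw [fderiv_eq_partialD] at h2
  convert! h2 using 1
  ring

theorem hasDerivAt_comp_charPath_alpha (hg : Differentiable ℝ g) (y β : ℝ) {α : ℝ} (hα : 0 < α)
    (θ : ℝ) :
    HasDerivAt (fun α => g (charPath y β α θ))
      (1 / 2 * partialD (1, 0, 0) g (charPath y β α θ)
        + charFactor y β * (1 / (2 * √α)) * Real.cos θ *
          partialD (0, 0, 1) g (charPath y β α θ)) α := by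
  have h1 : HasDerivAt (fun α => charPath y β α θ)
      ((1 / 2, 0, charFactor y β * (1 / (2 * √α)) * Real.cos θ) : ℝ × ℝ × ℝ) α := by
    refine HasDerivAt.prodMk ?_ (HasDerivAt.prodMk ?_ ?_)
    · exact ((hasDerivAt_id α).add_const β).div_const 2
    · exact hasDerivAt_const _ _
    · exact ((Real.hasDerivAt_sqrt hα.ne').const_mul _).mul_const _
  have h2 := (hg (charPath y β α θ)).hasFDerivAt.comp_hasDerivAt α h1
  rw [fderiv_eq_partialD] at h2
  convert! h2 using 1
  ring

theorem hasDerivAt_comp_charPath_theta (hg : Differentiable ℝ g) (y β α θ : ℝ) :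
    HasDerivAt (fun θ => g (charPath y β α θ))
      (-(charFactor y β * √α * Real.sin θ * partialD (0, 0, 1) g (charPath y β α θ))) θ := by
  have h1 : HasDerivAt (fun θ => charPath y β α θ)
      ((0, 0, charFactor y β * √α * -Real.sin θ) : ℝ × ℝ × ℝ) θ := by
    refine HasDerivAt.prodMk ?_ (HasDerivAt.prodMk ?_ ?_)
    · exact hasDerivAt_const _ _
    · exact hasDerivAt_const _ _
    · exact (Real.hasDerivAt_cos θ).const_mul _
  have h2 := (hg (charPath y β α θ)).hasFDerivAt.comp_hasDerivAt θ h1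
  rw [fderiv_eq_partialD] at h2
  convert! h2 using 1
  ring

end Deriv

/-- Integration against the kernel in characteristic coordinates. -/
theorem integral_Gam_mul_eq {W : ℝ × ℝ × ℝ → ℝ} (hW : Continuous W) (hc : HasCompactSupport W)
    (y : ℝ) :
    ∫ p : ℝ × ℝ × ℝ, Gam p.1 p.2.1 y p.2.2 * W p
      = (4 * Real.pi)⁻¹ * ∫ β in Set.Ioi 0, ∫ α in Set.Ioi 0, ∫ θ in Set.Ioo 0 Real.pi,
          W (charPath y β α θ) := by
  have hint : Integrable fun p : ℝ × ℝ × ℝ => Gam p.1 p.2.1 y p.2.2 * W p :=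
    (locallyIntegrable_Gam y).integrable_smul_right_of_hasCompactSupport hW hc
  have hint' : Integrable fun p : (ℝ × ℝ) × ℝ => Gam p.1.1 p.1.2 y p.2 * W (p.1.1, p.1.2, p.2) := by
    have := (measurePreserving_prodAssoc (volume : Measure ℝ) (volume : Measure ℝ)
      (volume : Measure ℝ)).integrable_comp_of_integrable (g := fun p : ℝ × ℝ × ℝ =>
        Gam p.1 p.2.1 y p.2.2 * W p) hint
    exact this
  set G : ℝ → ℝ → ℝ := fun t x => ∫ z, Gam t x y z * W (t, x, z) with hG
  have hGint : Integrable (Function.uncurry G) (volume.prod volume) := hint'.integral_prod_left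
  have e1 : ∫ p : ℝ × ℝ × ℝ, Gam p.1 p.2.1 y p.2.2 * W p = ∫ t, ∫ x, G t x := by
    have := (measurePreserving_prodAssoc (volume : Measure ℝ) (volume : Measure ℝ)
      (volume : Measure ℝ)).integral_comp (MeasurableEquiv.prodAssoc.measurableEmbedding)
        (fun p : ℝ × ℝ × ℝ => Gam p.1 p.2.1 y p.2.2 * W p)
    exact this.symm.trans ((integral_prod _ hint').trans (integral_prod _ hGint))
  have e2 : ∀ β α : ℝ, G ((α + β) / 2) (y - β)
      = (Set.Ioi 0 ×ˢ Set.Ioi 0).indicator (fun q : ℝ × ℝ => (2 * Real.pi)⁻¹ *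
          ∫ θ in Set.Ioo 0 Real.pi, W (charPath y q.1 q.2 θ)) (β, α) := by
    intro β α
    by_cases h : 0 < β ∧ 0 < α
    · rw [Set.indicator_of_mem (by exact ⟨h.1, h.2⟩)]
      have h1 : y - β < y := by linarith [h.1]
      have h2 : y < y - β + 2 * ((α + β) / 2) := by linarith [h.2]
      have := integral_Gam_smul h1 h2 (fun z => W ((α + β) / 2, y - β, z))
      simp only [smul_eq_mul] at this
      rw [hG]
      simp only
      rw [this, rad_eq y α h.1]
      rfl
    · rw [Set.indicator_of_notMem (by exact h)]
      simp only [hG]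
      have : ∀ z, Gam ((α + β) / 2) (y - β) y z = 0 := by
        refine Gam_eq_zero_of_not fun h' => h ⟨by linarith [h'.1], by linarith [h'.2]⟩
      simp [this]
  -- Put x₁ = y - β, and then t = (α + β)/2 at fixed β; the Jacobian of the second step is 1/2.
  -- Together with the factor 1/(2π) of the arcsine substitution it produces 1/(4π).
  have e3 : ∫ t, ∫ x, G t x = ∫ β, (2 : ℝ)⁻¹ * ∫ α, G ((α + β) / 2) (y - β) := by
    rw [integral_integral_swap hGint, ← integral_sub_left_eq_self (fun x => ∫ t, G t x) volume y]
    refine integral_congr_ae (Eventually.of_forall fun β => ?_)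
    simp only
    have h1 := Measure.integral_comp_div (fun t => G t (y - β)) 2
    have h2 := integral_add_right_eq_self (μ := volume) (fun α => G (α / 2) (y - β)) β
    rw [h2, h1]
    simp
  rw [e1, e3]
  have e4 : ∀ β : ℝ, (2 : ℝ)⁻¹ * ∫ α, G ((α + β) / 2) (y - β)
      = (Set.Ioi 0).indicator (fun β => (4 * Real.pi)⁻¹ * ∫ α in Set.Ioi 0,
          ∫ θ in Set.Ioo 0 Real.pi, W (charPath y β α θ)) β := by
    intro β
    simp_rw [e2]
    by_cases hβ : 0 < β
    · rw [Set.indicator_of_mem (by exact hβ)]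
      have : ∀ α : ℝ, (Set.Ioi 0 ×ˢ Set.Ioi 0).indicator (fun q : ℝ × ℝ => (2 * Real.pi)⁻¹ *
          ∫ θ in Set.Ioo 0 Real.pi, W (charPath y q.1 q.2 θ)) (β, α)
          = (2 * Real.pi)⁻¹ * (Set.Ioi 0).indicator (fun α =>
            ∫ θ in Set.Ioo 0 Real.pi, W (charPath y β α θ)) α := by
        intro α
        by_cases hα : 0 < α
        · rw [Set.indicator_of_mem (by exact ⟨hβ, hα⟩), Set.indicator_of_mem (by exact hα)]
        · rw [Set.indicator_of_notMem (by exact fun h => hα h.2),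
            Set.indicator_of_notMem (by exact hα), mul_zero]
      simp_rw [this]
      rw [integral_const_mul, integral_indicator measurableSet_Ioi, ← mul_assoc]
      congr 1
      rw [← mul_inv]
      ring
    · rw [Set.indicator_of_notMem (by exact hβ)]
      have : ∀ α : ℝ, (Set.Ioi 0 ×ˢ Set.Ioi 0).indicator (fun q : ℝ × ℝ => (2 * Real.pi)⁻¹ *
          ∫ θ in Set.Ioo 0 Real.pi, W (charPath y q.1 q.2 θ)) (β, α) = 0 := fun α =>
        Set.indicator_of_notMem (by exact fun h => hβ h.1) _
      simp_rw [this, integral_zero, mul_zero]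
  simp_rw [e4]
  rw [integral_indicator measurableSet_Ioi, integral_const_mul]

/-! ### The explicit kernel is a fundamental solution -/

section Fundamental
variable {φ : ℝ × ℝ × ℝ → ℝ}

theorem integrable_of_le_charFactor' {y L C₀ C₁ : ℝ} {f : ℝ × ℝ × ℝ → ℝ} (hf : Measurable f)
    (hb : ∀ β α θ : ℝ, 0 < β → β ≤ L → 0 < α → α ≤ L →
      ‖f (β, α, θ)‖ ≤ C₀ + C₁ * charFactor' y β) :
    Integrable f ((volume.restrict (Set.Ioc 0 L)).prod
      ((volume.restrict (Set.Ioc 0 L)).prod (volume.restrict (Set.Ioo 0 Real.pi)))) := by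
  have h1 : Integrable (fun β => C₀ + C₁ * charFactor' y β) (volume.restrict (Set.Ioc 0 L)) :=
    (integrable_const _).add ((integrableOn_charFactor' y L).const_mul C₁)
  refine Integrable.mono' (h1.comp_fst _) hf.aestronglyMeasurable ?_
  rw [Measure.prod_restrict, Measure.prod_restrict, ae_restrict_iff']
  · refine Eventually.of_forall fun q hq => ?_
    exact hb q.1 q.2.1 q.2.2 hq.1.1 hq.1.2 hq.2.1.1 hq.2.1.2
  · exact measurableSet_Ioc.prod (measurableSet_Ioc.prod measurableSet_Ioo)

theorem integrableOn_inv_sqrt (L : ℝ) : IntegrableOn (fun α : ℝ => 1 / (2 * √α)) (Set.Ioc 0 L) :=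
  intervalIntegral.integrableOn_deriv_of_nonneg Real.continuous_sqrt.continuousOn
    (fun _ hx => Real.hasDerivAt_sqrt hx.1.ne') fun _ _ => by positivity

/-- The integrand is a divergence in (α, θ). Write b for `charFactor y β` and b' for its derivative.
Since 2bb' = (y - β)² and sin² + cos² = 1, it is the θ-derivative of -(2b'/√α) φ₂ sin θ plus the
α-derivative `D'` of 4b' cos θ √α φ₂. All boundary terms vanish: sin at 0 and π, √α at 0, and φ₂ at
α = L because L > K. -/
theorem integral_charPath_alpha_theta_eq_zero (hφ : ContDiff ℝ (⊤ : ℕ∞) φ)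
    (hc : HasCompactSupport φ) {K L : ℝ} (hK : ∀ p : ℝ × ℝ × ℝ, K < 2 * p.1 → φ p = 0)
    (hL : 0 < L) (hKL : K < L) (y : ℝ) {β : ℝ} (hβ : 0 < β) :
    ∫ α in Set.Ioc 0 L, ∫ θ in Set.Ioo 0 Real.pi,
      (2 * charFactor' y β * √α * Real.cos θ *
          partialD (1, 0, 0) (partialD (0, 0, 1) φ) (charPath y β α θ)
        + (y - β) ^ 2 * partialD (0, 0, 1) (partialD (0, 0, 1) φ) (charPath y β α θ)) = 0 := by
  set φ₂ := partialD (0, 0, 1) φ with hφ₂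
  have s₂ : ContDiff ℝ (⊤ : ℕ∞) φ₂ := contDiff_partialD hφ _
  have c₂ : HasCompactSupport φ₂ := hasCompactSupport_partialD hc _
  have d₂ : Differentiable ℝ φ₂ := s₂.differentiable (by simp)
  have st := (contDiff_partialD s₂ (1, 0, 0)).continuous
  have s22 := (contDiff_partialD s₂ (0, 0, 1)).continuous
  obtain ⟨C, hC⟩ := c₂.exists_bound_of_continuous s₂.continuous
  obtain ⟨Ct, hCt⟩ := (hasCompactSupport_partialD c₂ (1, 0, 0)).exists_bound_of_continuous st
  obtain ⟨C2, hC2⟩ := (hasCompactSupport_partialD c₂ (0, 0, 1)).exists_bound_of_continuous s22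
  have hp : Continuous fun q : ℝ × ℝ => charPath y β q.1 q.2 :=
    (continuous_charPath y).comp (f := fun q : ℝ × ℝ => (β, q.1, q.2)) (by fun_prop)
  set b := charFactor y β with hb
  set b' := charFactor' y β with hb'
  have hbp : 0 < b := charFactor_pos y hβ
  have hbb : 2 * (b * b') = (y - β) ^ 2 := charFactor_mul_charFactor' y hβ
  have hb0 : 0 ≤ b' := charFactor'_nonneg y β
  set D' : ℝ → ℝ → ℝ := fun α θ => b' * Real.cos θ * (2 * √α * partialD (1, 0, 0) φ₂ (charPath y β α θ)
    + 2 * b * Real.cos θ * partialD (0, 0, 1) φ₂ (charPath y β α θ)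
    + 4 * φ₂ (charPath y β α θ) * (1 / (2 * √α))) with hD'
  have hD'm : Measurable fun q : ℝ × ℝ => D' q.1 q.2 := by
    have m1 := (st.comp hp).measurable
    have m2 := (s22.comp hp).measurable
    have m3 := (s₂.continuous.comp hp).measurable
    simp only [Function.comp_def] at m1 m2 m3
    have m4 : Measurable fun q : ℝ × ℝ => 1 / (2 * √q.1) := by fun_prop
    have m5 : Measurable fun q : ℝ × ℝ => √q.1 := by fun_prop
    have m6 : Measurable fun q : ℝ × ℝ => Real.cos q.2 := by fun_prop
    exact (m6.const_mul b').mul ((((m5.const_mul 2).mul m1).add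
      ((m6.const_mul (2 * b)).mul m2)).add ((m3.const_mul 4).mul m4))
  have hD'b : ∀ α θ, 0 < α → α ≤ L → ‖D' α θ‖ ≤
      b' * (2 * √L * Ct + 2 * b * C2) + b' * (4 * C) * (1 / (2 * √α)) := by
    intro α θ h0 h1
    have hcos := Real.abs_cos_le_one θ
    have hCp : 0 ≤ C := (norm_nonneg _).trans (hC 0)
    have hCtp : 0 ≤ Ct := (norm_nonneg _).trans (hCt 0)
    have hC2p : 0 ≤ C2 := (norm_nonneg _).trans (hC2 0)
    have hs : √α ≤ √L := Real.sqrt_le_sqrt h1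
    simp only [hD', norm_mul, Real.norm_eq_abs, abs_of_nonneg hb0]
    calc b' * |Real.cos θ| * |2 * √α * partialD (1, 0, 0) φ₂ (charPath y β α θ)
          + 2 * b * Real.cos θ * partialD (0, 0, 1) φ₂ (charPath y β α θ)
          + 4 * φ₂ (charPath y β α θ) * (1 / (2 * √α))|
        ≤ b' * 1 * (2 * √L * Ct + 2 * b * 1 * C2 + 4 * C * (1 / (2 * √α))) := by
          gcongr
          refine (abs_add_three _ _ _).trans ?_
          simp only [abs_mul, abs_of_nonneg (Real.sqrt_nonneg α), abs_of_pos hbp, abs_two,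
            abs_of_nonneg (show (0 : ℝ) ≤ 1 / (2 * √α) by positivity),
            abs_of_pos (show (0 : ℝ) < 4 by norm_num)]
          have e1 := hCt (charPath y β α θ)
          have e2 := hC2 (charPath y β α θ)
          have e3 := hC (charPath y β α θ)
          rw [Real.norm_eq_abs] at e1 e2 e3
          gcongr
      _ = _ := by ring
  have hD'i : Integrable (fun q : ℝ × ℝ => D' q.1 q.2)
      ((volume.restrict (Set.Ioc 0 L)).prod (volume.restrict (Set.Ioo 0 Real.pi))) := by
    have h1 : Integrable (fun α : ℝ => b' * (2 * √L * Ct + 2 * b * C2)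
        + b' * (4 * C) * (1 / (2 * √α))) (volume.restrict (Set.Ioc 0 L)) :=
      (integrable_const _).add ((integrableOn_inv_sqrt L).const_mul _)
    refine Integrable.mono' (h1.comp_fst _) hD'm.aestronglyMeasurable ?_
    rw [Measure.prod_restrict, ae_restrict_iff' (measurableSet_Ioc.prod measurableSet_Ioo)]
    exact Eventually.of_forall fun q hq => hD'b q.1 q.2 hq.1.1 hq.1.2
  have step1 : ∀ α ∈ Set.Ioc 0 L, ∫ θ in Set.Ioo 0 Real.pi,
      (2 * b' * √α * Real.cos θ * partialD (1, 0, 0) φ₂ (charPath y β α θ)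
        + (y - β) ^ 2 * partialD (0, 0, 1) φ₂ (charPath y β α θ))
      = ∫ θ in Set.Ioo 0 Real.pi, D' α θ := by
    intro α hα
    have hα0 : 0 < √α := Real.sqrt_pos.2 hα.1
    have hpθ : Continuous fun θ => charPath y β α θ :=
      hp.comp (f := fun θ : ℝ => (α, θ)) (by fun_prop)
    have k1 := st.comp hpθ
    have k2 := s22.comp hpθ
    have k3 := s₂.continuous.comp hpθ
    simp only [Function.comp_def] at k1 k2 k3
    have i1 : Continuous fun θ => 2 * b' * √α * Real.cos θ *
        partialD (1, 0, 0) φ₂ (charPath y β α θ)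
        + (y - β) ^ 2 * partialD (0, 0, 1) φ₂ (charPath y β α θ) := by fun_prop
    have i2 : Continuous fun θ => D' α θ := by simp only [hD']; fun_prop
    rw [← sub_eq_zero, ← integral_Ioc_eq_integral_Ioo, ← integral_Ioc_eq_integral_Ioo,
      ← intervalIntegral.integral_of_le Real.pi_pos.le,
      ← intervalIntegral.integral_of_le Real.pi_pos.le,
      ← intervalIntegral.integral_sub (i1.intervalIntegrable _ _) (i2.intervalIntegrable _ _)]
    have hder : ∀ θ ∈ Set.uIcc 0 Real.pi, HasDerivAt
        (fun θ => -(2 * b' / √α) * (φ₂ (charPath y β α θ) * Real.sin θ))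
        (2 * b' * √α * Real.cos θ * partialD (1, 0, 0) φ₂ (charPath y β α θ)
        + (y - β) ^ 2 * partialD (0, 0, 1) φ₂ (charPath y β α θ) - D' α θ) θ := by
      intro θ _
      have := ((hasDerivAt_comp_charPath_theta d₂ y β α θ).mul
        (Real.hasDerivAt_sin θ)).const_mul (-(2 * b' / √α))
      convert! this using 1
      have hcs := Real.sin_sq_add_cos_sq θ
      rw [← hbb]
      simp only [hD']
      rw [← hb]
      field_simp
      linear_combination (-(4 * b * b' * √α * partialD (0, 0, 1) φ₂ (charPath y β α θ))) * hcs
    rw [intervalIntegral.integral_eq_sub_of_hasDerivAt hder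
      ((i1.sub i2).intervalIntegrable _ _)]
    simp
  rw [setIntegral_congr_fun measurableSet_Ioc step1, integral_integral_swap hD'i]
  have step2 : ∀ θ, ∫ α in Set.Ioc 0 L, D' α θ = 0 := by
    intro θ
    have hpα : Continuous fun α => charPath y β α θ :=
      hp.comp (f := fun α : ℝ => (α, θ)) (by fun_prop)
    have hder : ∀ α ∈ Set.Ioo 0 L, HasDerivAt
        (fun α => 4 * b' * Real.cos θ * (φ₂ (charPath y β α θ) * √α)) (D' α θ) α := by
      intro α hα
      have hα0 : 0 < √α := Real.sqrt_pos.2 hα.1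
      have := ((hasDerivAt_comp_charPath_alpha d₂ y β hα.1 θ).mul
        (Real.hasDerivAt_sqrt hα.1.ne')).const_mul (4 * b' * Real.cos θ)
      convert! this using 1
      simp only [hD']
      rw [← hb]
      field_simp
      ring
    have hint : IntervalIntegrable (fun α => D' α θ) volume 0 L := by
      rw [intervalIntegrable_iff_integrableOn_Ioc_of_le hL.le]
      refine Integrable.mono' ((integrable_const (b' * (2 * √L * Ct + 2 * b * C2))).add
        ((integrableOn_inv_sqrt L).const_mul (b' * (4 * C))))
        (hD'm.comp (f := fun α : ℝ => (α, θ)) (by fun_prop)).aestronglyMeasurable ?_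
      rw [ae_restrict_iff' measurableSet_Ioc]
      exact Eventually.of_forall fun α hα => hD'b α θ hα.1 hα.2
    have hcont : Continuous fun α => 4 * b' * Real.cos θ * (φ₂ (charPath y β α θ) * √α) := by
      have k3 := s₂.continuous.comp hpα
      simp only [Function.comp_def] at k3
      fun_prop
    rw [← intervalIntegral.integral_of_le hL.le,
      intervalIntegral.integral_eq_sub_of_hasDerivAt_of_le hL.le hcont.continuousOn hder hint]
    have hv : φ₂ (charPath y β L θ) = 0 := by
      refine partialD_vanish hK _ _ ?_
      simp only [charPath]
      linarith
    simp [hv]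
  simp_rw [step2]
  simp

/-- Along the path the operator splits as A - D, where A is twice the β-derivative of ∂ₜφ and D
integrates to zero over (α, θ). Integrating A over β leaves -2 ∂ₜφ(α/2, y, 0), free of θ because
`charFactor` vanishes at β = 0. The θ-integral then contributes π, and the α-integral of the
derivative gives 4π φ(0, y, 0). -/
theorem integral_charPath_waveOp (hφ : ContDiff ℝ (⊤ : ℕ∞) φ) (hc : HasCompactSupport φ)
    (y : ℝ) :
    ∫ β in Set.Ioi 0, ∫ α in Set.Ioi 0, ∫ θ in Set.Ioo 0 Real.pi,
      waveOp φ (charPath y β α θ) = 4 * Real.pi * φ (0, y, 0) := by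
  obtain ⟨K, hK⟩ : ∃ K : ℝ, ∀ p : ℝ × ℝ × ℝ, K < 2 * p.1 → φ p = 0 := by
    obtain ⟨R, hR⟩ := hc.isBounded.subset_closedBall (0 : ℝ × ℝ × ℝ)
    refine ⟨2 * R, fun p hp => image_eq_zero_of_notMem_tsupport fun h => ?_⟩
    have h1 := hR h
    rw [mem_closedBall_zero_iff] at h1
    have h2 := (le_abs_self p.1).trans ((norm_fst_le p).trans h1)
    linarith
  obtain ⟨L, hL, hKL⟩ : ∃ L : ℝ, 0 < L ∧ K < L :=
    ⟨|K| + 1, by positivity, (le_abs_self K).trans_lt (lt_add_one _)⟩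
  set φt := partialD (1, 0, 0) φ with hφt
  have sT : ContDiff ℝ (⊤ : ℕ∞) φt := contDiff_partialD hφ _
  have cT : HasCompactSupport φt := hasCompactSupport_partialD hc _
  have dT : Differentiable ℝ φt := sT.differentiable (by simp)
  have k1 := (contDiff_partialD sT (1, 0, 0)).continuous
  have k2 := (contDiff_partialD sT (0, 1, 0)).continuous
  have k3 := (contDiff_partialD sT (0, 0, 1)).continuous
  have k4 := (contDiff_partialD (contDiff_partialD hφ (0, 0, 1)) (0, 0, 1)).continuous
  obtain ⟨C1, hC1⟩ := (hasCompactSupport_partialD cT (1, 0, 0)).exists_bound_of_continuous k1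
  obtain ⟨C2, hC2⟩ := (hasCompactSupport_partialD cT (0, 1, 0)).exists_bound_of_continuous k2
  obtain ⟨C3, hC3⟩ := (hasCompactSupport_partialD cT (0, 0, 1)).exists_bound_of_continuous k3
  obtain ⟨C4, hC4⟩ := (hasCompactSupport_partialD (hasCompactSupport_partialD hc (0, 0, 1))
    (0, 0, 1)).exists_bound_of_continuous k4
  have hC1p : 0 ≤ C1 := (norm_nonneg _).trans (hC1 0)
  have hC2p : 0 ≤ C2 := (norm_nonneg _).trans (hC2 0)
  have hC3p : 0 ≤ C3 := (norm_nonneg _).trans (hC3 0)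
  have hC4p : 0 ≤ C4 := (norm_nonneg _).trans (hC4 0)
  have hp := continuous_charPath y
  have m0 := measurable_charFactor' y
  have m1 := (k1.comp hp).measurable
  have m2 := (k2.comp hp).measurable
  have m3 := (k3.comp hp).measurable
  have m4 := (k4.comp hp).measurable
  simp only [Function.comp_def] at m1 m2 m3 m4
  set A : ℝ × ℝ × ℝ → ℝ := fun q => 2 * (1 / 2 * partialD (1, 0, 0) φt (charPath y q.1 q.2.1 q.2.2)
    - partialD (0, 1, 0) φt (charPath y q.1 q.2.1 q.2.2)
    + charFactor' y q.1 * √q.2.1 * Real.cos q.2.2 *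
      partialD (0, 0, 1) φt (charPath y q.1 q.2.1 q.2.2)) with hA
  set D : ℝ × ℝ × ℝ → ℝ := fun q => 2 * charFactor' y q.1 * √q.2.1 * Real.cos q.2.2 *
      partialD (0, 0, 1) φt (charPath y q.1 q.2.1 q.2.2)
    + (y - q.1) ^ 2 * partialD (0, 0, 1) (partialD (0, 0, 1) φ)
      (charPath y q.1 q.2.1 q.2.2) with hD
  have hAm : Measurable A := by simp only [hA]; fun_prop
  have hDm : Measurable D := by simp only [hD]; fun_prop
  have hbound : ∀ β α θ : ℝ, α ≤ L →
      |charFactor' y β * √α * Real.cos θ * partialD (0, 0, 1) φt (charPath y β α θ)|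
        ≤ √L * C3 * charFactor' y β := by
    intro β α θ hα
    have e3 := hC3 (charPath y β α θ)
    rw [Real.norm_eq_abs] at e3
    have hb0 := charFactor'_nonneg y β
    simp only [abs_mul, abs_of_nonneg (Real.sqrt_nonneg α), abs_of_nonneg hb0]
    calc charFactor' y β * √α * |Real.cos θ| * |partialD (0, 0, 1) φt (charPath y β α θ)|
        ≤ charFactor' y β * √L * 1 * C3 := by
          gcongr
          exact Real.abs_cos_le_one θ
      _ = _ := by ring
  have hAi := integrable_of_le_charFactor' (y := y) (L := L) (C₀ := C1 + 2 * C2)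
    (C₁ := 2 * (√L * C3)) hAm (by
      intro β α θ _ _ _ hα
      have e1 := hC1 (charPath y β α θ)
      have e2 := hC2 (charPath y β α θ)
      have e3 := hbound β α θ hα
      rw [Real.norm_eq_abs] at e1 e2 ⊢
      simp only [hA]
      rw [abs_le] at e1 e2 e3 ⊢
      constructor <;> linarith [e1.1, e1.2, e2.1, e2.2, e3.1, e3.2])
  have hDi := integrable_of_le_charFactor' (y := y) (L := L) (C₀ := (|y| + L) ^ 2 * C4)
    (C₁ := 2 * (√L * C3)) hDm (by
      intro β α θ hβ hβ' _ hα
      have e4 := hC4 (charPath y β α θ)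
      have e3 := hbound β α θ hα
      have e5 : |(y - β) ^ 2 * partialD (0, 0, 1) (partialD (0, 0, 1) φ) (charPath y β α θ)|
          ≤ (|y| + L) ^ 2 * C4 := by
        rw [Real.norm_eq_abs] at e4
        rw [abs_mul, abs_pow]
        gcongr
        refine (abs_sub _ _).trans ?_
        rw [abs_of_pos hβ]
        gcongr
      rw [Real.norm_eq_abs]
      simp only [hD]
      rw [abs_le] at e3 e5 ⊢
      constructor <;> linarith [e5.1, e5.2, e3.1, e3.2])
  have hWAD : ∀ q : ℝ × ℝ × ℝ, waveOp φ (charPath y q.1 q.2.1 q.2.2) = A q - D q := by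
    intro q
    rw [waveOp_eq hφ]
    simp only [hA, hD, hφt]
    have : (charPath y q.1 q.2.1 q.2.2).2.1 = y - q.1 := rfl
    rw [this]
    ring
  -- If α or β exceeds L, then 2t = α + β > K and the integrand vanishes.
  have restr : ∫ β in Set.Ioi 0, ∫ α in Set.Ioi 0, ∫ θ in Set.Ioo 0 Real.pi,
      waveOp φ (charPath y β α θ) = ∫ β in Set.Ioc 0 L, ∫ α in Set.Ioc 0 L,
        ∫ θ in Set.Ioo 0 Real.pi, waveOp φ (charPath y β α θ) := by
    have hz : ∀ β α θ : ℝ, 0 < β → 0 < α → L < β ∨ L < α → waveOp φ (charPath y β α θ) = 0 := by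
      intro β α θ h1 h2 h3
      refine waveOp_vanish hK _ ?_
      simp only [charPath]
      rcases h3 with h3 | h3 <;> linarith
    have inner : ∀ β : ℝ, 0 < β → ∫ α in Set.Ioi 0, ∫ θ in Set.Ioo 0 Real.pi,
        waveOp φ (charPath y β α θ)
        = ∫ α in Set.Ioc 0 L, ∫ θ in Set.Ioo 0 Real.pi, waveOp φ (charPath y β α θ) := by
      intro β hβ
      refine setIntegral_eq_of_subset_of_forall_sdiff_eq_zero measurableSet_Ioi
        (fun _ h => h.1) fun α hα => ?_
      have h1 : L < α := not_le.1 fun h => hα.2 ⟨hα.1, h⟩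
      simp [hz β α _ hβ hα.1 (Or.inr h1)]
    rw [setIntegral_eq_of_subset_of_forall_sdiff_eq_zero (s := Set.Ioc 0 L) measurableSet_Ioi
      (fun _ h => h.1)]
    · exact setIntegral_congr_fun measurableSet_Ioc fun β hβ => inner β hβ.1
    · intro β hβ
      have h1 : L < β := not_le.1 fun h => hβ.2 ⟨hβ.1, h⟩
      refine setIntegral_eq_zero_of_forall_eq_zero fun α hα => ?_
      simp [hz β α _ hβ.1 hα (Or.inl h1)]
  have hsplit : ∫ β in Set.Ioc 0 L, ∫ α in Set.Ioc 0 L,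
      ∫ θ in Set.Ioo 0 Real.pi, waveOp φ (charPath y β α θ)
      = ∫ q, A q - D q ∂((volume.restrict (Set.Ioc 0 L)).prod
        ((volume.restrict (Set.Ioc 0 L)).prod (volume.restrict (Set.Ioo 0 Real.pi)))) := by
    have hprod := integral_prod (fun q => A q - D q) (hAi.sub hDi)
    rw [hprod]
    refine integral_congr_ae ?_
    filter_upwards [(hAi.sub hDi).prod_right_ae] with β hβ
    have hprod' := integral_prod (fun r : ℝ × ℝ => A (β, r) - D (β, r)) hβ
    rw [hprod']
    exact integral_congr_ae (Eventually.of_forall fun α => integral_congr_ae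
      (Eventually.of_forall fun θ => hWAD (β, α, θ)))
  rw [restr, hsplit, integral_sub hAi hDi]
  have hD0 : ∫ q, D q ∂((volume.restrict (Set.Ioc 0 L)).prod
      ((volume.restrict (Set.Ioc 0 L)).prod (volume.restrict (Set.Ioo 0 Real.pi)))) = 0 := by
    rw [integral_prod _ hDi]
    refine integral_eq_zero_of_ae ?_
    filter_upwards [hDi.prod_right_ae, ae_restrict_mem measurableSet_Ioc] with β hβ hβ'
    rw [integral_prod _ hβ]
    have := integral_charPath_alpha_theta_eq_zero hφ hc hK hL hKL y hβ'.1
    simp only [hD, Pi.zero_apply, hφt, partialD_comm hφ (0, 0, 1) (1, 0, 0)]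
    exact this
  have hA0 : ∀ α θ : ℝ, α ∈ Set.Ioc 0 L →
      Integrable (fun β => A (β, α, θ)) (volume.restrict (Set.Ioc 0 L)) →
      ∫ β in Set.Ioc 0 L, A (β, α, θ) = -(2 * φt (α / 2, y, 0)) := by
    intro α θ hα hi
    have hcont : Continuous fun β => 2 * φt (charPath y β α θ) := by
      have := sT.continuous.comp (hp.comp (f := fun β : ℝ => (β, α, θ)) (by fun_prop))
      simp only [Function.comp_def] at this
      fun_prop
    have hder : ∀ β ∈ Set.Ioo 0 L, HasDerivAt (fun β => 2 * φt (charPath y β α θ))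
        (A (β, α, θ)) β := fun β hβ =>
      (hasDerivAt_comp_charPath_beta dT y hβ.1 α θ).const_mul 2
    rw [← intervalIntegral.integral_of_le hL.le,
      intervalIntegral.integral_eq_sub_of_hasDerivAt_of_le hL.le hcont.continuousOn hder
        ((intervalIntegrable_iff_integrableOn_Ioc_of_le hL.le).2 hi)]
    have hv : φt (charPath y L α θ) = 0 := by
      refine partialD_vanish hK _ _ ?_
      simp only [charPath]
      linarith [hα.1]
    rw [hv]
    simp [charPath, charFactor_zero]
  have hA1 : ∫ q, A q ∂((volume.restrict (Set.Ioc 0 L)).prod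
      ((volume.restrict (Set.Ioc 0 L)).prod (volume.restrict (Set.Ioo 0 Real.pi))))
      = 4 * Real.pi * φ (0, y, 0) := by
    have hφtc : Continuous fun α : ℝ => φt (α / 2, y, 0) :=
      sT.continuous.comp (f := fun α : ℝ => ((α / 2, y, 0) : ℝ × ℝ × ℝ)) (by fun_prop)
    have hi2 : Integrable (fun r : ℝ × ℝ => -(2 * φt (r.1 / 2, y, 0)))
        ((volume.restrict (Set.Ioc 0 L)).prod (volume.restrict (Set.Ioo 0 Real.pi))) := by
      have : Integrable (fun α : ℝ => -(2 * φt (α / 2, y, 0))) (volume.restrict (Set.Ioc 0 L)) :=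
        (continuous_const.mul hφtc).neg.continuousOn.integrableOn_Icc.mono_set
          Set.Ioc_subset_Icc_self
      exact this.comp_fst _
    rw [integral_prod_symm _ hAi]
    have : ∫ r, (∫ β in Set.Ioc 0 L, A (β, r)) ∂((volume.restrict (Set.Ioc 0 L)).prod
        (volume.restrict (Set.Ioo 0 Real.pi)))
        = ∫ r, -(2 * φt (r.1 / 2, y, 0)) ∂((volume.restrict (Set.Ioc 0 L)).prod
        (volume.restrict (Set.Ioo 0 Real.pi))) := by
      refine integral_congr_ae ?_
      have hmem : ∀ᵐ r : ℝ × ℝ ∂((volume.restrict (Set.Ioc 0 L)).prod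
          (volume.restrict (Set.Ioo 0 Real.pi))), r ∈ Set.Ioc 0 L ×ˢ Set.Ioo 0 Real.pi := by
        rw [Measure.prod_restrict]
        exact ae_restrict_mem (measurableSet_Ioc.prod measurableSet_Ioo)
      filter_upwards [hAi.prod_left_ae, hmem] with r hr hr'
      exact hA0 r.1 r.2 hr'.1 hr
    rw [this, integral_prod _ hi2]
    simp only [integral_const, smul_eq_mul, measureReal_restrict_apply MeasurableSet.univ,
      Set.univ_inter, Real.volume_real_Ioo_of_le Real.pi_pos.le, sub_zero]
    have hder : ∀ α ∈ Set.uIcc 0 L, HasDerivAt (fun α : ℝ => -(4 * Real.pi) * φ (α / 2, y, 0))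
        (Real.pi * -(2 * φt (α / 2, y, 0))) α := by
      intro α _
      have h1 : HasDerivAt (fun α : ℝ => ((α / 2, y, 0) : ℝ × ℝ × ℝ)) (1 / 2, 0, 0) α :=
        ((hasDerivAt_id α).div_const 2).prodMk
          ((hasDerivAt_const α y).prodMk (hasDerivAt_const α (0 : ℝ)))
      have h2 := ((hφ.differentiable (by simp) _).hasFDerivAt.comp_hasDerivAt α h1).const_mul
        (-(4 * Real.pi))
      rw [fderiv_eq_partialD] at h2
      convert! h2 using 1
      simp only [hφt]
      ring
    rw [← intervalIntegral.integral_of_le hL.le,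
      intervalIntegral.integral_eq_sub_of_hasDerivAt hder
        ((continuous_const.mul (continuous_const.mul hφtc).neg).intervalIntegrable _ _)]
    have hv : φ (L / 2, y, 0) = 0 := hK _ (by simp only; linarith)
    rw [hv]
    simp
  rw [hA1, hD0, sub_zero]

theorem isFundamentalSolution_Gam : IsFundamentalSolution Gam where
  locallyIntegrable := locallyIntegrable_Gam
  causal t x₁ y₁ x₂ h := Gam_causal t x₁ y₁ x₂ h
  equation y φ := by
    rw [integral_Gam_mul_eq (continuous_waveOp φ.contDiff)
      (hasCompactSupport_waveOp φ.hasCompactSupport),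
      integral_charPath_waveOp φ.contDiff φ.hasCompactSupport]
    have := Real.pi_pos
    field_simp

end Fundamental

/-! ### Oscillatory integrals -/

theorem norm_cexp_neg_I_mul (a : ℝ) : ‖Complex.exp (-Complex.I * (a : ℂ))‖ = 1 := by
  rw [Complex.norm_exp]; simp

theorem norm_cexp_I_mul (a : ℝ) : ‖Complex.exp (Complex.I * (a : ℂ))‖ = 1 := by
  rw [Complex.norm_exp]; simp

/-- Integration by parts against a bounded function. -/
theorem norm_integral_mul_deriv_le {a b M : ℝ} (hab : a ≤ b) {u v u' v' : ℝ → ℂ}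
    (hu : ContinuousOn u (Set.Icc a b)) (hv : ContinuousOn v (Set.Icc a b))
    (hu' : ∀ x ∈ Set.Ioo a b, HasDerivAt u (u' x) x)
    (hv' : ∀ x ∈ Set.Ioo a b, HasDerivAt v (v' x) x)
    (iu : IntervalIntegrable u' volume a b) (iv : IntervalIntegrable v' volume a b)
    (hM : ∀ x, ‖v x‖ ≤ M) :
    ‖∫ x in a..b, u x * v' x‖ ≤ M * (‖u a‖ + ‖u b‖ + ∫ x in a..b, ‖u' x‖) := by
  have h := intervalIntegral.integral_mul_deriv_eq_deriv_mul_of_hasDerivAt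
    (u := u) (v := v) (u' := u') (v' := v') (by rwa [Set.uIcc_of_le hab])
    (by rwa [Set.uIcc_of_le hab]) (by simpa [hab] using hu') (by simpa [hab] using hv') iu iv
  rw [h]
  have h1 : ‖∫ x in a..b, u' x * v x‖ ≤ M * ∫ x in a..b, ‖u' x‖ := by
    rw [← intervalIntegral.integral_const_mul]
    refine intervalIntegral.norm_integral_le_of_norm_le hab ?_ (iu.norm.const_mul M)
    refine Eventually.of_forall fun x _ => ?_
    rw [norm_mul, mul_comm]
    exact mul_le_mul_of_nonneg_right (hM x) (norm_nonneg _)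
  calc ‖u b * v b - u a * v a - ∫ x in a..b, u' x * v x‖
      ≤ ‖u b * v b‖ + ‖u a * v a‖ + ‖∫ x in a..b, u' x * v x‖ :=
        (norm_sub_le _ _).trans (add_le_add_left (norm_sub_le _ _) _)
    _ ≤ ‖u b‖ * M + ‖u a‖ * M + M * ∫ x in a..b, ‖u' x‖ := by
        rw [norm_mul, norm_mul]
        gcongr
        · exact hM b
        · exact hM a
    _ = _ := by ring

/-- The Bessel type integral `∫₀^π exp (i z cos θ) dθ`. -/
def besselInt (z : ℝ) : ℂ :=
  ∫ θ in Set.Ioo 0 Real.pi, Complex.exp (Complex.I * ((z * Real.cos θ : ℝ) : ℂ))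

theorem besselInt_eq (z : ℝ) : besselInt z
    = ∫ θ in (0 : ℝ)..Real.pi, Complex.exp (Complex.I * ((z * Real.cos θ : ℝ) : ℂ)) := by
  rw [besselInt, intervalIntegral.integral_of_le Real.pi_pos.le, integral_Ioc_eq_integral_Ioo]

theorem norm_besselInt_le (z : ℝ) : ‖besselInt z‖ ≤ Real.pi := by
  rw [besselInt_eq]
  have := intervalIntegral.norm_integral_le_of_norm_le_const (a := 0) (b := Real.pi) (C := 1)
    (f := fun θ => Complex.exp (Complex.I * ((z * Real.cos θ : ℝ) : ℂ)))
    (fun θ _ => (norm_cexp_I_mul _).le)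
  simpa [abs_of_pos Real.pi_pos] using this

/-- The phase z cos θ is stationary at θ = 0, so the interval (0, δ) is estimated trivially. On the
rest one integrates by parts after dividing by sin θ; as 1/sin is monotone there, its variation
telescopes, and Jordan's inequality sin δ ≥ 2δ/π bounds the total 2/(|z| sin δ). -/
theorem norm_integral_cexp_cos_le {z δ : ℝ} (hz : z ≠ 0) (hδ : 0 < δ) (hδ' : δ ≤ 1) :
    ‖∫ θ in (0 : ℝ)..(Real.pi / 2), Complex.exp (Complex.I * ((z * Real.cos θ : ℝ) : ℂ))‖
      ≤ δ + Real.pi / (δ * |z|) := by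
  have hpi := Real.pi_gt_three
  have hδ2 : δ ≤ Real.pi / 2 := by linarith
  have hc : Continuous fun θ : ℝ => Complex.exp (Complex.I * ((z * Real.cos θ : ℝ) : ℂ)) := by
    fun_prop
  rw [← intervalIntegral.integral_add_adjacent_intervals (b := δ) (hc.intervalIntegrable _ _)
    (hc.intervalIntegrable _ _)]
  refine (norm_add_le _ _).trans (add_le_add ?_ ?_)
  · have := intervalIntegral.norm_integral_le_of_norm_le_const (a := 0) (b := δ) (C := 1)
      (f := fun θ => Complex.exp (Complex.I * ((z * Real.cos θ : ℝ) : ℂ)))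
      (fun θ _ => (norm_cexp_I_mul _).le)
    simpa [abs_of_pos hδ] using this
  · have hsin : ∀ θ ∈ Set.Icc δ (Real.pi / 2), 0 < Real.sin θ := fun θ h =>
      Real.sin_pos_of_pos_of_lt_pi (by linarith [h.1]) (by linarith [h.2])
    have hder : ∀ θ ∈ Set.Icc δ (Real.pi / 2), HasDerivAt (fun θ => (Real.sin θ)⁻¹)
        (-Real.cos θ / Real.sin θ ^ 2) θ := fun θ h =>
      (Real.hasDerivAt_sin θ).inv (hsin θ h).ne'
    have hcont : ContinuousOn (fun θ => -Real.cos θ / Real.sin θ ^ 2)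
        (Set.Icc δ (Real.pi / 2)) :=
      ContinuousOn.div (by fun_prop) (by fun_prop) fun θ h => (pow_pos (hsin θ h) 2).ne'
    have hii : IntervalIntegrable (fun θ => -Real.cos θ / Real.sin θ ^ 2) volume δ
        (Real.pi / 2) := by
      apply ContinuousOn.intervalIntegrable
      rwa [Set.uIcc_of_le hδ2]
    have hzC : (z : ℂ) ≠ 0 := Complex.ofReal_ne_zero.2 hz
    have key := norm_integral_mul_deriv_le (a := δ) (b := Real.pi / 2) (M := |z|⁻¹) hδ2
      (u := fun θ => (((Real.sin θ)⁻¹ : ℝ) : ℂ))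
      (u' := fun θ => ((-Real.cos θ / Real.sin θ ^ 2 : ℝ) : ℂ))
      (v := fun θ => Complex.I / z * Complex.exp (Complex.I * ((z * Real.cos θ : ℝ) : ℂ)))
      (v' := fun θ => Real.sin θ * Complex.exp (Complex.I * ((z * Real.cos θ : ℝ) : ℂ)))
      (fun θ h => ((hder θ h).ofReal_comp).continuousAt.continuousWithinAt)
      (by fun_prop)
      (fun θ h => (hder θ (Set.Ioo_subset_Icc_self h)).ofReal_comp)
      (fun θ _ => by
        have h1 := ((((Real.hasDerivAt_cos θ).const_mul z).ofReal_comp.const_mul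
          Complex.I).cexp).const_mul (Complex.I / (z : ℂ))
        convert! h1 using 1
        push_cast
        field_simp
        linear_combination Complex.sin θ * Complex.I_sq)
      ⟨Integrable.ofReal hii.1, Integrable.ofReal hii.2⟩
      ((by fun_prop : Continuous fun θ : ℝ => (Real.sin θ : ℂ) *
        Complex.exp (Complex.I * ((z * Real.cos θ : ℝ) : ℂ))).intervalIntegrable _ _)
      (fun θ => by
        rw [norm_mul, norm_cexp_I_mul]
        simp)
    have e1 : ∫ θ in δ..(Real.pi / 2), ((((Real.sin θ)⁻¹ : ℝ) : ℂ)) *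
        (Real.sin θ * Complex.exp (Complex.I * ((z * Real.cos θ : ℝ) : ℂ)))
        = ∫ θ in δ..(Real.pi / 2), Complex.exp (Complex.I * ((z * Real.cos θ : ℝ) : ℂ)) := by
      refine intervalIntegral.integral_congr fun θ h => ?_
      rw [Set.uIcc_of_le hδ2] at h
      have : (Real.sin θ : ℂ) ≠ 0 := Complex.ofReal_ne_zero.2 (hsin θ h).ne'
      rw [Complex.ofReal_inv, inv_mul_cancel_left₀ this]
    have e2 : ∫ θ in δ..(Real.pi / 2), ‖((-Real.cos θ / Real.sin θ ^ 2 : ℝ) : ℂ)‖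
        = (Real.sin δ)⁻¹ - 1 := by
      have : ∫ θ in δ..(Real.pi / 2), ‖((-Real.cos θ / Real.sin θ ^ 2 : ℝ) : ℂ)‖
          = ∫ θ in δ..(Real.pi / 2), -(-Real.cos θ / Real.sin θ ^ 2) := by
        refine intervalIntegral.integral_congr fun θ h => ?_
        rw [Set.uIcc_of_le hδ2] at h
        have hcos : 0 ≤ Real.cos θ :=
          Real.cos_nonneg_of_neg_pi_div_two_le_of_le (by linarith [h.1]) h.2
        rw [Complex.norm_real, Real.norm_eq_abs, abs_of_nonpos]
        exact div_nonpos_of_nonpos_of_nonneg (by linarith) (by positivity)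
      rw [this, intervalIntegral.integral_neg,
        intervalIntegral.integral_eq_sub_of_hasDerivAt (f := fun θ => (Real.sin θ)⁻¹)
          (fun θ h => hder θ (by rwa [Set.uIcc_of_le hδ2] at h)) hii]
      simp
    rw [e1, e2] at key
    refine key.trans ?_
    have hs := hsin δ ⟨le_rfl, hδ2⟩
    have hs2 : 2 / Real.pi * δ ≤ Real.sin δ := Real.mul_le_sin hδ.le hδ2
    have hs3 : (Real.sin δ)⁻¹ ≤ Real.pi / (2 * δ) := by
      rw [inv_le_comm₀ hs (by positivity), inv_div]
      calc 2 * δ / Real.pi = 2 / Real.pi * δ := by ring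
        _ ≤ _ := hs2
    rw [Complex.norm_real, Complex.norm_real, Real.norm_of_nonneg (by positivity)]
    simp only [Real.sin_pi_div_two, inv_one, norm_one]
    have hz' : 0 < |z| := abs_pos.2 hz
    calc |z|⁻¹ * ((Real.sin δ)⁻¹ + 1 + ((Real.sin δ)⁻¹ - 1)) = |z|⁻¹ * (2 * (Real.sin δ)⁻¹) := by
          ring
      _ ≤ |z|⁻¹ * (2 * (Real.pi / (2 * δ))) := by gcongr
      _ = _ := by field_simp

/-- For |z| ≥ 1 the choice δ = |z|^(-1/2) balances the two terms of the previous estimate. The half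
near the other stationary point θ = π is reflected by θ ↦ π - θ, which replaces z by -z. The total
is 2(1 + π) ≤ 9; for |z| ≤ 1 the trivial bound π is enough. -/
theorem norm_besselInt_mul_sqrt_le (z : ℝ) : ‖besselInt z‖ * √|z| ≤ 9 := by
  have hpi := Real.pi_lt_d2
  have hpi0 := Real.pi_pos
  rcases le_total |z| 1 with h | h
  · calc ‖besselInt z‖ * √|z| ≤ Real.pi * 1 := by
          gcongr
          · exact norm_besselInt_le z
          · exact Real.sqrt_le_one.2 h
      _ ≤ 9 := by linarith
  · have hs1 : 1 ≤ √|z| := Real.one_le_sqrt.2 h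
    have hs0 : 0 < √|z| := by linarith
    have hzz : √|z| * √|z| = |z| := Real.mul_self_sqrt (abs_nonneg z)
    have hz : z ≠ 0 := by rintro rfl; simp at h; linarith
    have hb : ∀ w : ℝ, |w| = |z| → ‖∫ θ in (0 : ℝ)..(Real.pi / 2),
        Complex.exp (Complex.I * ((w * Real.cos θ : ℝ) : ℂ))‖ ≤ (1 + Real.pi) * (√|z|)⁻¹ := by
      intro w hw
      have hw0 : w ≠ 0 := by
        intro h0; rw [h0, abs_zero] at hw; exact hz (abs_eq_zero.1 hw.symm)
      refine (norm_integral_cexp_cos_le hw0 (inv_pos.2 hs0) (inv_le_one_of_one_le₀ hs1)).trans ?_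
      rw [hw]
      have : Real.pi / ((√|z|)⁻¹ * |z|) = Real.pi * (√|z|)⁻¹ := by
        rw [show (√|z|)⁻¹ * |z| = √|z| by rw [inv_mul_eq_iff_eq_mul₀ hs0.ne', hzz], div_eq_mul_inv]
      rw [this]
      linarith
    have hc : Continuous fun θ : ℝ => Complex.exp (Complex.I * ((z * Real.cos θ : ℝ) : ℂ)) := by
      fun_prop
    have hsplit : besselInt z = (∫ θ in (0 : ℝ)..(Real.pi / 2),
        Complex.exp (Complex.I * ((z * Real.cos θ : ℝ) : ℂ))) + ∫ θ in (0 : ℝ)..(Real.pi / 2),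
        Complex.exp (Complex.I * ((-z * Real.cos θ : ℝ) : ℂ)) := by
      rw [besselInt_eq, ← intervalIntegral.integral_add_adjacent_intervals (b := Real.pi / 2)
        (hc.intervalIntegrable _ _) (hc.intervalIntegrable _ _)]
      congr 1
      have := intervalIntegral.integral_comp_sub_left
        (fun θ : ℝ => Complex.exp (Complex.I * ((z * Real.cos θ : ℝ) : ℂ))) (a := 0)
        (b := Real.pi / 2) Real.pi
      simp only [Real.cos_pi_sub] at this
      rw [show Real.pi - Real.pi / 2 = Real.pi / 2 by ring, sub_zero] at this
      rw [← this]
      refine intervalIntegral.integral_congr fun θ _ => ?_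
      simp
    rw [hsplit]
    calc _ ≤ ((1 + Real.pi) * (√|z|)⁻¹ + (1 + Real.pi) * (√|z|)⁻¹) * √|z| := by
          gcongr
          exact (norm_add_le _ _).trans (add_le_add (hb z rfl) (hb (-z) (abs_neg z)))
      _ = 2 * (1 + Real.pi) := by field_simp; ring
      _ ≤ 9 := by linarith

/-! ### Decay of the Fourier transform of the kernel -/

/-- The oscillatory integral which is, up to a factor of constant modulus, the Fourier transform of
the kernel in its last two variables. -/
def oscInt (r x : ℝ) (ξ : ℝ × ℝ) : ℂ :=
  ∫ y in x..(x + 2 * r), Complex.exp (-Complex.I * ((ξ.1 * y : ℝ) : ℂ)) *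
    besselInt (ξ.2 * rad r x y)

theorem continuous_rad (r x : ℝ) : Continuous (rad r x) := by
  unfold rad; fun_prop

/-- Here x is fixed and y varies, the opposite of the situation in characteristic coordinates.
Reflection, y³ - x³ = (-x)³ - (-y)³, allows the facts on `charFactor` to be reused with base point
-x. -/
theorem rad_eq_charFactor {r x y : ℝ} (h : x < y) :
    rad r x y = charFactor (-x) (y - x) * √(2 * r + x - y) := by
  have := cube_sub_pos h
  rw [rad, charFactor, ← Real.sqrt_mul]
  · congr 1
    ring
  · have : (-x) ^ 3 - (-x - (y - x)) ^ 3 = y ^ 3 - x ^ 3 := by ring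
    rw [this]; positivity

theorem charFactor_mono (x : ℝ) {a b : ℝ} (h : a ≤ b) : charFactor x a ≤ charFactor x b := by
  unfold charFactor
  have : (x - b) ^ 3 ≤ (x - a) ^ 3 := (Odd.strictMono_pow (by decide : Odd 3)).monotone (by linarith)
  gcongr

theorem norm_oscInt_le {r : ℝ} (x : ℝ) (ξ : ℝ × ℝ) (hr : 0 ≤ r) :
    ‖oscInt r x ξ‖ ≤ 2 * Real.pi * r := by
  have := intervalIntegral.norm_integral_le_of_norm_le_const (a := x) (b := x + 2 * r)
    (C := Real.pi) (f := fun y => Complex.exp (-Complex.I * ((ξ.1 * y : ℝ) : ℂ)) *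
    besselInt (ξ.2 * rad r x y))
    (fun y _ => by rw [norm_mul, norm_cexp_neg_I_mul, one_mul]; exact norm_besselInt_le _)
  refine this.trans (le_of_eq ?_)
  rw [show x + 2 * r - x = 2 * r by ring, abs_of_nonneg (by positivity)]
  ring

/-- The derivative of `rad` in its last variable. -/
def rad' (r x y : ℝ) : ℝ :=
  charFactor' (-x) (y - x) * √(2 * r + x - y)
    + charFactor (-x) (y - x) * (-1 / (2 * √(2 * r + x - y)))

theorem hasDerivAt_rad {r x y : ℝ} (h₁ : x < y) (h₂ : y < x + 2 * r) :
    HasDerivAt (rad r x) (rad' r x y) y := by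
  have h1 : HasDerivAt (fun y => charFactor (-x) (y - x)) (charFactor' (-x) (y - x)) y := by
    have := (hasDerivAt_charFactor (-x) (sub_pos.2 h₁)).comp_sub_const y x
    exact this
  have h2 : HasDerivAt (fun y => √(2 * r + x - y)) (-1 / (2 * √(2 * r + x - y))) y :=
    ((hasDerivAt_id y).const_sub (2 * r + x)).sqrt (by simp only [id]; linarith)
  refine (h1.mul h2).congr_of_eventuallyEq ?_
  filter_upwards [lt_mem_nhds h₁] with z hz using rad_eq_charFactor hz

/-- `rad` is the product of an increasing factor, from 0 to `charFactor (-x) (2 * r)`, and a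
decreasing one, from √(2r) to 0. Bounding each undifferentiated factor by its maximum controls the
total variation without locating the zeros of the derivative. -/
theorem intervalIntegrable_rad' {r : ℝ} (x : ℝ) (hr : 0 ≤ r) :
    IntervalIntegrable (rad' r x) volume x (x + 2 * r) ∧
      ∫ y in x..(x + 2 * r), |rad' r x y| ≤ 2 * (√(2 * r) * charFactor (-x) (2 * r)) := by
  have hle : x ≤ x + 2 * r := by linarith
  have hcf : Continuous fun y => charFactor (-x) (y - x) :=
    (continuous_charFactor (-x)).comp (by fun_prop)
  have hd1 : ∀ y ∈ Set.Ioo x (x + 2 * r), HasDerivAt (fun y => charFactor (-x) (y - x))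
      (charFactor' (-x) (y - x)) y := fun y hy =>
    (hasDerivAt_charFactor (-x) (sub_pos.2 hy.1)).comp_sub_const y x
  have hd2 : ∀ y ∈ Set.Ioo x (x + 2 * r), HasDerivAt (fun y => -√(2 * r + x - y))
      (1 / (2 * √(2 * r + x - y))) y := fun y hy => by
    have := (((hasDerivAt_id y).const_sub (2 * r + x)).sqrt
      (by simp only [id]; linarith [hy.2])).neg
    convert! this using 1
    simp only [id]
    ring
  have hs : Continuous fun y => -√(2 * r + x - y) := by fun_prop
  have i1 : IntervalIntegrable (fun y => charFactor' (-x) (y - x)) volume x (x + 2 * r) :=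
    intervalIntegral.intervalIntegrable_deriv_of_nonneg hcf.continuousOn
      (by simpa [hr] using hd1) (fun _ _ => charFactor'_nonneg _ _)
  have i2 : IntervalIntegrable (fun y => 1 / (2 * √(2 * r + x - y))) volume x (x + 2 * r) :=
    intervalIntegral.intervalIntegrable_deriv_of_nonneg hs.continuousOn
      (by simpa [hr] using hd2) (fun _ _ => by positivity)
  have e1 := intervalIntegral.integral_eq_sub_of_hasDerivAt_of_le hle hcf.continuousOn hd1 i1
  have e2 := intervalIntegral.integral_eq_sub_of_hasDerivAt_of_le hle hs.continuousOn hd2 i2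
  have hint : IntervalIntegrable (rad' r x) volume x (x + 2 * r) := by
    have j1 := i1.mul_continuousOn (g := fun y => √(2 * r + x - y)) (by fun_prop)
    have j2 := (i2.mul_continuousOn (g := fun y => charFactor (-x) (y - x)) hcf.continuousOn).neg
    refine (j1.add j2).congr ?_
    refine fun y _ => ?_
    simp only [rad', Pi.neg_apply]
    ring
  refine ⟨hint, ?_⟩
  have hb : ∀ y ∈ Set.Icc x (x + 2 * r), |rad' r x y| ≤ √(2 * r) * charFactor' (-x) (y - x)
      + charFactor (-x) (2 * r) * (1 / (2 * √(2 * r + x - y))) := by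
    intro y hy
    have h0 := charFactor'_nonneg (-x) (y - x)
    have h1 : 0 ≤ charFactor (-x) (y - x) := Real.sqrt_nonneg _
    have h2 : charFactor (-x) (y - x) ≤ charFactor (-x) (2 * r) :=
      charFactor_mono _ (by linarith [hy.2])
    have h3 : √(2 * r + x - y) ≤ √(2 * r) := Real.sqrt_le_sqrt (by linarith [hy.1])
    have h4 : 0 ≤ √(2 * r + x - y) := Real.sqrt_nonneg _
    refine (abs_add_le _ _).trans (add_le_add ?_ ?_)
    · rw [abs_of_nonneg (by positivity), mul_comm]
      gcongr
    · rw [neg_div, mul_neg, abs_neg, abs_of_nonneg (by positivity)]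
      gcongr
  calc ∫ y in x..(x + 2 * r), |rad' r x y|
      ≤ ∫ y in x..(x + 2 * r), (√(2 * r) * charFactor' (-x) (y - x)
      + charFactor (-x) (2 * r) * (1 / (2 * √(2 * r + x - y)))) :=
        intervalIntegral.integral_mono_on hle hint.abs ((i1.const_mul _).add (i2.const_mul _)) hb
    _ = 2 * (√(2 * r) * charFactor (-x) (2 * r)) := by
        rw [intervalIntegral.integral_add (i1.const_mul _) (i2.const_mul _),
          intervalIntegral.integral_const_mul, intervalIntegral.integral_const_mul, e1, e2]
        have a1 : x + 2 * r - x = 2 * r := by ring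
        have a2 : 2 * r + x - (x + 2 * r) = 0 := by ring
        have a3 : 2 * r + x - x = 2 * r := by ring
        rw [a1, a2, a3, sub_self, charFactor_zero, Real.sqrt_zero]
        ring

/-- With the θ-integral of the Bessel function taken outside, integrate by parts in y against exp(-i
ξ₁ y), which has a primitive of modulus 1/|ξ₁|. The two boundary terms give 2, and differentiating
the phase ξ₂ rad cos θ costs |ξ₂| times the total variation of `rad`. -/
theorem norm_oscInt_mul_fst_le {r : ℝ} (x : ℝ) (ξ : ℝ × ℝ) (hr : 0 ≤ r) :
    ‖oscInt r x ξ‖ * |ξ.1|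
      ≤ Real.pi * (2 + |ξ.2| * (2 * (√(2 * r) * charFactor (-x) (2 * r)))) := by
  rcases eq_or_ne ξ.1 0 with h0 | h0
  · rw [h0, abs_zero, mul_zero]
    have : 0 ≤ charFactor (-x) (2 * r) := Real.sqrt_nonneg _
    have := Real.pi_pos
    positivity
  have hle : x ≤ x + 2 * r := by linarith
  have hξ : (ξ.1 : ℂ) ≠ 0 := Complex.ofReal_ne_zero.2 h0
  obtain ⟨hi, hb⟩ := intervalIntegrable_rad' x hr
  have hrad := continuous_rad r x
  set V := 2 * (√(2 * r) * charFactor (-x) (2 * r)) with hV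
  have inner : ∀ θ : ℝ, ‖∫ y in x..(x + 2 * r),
      Complex.exp (Complex.I * ((ξ.2 * rad r x y * Real.cos θ : ℝ) : ℂ)) *
        Complex.exp (-Complex.I * ((ξ.1 * y : ℝ) : ℂ))‖ ≤ |ξ.1|⁻¹ * (2 + |ξ.2| * V) := by
    intro θ
    have hu'i : IntervalIntegrable (fun y =>
        Complex.exp (Complex.I * ((ξ.2 * rad r x y * Real.cos θ : ℝ) : ℂ)) *
          (Complex.I * ((ξ.2 * rad' r x y * Real.cos θ : ℝ) : ℂ))) volume x (x + 2 * r) := by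
      refine IntervalIntegrable.continuousOn_mul ?_ (by fun_prop)
      have h1 : IntervalIntegrable (fun y => ξ.2 * rad' r x y * Real.cos θ) volume x (x + 2 * r) :=
        (hi.const_mul _).mul_const _
      exact IntervalIntegrable.const_mul ⟨Integrable.ofReal h1.1, Integrable.ofReal h1.2⟩ _
    have key := norm_integral_mul_deriv_le (a := x) (b := x + 2 * r) (M := |ξ.1|⁻¹) hle
      (u := fun y => Complex.exp (Complex.I * ((ξ.2 * rad r x y * Real.cos θ : ℝ) : ℂ)))
      (u' := fun y => Complex.exp (Complex.I * ((ξ.2 * rad r x y * Real.cos θ : ℝ) : ℂ)) *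
        (Complex.I * ((ξ.2 * rad' r x y * Real.cos θ : ℝ) : ℂ)))
      (v := fun y => Complex.I / ξ.1 * Complex.exp (-Complex.I * ((ξ.1 * y : ℝ) : ℂ)))
      (v' := fun y => Complex.exp (-Complex.I * ((ξ.1 * y : ℝ) : ℂ)))
      (by fun_prop) (by fun_prop)
      (fun y hy => ((((hasDerivAt_rad hy.1 hy.2).const_mul ξ.2).mul_const
        (Real.cos θ)).ofReal_comp.const_mul Complex.I).cexp)
      (fun y _ => by
        have h1 := ((((hasDerivAt_id y).const_mul ξ.1).ofReal_comp.const_mul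
          (-Complex.I)).cexp).const_mul (Complex.I / (ξ.1 : ℂ))
        convert! h1 using 1
        simp only [id]
        push_cast
        field_simp
        linear_combination Complex.I_sq)
      hu'i ((by fun_prop : Continuous fun y : ℝ =>
        Complex.exp (-Complex.I * ((ξ.1 * y : ℝ) : ℂ))).intervalIntegrable _ _)
      (fun y => by rw [norm_mul, norm_cexp_neg_I_mul]; simp)
    refine key.trans ?_
    rw [norm_cexp_I_mul, norm_cexp_I_mul]
    have hub : ∫ y in x..(x + 2 * r),
        ‖Complex.exp (Complex.I * ((ξ.2 * rad r x y * Real.cos θ : ℝ) : ℂ)) *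
          (Complex.I * ((ξ.2 * rad' r x y * Real.cos θ : ℝ) : ℂ))‖ ≤ |ξ.2| * V := by
      calc _ ≤ ∫ y in x..(x + 2 * r), |ξ.2| * |rad' r x y| := by
            refine intervalIntegral.integral_mono_on hle hu'i.norm (hi.abs.const_mul _)
              fun y _ => ?_
            rw [norm_mul, norm_cexp_I_mul, norm_mul, Complex.norm_I, Complex.norm_real,
              Real.norm_eq_abs, abs_mul, abs_mul, one_mul, one_mul]
            exact mul_le_of_le_one_right (by positivity) (Real.abs_cos_le_one θ)
        _ ≤ |ξ.2| * V := by
            rw [intervalIntegral.integral_const_mul]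
            gcongr
    gcongr
    linarith
  have hF : Continuous fun p : ℝ × ℝ =>
      Complex.exp (-Complex.I * ((ξ.1 * p.1 : ℝ) : ℂ)) *
        Complex.exp (Complex.I * ((ξ.2 * rad r x p.1 * Real.cos p.2 : ℝ) : ℂ)) := by fun_prop
  have hswap : oscInt r x ξ = ∫ θ in (0 : ℝ)..Real.pi, ∫ y in x..(x + 2 * r),
      Complex.exp (Complex.I * ((ξ.2 * rad r x y * Real.cos θ : ℝ) : ℂ)) *
        Complex.exp (-Complex.I * ((ξ.1 * y : ℝ) : ℂ)) := by
    have h1 : oscInt r x ξ = ∫ y in x..(x + 2 * r), ∫ θ in (0 : ℝ)..Real.pi,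
        Complex.exp (-Complex.I * ((ξ.1 * y : ℝ) : ℂ)) *
          Complex.exp (Complex.I * ((ξ.2 * rad r x y * Real.cos θ : ℝ) : ℂ)) := by
      unfold oscInt
      refine intervalIntegral.integral_congr fun y _ => ?_
      rw [intervalIntegral.integral_const_mul, besselInt_eq]
    rw [h1, intervalIntegral_intervalIntegral_swap]
    · refine intervalIntegral.integral_congr fun θ _ => ?_
      exact intervalIntegral.integral_congr fun y _ => mul_comm _ _
    · refine (hF.continuousOn.integrableOn_compact
        ((isCompact_uIcc (a := x) (b := x + 2 * r)).prod (isCompact_uIcc (a := 0) (b := Real.pi)))).mono_set ?_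
      exact Set.prod_mono Set.uIoc_subset_uIcc Set.uIoc_subset_uIcc
  have hfin := intervalIntegral.norm_integral_le_of_norm_le_const (a := 0) (b := Real.pi)
    (C := |ξ.1|⁻¹ * (2 + |ξ.2| * V)) (fun θ _ => inner θ)
  rw [← hswap, sub_zero, abs_of_pos Real.pi_pos] at hfin
  have hpos : 0 < |ξ.1| := abs_pos.2 h0
  calc ‖oscInt r x ξ‖ * |ξ.1| ≤ |ξ.1|⁻¹ * (2 + |ξ.2| * V) * Real.pi * |ξ.1| := by gcongr
    _ = _ := by field_simp

/-- Let v = y - x and w = 2r + x - y, so that v + w = 2r. Then 12 rad² ≥ v³ w, which bounds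
rad^(-1/2) by 2 v^(-3/4) w^(-1/4). At least one of v and w is ≥ r and may be replaced by r; each
case leaves a single integrable power. -/
theorem inv_sqrt_rad_le {r x y : ℝ} (h₁ : x < y) (h₂ : y < x + 2 * r) :
    1 / √(rad r x y) ≤ 2 * r ^ (-1 / 4 : ℝ) * (y - x) ^ (-3 / 4 : ℝ)
      + 2 * r ^ (-3 / 4 : ℝ) * (2 * r + x - y) ^ (-1 / 4 : ℝ) := by
  have hv : 0 < y - x := by linarith
  have hw : 0 < 2 * r + x - y := by linarith
  have hr : 0 < r := by linarith
  have hρ := rad_pos h₁ h₂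
  have hσ : 0 < √(rad r x y) := Real.sqrt_pos.2 hρ
  have hc := cube_sub_pos h₁
  have hσ4 : √(rad r x y) ^ 4 = (y ^ 3 - x ^ 3) * (2 * r + x - y) / 3 := by
    rw [show √(rad r x y) ^ 4 = (√(rad r x y) ^ 2) ^ 2 by ring, Real.sq_sqrt hρ.le, rad,
      Real.sq_sqrt (by positivity)]
  have hlow : (y - x) ^ 3 * (2 * r + x - y) ≤ (2 * √(rad r x y)) ^ 4 := by
    -- From 4(y² + xy + x²) = (y - x)² + 3(x + y)². No lower bound better than the cube holds near x
    -- = y = 0, where the operator degenerates.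
    have h3 : (y - x) ^ 3 ≤ 4 * (y ^ 3 - x ^ 3) := by
      nlinarith [mul_nonneg hv.le (sq_nonneg (y + x))]
    rw [mul_pow, hσ4]
    nlinarith [mul_le_mul_of_nonneg_right h3 hw.le, mul_pos hc hw]
  have key : ∀ a b : ℝ, 0 < a → 0 < b → a ^ 3 * b ≤ (2 * √(rad r x y)) ^ 4 →
      1 / √(rad r x y) ≤ 2 * b ^ (-1 / 4 : ℝ) * a ^ (-3 / 4 : ℝ) := by
    intro a b ha hb hab
    have h1 : (b ^ (1 / 4 : ℝ) * a ^ (3 / 4 : ℝ)) ^ 4 = a ^ 3 * b := by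
      rw [mul_pow, ← Real.rpow_natCast, ← Real.rpow_natCast, ← Real.rpow_mul hb.le,
        ← Real.rpow_mul ha.le, ← Real.rpow_natCast a 3]
      norm_num
      ring
    rw [← h1] at hab
    have h2 := le_of_pow_le_pow_left₀ (by norm_num) (by positivity) hab
    have h3 : 2 * b ^ (-1 / 4 : ℝ) * a ^ (-3 / 4 : ℝ)
        = 2 / (b ^ (1 / 4 : ℝ) * a ^ (3 / 4 : ℝ)) := by
      rw [neg_div, neg_div, Real.rpow_neg hb.le, Real.rpow_neg ha.le]
      field_simp
    rw [h3, div_le_div_iff₀ hσ (by positivity)]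
    linarith
  rcases le_total r (2 * r + x - y) with h | h
  · refine (key (y - x) r hv hr ?_).trans (le_add_of_nonneg_right (by positivity))
    exact (mul_le_mul_of_nonneg_left h (by positivity)).trans hlow
  · refine le_trans ?_ (le_add_of_nonneg_left (by positivity))
    refine (key r (2 * r + x - y) hr hw ?_).trans (le_of_eq (by ring))
    refine le_trans ?_ hlow
    gcongr
    linarith

/-- The Bessel decay reduces the claim to the integral of rad^(-1/2). By scaling, the powers of r
cancel in the integrals of v^(-3/4) and w^(-1/4), so the constant depends neither on r nor on x. -/
theorem norm_oscInt_mul_sqrt_snd_le {r : ℝ} (x : ℝ) (ξ : ℝ × ℝ) (hr : 0 < r) :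
    ‖oscInt r x ξ‖ * √|ξ.2| ≤ 9 * (8 * 2 ^ (1 / 4 : ℝ) + 8 / 3 * 2 ^ (3 / 4 : ℝ)) := by
  have hle : x ≤ x + 2 * r := by linarith
  have i1 : IntervalIntegrable (fun y => (y - x) ^ (-3 / 4 : ℝ)) volume x (x + 2 * r) := by
    have := (intervalIntegral.intervalIntegrable_rpow' (r := -3 / 4) (a := 0) (b := 2 * r)
      (by norm_num)).comp_sub_right x
    simpa [add_comm] using this
  have i2 : IntervalIntegrable (fun y => (2 * r + x - y) ^ (-1 / 4 : ℝ)) volume x (x + 2 * r) := by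
    have := (intervalIntegral.intervalIntegrable_rpow' (r := -1 / 4) (a := 2 * r) (b := 0)
      (by norm_num)).comp_sub_left (2 * r + x)
    simpa [add_comm] using this
  have e1 : ∫ y in x..(x + 2 * r), (y - x) ^ (-3 / 4 : ℝ) = 4 * (2 * r) ^ (1 / 4 : ℝ) := by
    rw [intervalIntegral.integral_comp_sub_right (fun v => v ^ (-3 / 4 : ℝ)) x,
      integral_rpow (Or.inl (by norm_num))]
    norm_num
    ring
  have e2 : ∫ y in x..(x + 2 * r), (2 * r + x - y) ^ (-1 / 4 : ℝ)
      = 4 / 3 * (2 * r) ^ (3 / 4 : ℝ) := by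
    rw [intervalIntegral.integral_comp_sub_left (fun v => v ^ (-1 / 4 : ℝ)) (2 * r + x),
      integral_rpow (Or.inl (by norm_num)), show 2 * r + x - (x + 2 * r) = 0 by ring,
      show 2 * r + x - x = 2 * r by ring]
    norm_num
    ring
  have hb : ‖∫ y in x..(x + 2 * r), (√|ξ.2| : ℂ) *
      (Complex.exp (-Complex.I * ((ξ.1 * y : ℝ) : ℂ)) * besselInt (ξ.2 * rad r x y))‖
      ≤ ∫ y in x..(x + 2 * r), 9 * (2 * r ^ (-1 / 4 : ℝ) * (y - x) ^ (-3 / 4 : ℝ)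
      + 2 * r ^ (-3 / 4 : ℝ) * (2 * r + x - y) ^ (-1 / 4 : ℝ)) := by
    refine intervalIntegral.norm_integral_le_of_norm_le hle ?_
      (((i1.const_mul _).add (i2.const_mul _)).const_mul 9)
    have hne : ∀ᵐ y : ℝ, y ≠ x + 2 * r := by simp [ae_iff]
    filter_upwards [hne] with y hy hy'
    have h₂ : y < x + 2 * r := lt_of_le_of_ne hy'.2 hy
    have hρ := rad_pos hy'.1 h₂
    have hσ : 0 < √(rad r x y) := Real.sqrt_pos.2 hρ
    have hJ := norm_besselInt_mul_sqrt_le (ξ.2 * rad r x y)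
    rw [abs_mul, abs_of_pos hρ, Real.sqrt_mul (abs_nonneg _), ← mul_assoc,
      ← le_div_iff₀ hσ] at hJ
    rw [norm_mul, norm_mul, norm_cexp_neg_I_mul, one_mul, Complex.norm_real,
      Real.norm_of_nonneg (Real.sqrt_nonneg _), mul_comm]
    refine hJ.trans ?_
    rw [div_eq_mul_one_div]
    exact mul_le_mul_of_nonneg_left (inv_sqrt_rad_le hy'.1 h₂) (by norm_num)
  rw [intervalIntegral.integral_const_mul, norm_mul, Complex.norm_real,
    Real.norm_of_nonneg (Real.sqrt_nonneg _), intervalIntegral.integral_const_mul,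
    intervalIntegral.integral_add (i1.const_mul _) (i2.const_mul _),
    intervalIntegral.integral_const_mul, intervalIntegral.integral_const_mul, e1, e2] at hb
  rw [mul_comm]
  refine hb.trans (le_of_eq ?_)
  rw [Real.mul_rpow (by norm_num) hr.le, Real.mul_rpow (by norm_num) hr.le, neg_div, neg_div,
    Real.rpow_neg hr.le, Real.rpow_neg hr.le]
  have h1 : r ^ (1 / 4 : ℝ) ≠ 0 := (Real.rpow_pos_of_pos hr _).ne'
  have h2 : r ^ (3 / 4 : ℝ) ≠ 0 := (Real.rpow_pos_of_pos hr _).ne'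
  field_simp
  ring

theorem euclNorm_nonneg (ξ : ℝ × ℝ) : 0 ≤ euclNorm ξ := Real.sqrt_nonneg _

theorem euclNorm_le (ξ : ℝ × ℝ) : euclNorm ξ ≤ |ξ.1| + |ξ.2| := by
  unfold euclNorm
  rw [Real.sqrt_le_left (by positivity)]
  nlinarith [abs_nonneg ξ.1, abs_nonneg ξ.2, sq_abs ξ.1, sq_abs ξ.2,
    mul_nonneg (abs_nonneg ξ.1) (abs_nonneg ξ.2)]

/-- The decay of order `|ξ|^(-2/3)` of the square of the Fourier transform of the kernel. -/
theorem exists_norm_oscInt_sq_mul_le (x T : ℝ) : ∃ C : ℝ, ∀ r : ℝ, 0 < r → r ≤ T →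
    ∀ ξ : ℝ × ℝ, ‖oscInt r x ξ‖ ^ 2 * (1 + euclNorm ξ ^ (2 / 3 : ℝ)) ≤ C := by
  set A := 2 * Real.pi * T with hA
  set B := 9 * (8 * 2 ^ (1 / 4 : ℝ) + 8 / 3 * 2 ^ (3 / 4 : ℝ) : ℝ) with hB
  set V := 2 * (√(2 * T) * charFactor (-x) (2 * T)) with hV
  set E := Real.pi * (2 * A ^ 2 + V * B ^ 2) + A * B ^ 2 with hE
  refine ⟨A ^ 2 + E ^ (2 / 3 : ℝ), fun r hr hrT ξ => ?_⟩
  have hpi := Real.pi_pos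
  have h1 : ‖oscInt r x ξ‖ ≤ A := (norm_oscInt_le x ξ hr.le).trans (by rw [hA]; gcongr)
  have h2 : ‖oscInt r x ξ‖ ^ 2 * |ξ.2| ≤ B ^ 2 := by
    have := norm_oscInt_mul_sqrt_snd_le x ξ hr
    rw [← Real.sq_sqrt (abs_nonneg ξ.2), ← mul_pow]
    exact pow_le_pow_left₀ (by positivity) this 2
  have hmono := charFactor_mono (-x) (show 2 * r ≤ 2 * T by linarith)
  have hcf : 0 ≤ charFactor (-x) (2 * r) := Real.sqrt_nonneg _
  have hV0 : 0 ≤ V := by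
    have : 0 ≤ charFactor (-x) (2 * T) := Real.sqrt_nonneg _
    positivity
  have h3 : ‖oscInt r x ξ‖ * |ξ.1| ≤ Real.pi * (2 + |ξ.2| * V) :=
    (norm_oscInt_mul_fst_le x ξ hr.le).trans (by rw [hV]; gcongr)
  set h := ‖oscInt r x ξ‖ with hh
  have h0 : 0 ≤ h := norm_nonneg _
  have hA0 : 0 ≤ A := h0.trans h1
  -- The bound for h |ξ₁| grows like |ξ₂|; two further factors h absorb this growth through h² |ξ₂|
  -- ≤ B². The resulting cube is the origin of the exponent 2/3.
  have h4 : h ^ 3 * |ξ.1| ≤ Real.pi * (2 * A ^ 2 + V * B ^ 2) := by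
    calc h ^ 3 * |ξ.1| = h ^ 2 * (h * |ξ.1|) := by ring
      _ ≤ h ^ 2 * (Real.pi * (2 + |ξ.2| * V)) := by gcongr
      _ = Real.pi * (2 * h ^ 2 + V * (h ^ 2 * |ξ.2|)) := by ring
      _ ≤ _ := by gcongr
  have h5 : h ^ 3 * |ξ.2| ≤ A * B ^ 2 := by
    calc h ^ 3 * |ξ.2| = h * (h ^ 2 * |ξ.2|) := by ring
      _ ≤ _ := by gcongr
  have h6 : h ^ 3 * euclNorm ξ ≤ E := by
    calc h ^ 3 * euclNorm ξ ≤ h ^ 3 * (|ξ.1| + |ξ.2|) := by gcongr; exact euclNorm_le ξ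
      _ ≤ E := by rw [mul_add]; exact add_le_add h4 h5
  have h7 : h ^ 2 * euclNorm ξ ^ (2 / 3 : ℝ) ≤ E ^ (2 / 3 : ℝ) := by
    have : h ^ 2 * euclNorm ξ ^ (2 / 3 : ℝ) = (h ^ 3 * euclNorm ξ) ^ (2 / 3 : ℝ) := by
      rw [Real.mul_rpow (by positivity) (euclNorm_nonneg ξ), ← Real.rpow_natCast h 3,
        ← Real.rpow_mul h0]
      norm_num
    rw [this]
    exact Real.rpow_le_rpow (mul_nonneg (by positivity) (euclNorm_nonneg ξ)) h6 (by norm_num)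
  rw [mul_add, mul_one]
  exact add_le_add (pow_le_pow_left₀ h0 h1 2) h7

/-! ### The Fourier transform of real functions on the plane -/

open scoped Convolution

/-- The character `x ↦ exp (-i ξ·x)`. -/
def chr (ξ x : ℝ × ℝ) : ℂ := Complex.exp (-Complex.I * ((ξ.1 * x.1 + ξ.2 * x.2 : ℝ) : ℂ))

theorem norm_chr (ξ x : ℝ × ℝ) : ‖chr ξ x‖ = 1 := norm_cexp_neg_I_mul _

theorem continuous_chr : Continuous fun p : (ℝ × ℝ) × (ℝ × ℝ) => chr p.1 p.2 := by
  unfold chr; fun_prop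

theorem continuous_chr_right (ξ : ℝ × ℝ) : Continuous (chr ξ) := by
  unfold chr; fun_prop

theorem chr_add (ξ x y : ℝ × ℝ) : chr ξ (x + y) = chr ξ x * chr ξ y := by
  rw [chr, chr, chr, ← Complex.exp_add]
  congr 1
  simp only [Prod.fst_add, Prod.snd_add]
  push_cast
  ring

theorem chr_neg (ξ x : ℝ × ℝ) : chr ξ (-x) = (starRingEnd ℂ) (chr ξ x) := by
  rw [chr, chr, ← Complex.exp_conj]
  congr 1
  simp only [map_mul, map_neg, Complex.conj_I, Complex.conj_ofReal, Prod.fst_neg, Prod.snd_neg]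
  push_cast
  ring

theorem chr_zero (ξ : ℝ × ℝ) : chr ξ 0 = 1 := by simp [chr]

/-- The Fourier transform of a real function. -/
def fourierR (a : ℝ × ℝ → ℝ) (ξ : ℝ × ℝ) : ℂ := fourier (fun x => ((a x : ℝ) : ℂ)) ξ

theorem fourierR_eq (a : ℝ × ℝ → ℝ) (ξ : ℝ × ℝ) : fourierR a ξ = ∫ x, chr ξ x * (a x : ℂ) := rfl

theorem integrable_chr_mul {a : ℝ × ℝ → ℝ} (ha : Integrable a) (ξ : ℝ × ℝ) :
    Integrable fun x => chr ξ x * (a x : ℂ) :=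
  ha.ofReal.bdd_mul (c := 1) (continuous_chr_right ξ).aestronglyMeasurable
    (Eventually.of_forall fun x => (norm_chr ξ x).le)

theorem fourierR_add {a b : ℝ × ℝ → ℝ} (ha : Integrable a) (hb : Integrable b) (ξ : ℝ × ℝ) :
    fourierR (fun x => a x + b x) ξ = fourierR a ξ + fourierR b ξ := by
  rw [fourierR_eq, fourierR_eq, fourierR_eq,
    ← integral_add (integrable_chr_mul ha ξ) (integrable_chr_mul hb ξ)]
  refine integral_congr_ae (Eventually.of_forall fun x => ?_)
  simp only
  push_cast
  ring

theorem fourierR_const_mul (c : ℝ) (a : ℝ × ℝ → ℝ) (ξ : ℝ × ℝ) :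
    fourierR (fun x => c * a x) ξ = c * fourierR a ξ := by
  rw [fourierR_eq, fourierR_eq, ← integral_const_mul]
  refine integral_congr_ae (Eventually.of_forall fun x => ?_)
  simp only
  push_cast
  ring

theorem norm_fourierR_le (a : ℝ × ℝ → ℝ) (ξ : ℝ × ℝ) : ‖fourierR a ξ‖ ≤ ∫ x, ‖a x‖ := by
  rw [fourierR_eq]
  refine (norm_integral_le_integral_norm _).trans (le_of_eq ?_)
  simp [norm_chr]

theorem fourierR_comp_neg (a : ℝ × ℝ → ℝ) (ξ : ℝ × ℝ) :
    fourierR (fun x => a (-x)) ξ = (starRingEnd ℂ) (fourierR a ξ) := by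
  rw [fourierR_eq, fourierR_eq, ← integral_conj,
    ← integral_neg_eq_self fun x => chr ξ x * (a (-x) : ℂ)]
  refine integral_congr_ae (Eventually.of_forall fun x => ?_)
  simp [chr_neg]

theorem fourierR_convolution {a b : ℝ × ℝ → ℝ} (ha : Integrable a) (hb : Integrable b)
    (ξ : ℝ × ℝ) :
    fourierR (a ⋆[ContinuousLinearMap.lsmul ℝ ℝ, volume] b) ξ = fourierR a ξ * fourierR b ξ := by
  have hint : Integrable (fun p : (ℝ × ℝ) × (ℝ × ℝ) =>
      chr ξ p.1 * ((a p.2 * b (p.1 - p.2) : ℝ) : ℂ)) (volume.prod volume) := by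
    have h := (ha.convolution_integrand (ContinuousLinearMap.lsmul ℝ ℝ) hb).ofReal (𝕜 := ℂ)
    refine h.bdd_mul (c := 1) ?_ (Eventually.of_forall fun p => (norm_chr ξ p.1).le)
    exact ((continuous_chr_right ξ).comp continuous_fst).aestronglyMeasurable
  calc fourierR (a ⋆[ContinuousLinearMap.lsmul ℝ ℝ, volume] b) ξ
      = ∫ x, ∫ t, chr ξ x * ((a t * b (x - t) : ℝ) : ℂ) := by
        rw [fourierR_eq]
        refine integral_congr_ae (Eventually.of_forall fun x => ?_)
        simp only [convolution_def, ContinuousLinearMap.lsmul_apply, smul_eq_mul]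
        rw [integral_const_mul, integral_complex_ofReal]
    _ = ∫ t, ∫ x, chr ξ x * ((a t * b (x - t) : ℝ) : ℂ) := integral_integral_swap hint
    _ = ∫ t, chr ξ t * (a t : ℂ) * fourierR b ξ := by
        refine integral_congr_ae (Eventually.of_forall fun t => ?_)
        simp only
        rw [fourierR_eq, ← integral_const_mul,
          ← integral_add_right_eq_self (fun x => chr ξ x * ((a t * b (x - t) : ℝ) : ℂ)) t]
        refine integral_congr_ae (Eventually.of_forall fun x => ?_)
        simp only [chr_add, add_sub_cancel_right]
        push_cast
        ring
    _ = _ := by rw [integral_mul_const, ← fourierR_eq]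

theorem measurable_fourierR_slice {α : Type*} [MeasurableSpace α] {h : α × (ℝ × ℝ) → ℝ}
    (hh : Measurable h) :
    Measurable fun q : α × (ℝ × ℝ) => fourierR (fun y => h (q.1, y)) q.2 := by
  have : Measurable fun p : (α × (ℝ × ℝ)) × (ℝ × ℝ) => chr p.1.2 p.2 * (h (p.1.1, p.2) : ℂ) := by
    refine Measurable.mul ?_ ?_
    · exact continuous_chr.measurable.comp
        (f := fun p : (α × (ℝ × ℝ)) × (ℝ × ℝ) => (p.1.2, p.2)) (by fun_prop)
    · exact Complex.measurable_ofReal.comp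
        (hh.comp (f := fun p : (α × (ℝ × ℝ)) × (ℝ × ℝ) => (p.1.1, p.2)) (by fun_prop))
  exact this.stronglyMeasurable.integral_prod_right.measurable

theorem measurable_fourierR {a : ℝ × ℝ → ℝ} (ha : Measurable a) : Measurable (fourierR a) := by
  have := measurable_fourierR_slice (α := Unit) (h := fun p => a p.2) (by fun_prop)
  exact this.comp (f := fun ξ : ℝ × ℝ => ((), ξ)) (by fun_prop)

/-- Fourier transforms of smooth functions with compact support decay. -/
theorem exists_norm_fourierR_mul_le {a : ℝ × ℝ → ℝ} (hs : ContDiff ℝ (⊤ : ℕ∞) a)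
    (hc : HasCompactSupport a) : ∃ C : ℝ, 0 ≤ C ∧ ∀ ξ, ‖fourierR a ξ‖ * (1 + euclNorm ξ) ≤ C := by
  have key : ∀ v : ℝ × ℝ, ∀ ξ : ℝ × ℝ,
      ‖fourierR a ξ‖ * |ξ.1 * v.1 + ξ.2 * v.2| ≤ ∫ x, ‖fderiv ℝ a x v‖ := by
    intro v ξ
    have hd : Continuous fun x => fderiv ℝ a x v :=
      (hs.continuous_fderiv (by simp)).clm_apply continuous_const
    have hcd : HasCompactSupport fun x => fderiv ℝ a x v := hc.fderiv_apply ℝ v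
    have hchr : ∀ x, HasFDerivAt (chr ξ) (chr ξ x • (-Complex.I • Complex.ofRealCLM.comp
        (ξ.1 • ContinuousLinearMap.fst ℝ ℝ ℝ + ξ.2 • ContinuousLinearMap.snd ℝ ℝ ℝ))) x := by
      intro x
      have h1 : HasFDerivAt (fun x : ℝ × ℝ => ((ξ.1 * x.1 + ξ.2 * x.2 : ℝ) : ℂ))
          (Complex.ofRealCLM.comp
          (ξ.1 • ContinuousLinearMap.fst ℝ ℝ ℝ + ξ.2 • ContinuousLinearMap.snd ℝ ℝ ℝ)) x :=
        (Complex.ofRealCLM.hasFDerivAt).comp x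
          ((hasFDerivAt_fst.const_mul ξ.1).add (hasFDerivAt_snd.const_mul ξ.2))
      exact (h1.const_mul (-Complex.I)).cexp
    have hder : ∀ x, fderiv ℝ (chr ξ) x v = -Complex.I * ((ξ.1 * v.1 + ξ.2 * v.2 : ℝ) : ℂ)
        * chr ξ x := by
      intro x
      rw [(hchr x).fderiv]
      simp
      ring
    have hda : ∀ x, HasFDerivAt (fun x => (a x : ℂ)) (Complex.ofRealCLM.comp (fderiv ℝ a x)) x :=
      fun x => Complex.ofRealCLM.hasFDerivAt.comp x
        (hs.differentiable (by simp) x).hasFDerivAt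
    have hfa : ∀ x, fderiv ℝ (fun x => (a x : ℂ)) x v = (fderiv ℝ a x v : ℂ) := by
      intro x
      rw [(hda x).fderiv]
      simp
    have ia : Integrable a := hs.continuous.integrable_of_hasCompactSupport hc
    have ida : Integrable fun x => fderiv ℝ a x v := hd.integrable_of_hasCompactSupport hcd
    have ibp := integral_mul_fderiv_eq_neg_fderiv_mul_of_integrable (μ := volume)
      (f := chr ξ) (g := fun x => (a x : ℂ)) (v := v)
      (by
        simp_rw [hder, mul_assoc]
        exact ((integrable_chr_mul ia ξ).const_mul _).const_mul _)
      (by simp_rw [hfa]; exact integrable_chr_mul ida ξ)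
      (integrable_chr_mul ia ξ) (fun x _ => (hchr x).differentiableAt)
      (fun x _ => (hda x).differentiableAt)
    simp_rw [hfa, hder, mul_assoc] at ibp
    rw [integral_const_mul, integral_const_mul] at ibp
    have h2 : fourierR (fun x => fderiv ℝ a x v) ξ
        = -(-Complex.I * (((ξ.1 * v.1 + ξ.2 * v.2 : ℝ) : ℂ) * fourierR a ξ)) := ibp
    have h3 := norm_fourierR_le (fun x => fderiv ℝ a x v) ξ
    rw [h2] at h3
    simp only [norm_neg, norm_mul, Complex.norm_I, one_mul, Complex.norm_real,
      Real.norm_eq_abs (ξ.1 * v.1 + ξ.2 * v.2)] at h3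
    linarith
  refine ⟨(∫ x, ‖a x‖) + ((∫ x, ‖fderiv ℝ a x (1, 0)‖) + ∫ x, ‖fderiv ℝ a x (0, 1)‖),
    by positivity, fun ξ => ?_⟩
  have h0 := norm_fourierR_le a ξ
  have h1 := key (1, 0) ξ
  have h2 := key (0, 1) ξ
  simp only [mul_one, mul_zero, add_zero, zero_add] at h1 h2
  have h3 := mul_le_mul_of_nonneg_left (euclNorm_le ξ) (norm_nonneg (fourierR a ξ))
  linarith

open scoped Convolution

/-! ### Consequences of the spectral identity -/

section Spectral
variable {f : ℝ × ℝ → ℝ} {μ : Measure (ℝ × ℝ)}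

theorem sigmaFinite_of_integrable_pos {α : Type*} [MeasurableSpace α] {ν : Measure α} {k : α → ℝ}
    (hk : Integrable k ν) (hpos : ∀ x, 0 < k x) : SigmaFinite ν := by
  refine ⟨⟨⟨fun n : ℕ => {x | 1 / ((n : ℝ) + 1) ≤ k x}, fun _ => trivial,
    fun n => hk.measure_ge_lt_top (by positivity), ?_⟩⟩⟩
  refine Set.eq_univ_of_forall fun x => ?_
  obtain ⟨n, hn⟩ := exists_nat_one_div_lt (hpos x)
  exact Set.mem_iUnion.2 ⟨n, hn.le⟩

theorem sigmaFinite_of_decay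
    (hSC : Integrable (fun ξ => 1 / (1 + euclNorm ξ ^ (2 / 3 : ℝ))) μ) : SigmaFinite μ :=
  sigmaFinite_of_integrable_pos hSC fun ξ => by
    have := Real.rpow_nonneg (euclNorm_nonneg ξ) (2 / 3)
    positivity

/-- Decay of first order suffices since |ξ|^(2/3) ≤ 1 + |ξ|. Integrability must be established
separately from the spectral identity, whose right side is by convention zero when the integral
diverges. -/
theorem integrable_of_decay
    (hSC : Integrable (fun ξ => 1 / (1 + euclNorm ξ ^ (2 / 3 : ℝ))) μ) {g : ℝ × ℝ → ℂ}
    (hg : Measurable g) {C : ℝ} (hC : ∀ ξ, ‖g ξ‖ * (1 + euclNorm ξ) ≤ C) : Integrable g μ := by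
  refine (hSC.const_mul (2 * C)).mono' hg.aestronglyMeasurable (Eventually.of_forall fun ξ => ?_)
  have h0 := euclNorm_nonneg ξ
  have h1 : euclNorm ξ ^ (2 / 3 : ℝ) ≤ 1 + euclNorm ξ := by
    rcases le_total (euclNorm ξ) 1 with h | h
    · linarith [Real.rpow_le_one h0 h (show (0 : ℝ) ≤ 2 / 3 by norm_num)]
    · have := Real.rpow_le_rpow_of_exponent_le h (show (2 / 3 : ℝ) ≤ 1 by norm_num)
      rw [Real.rpow_one] at this
      linarith
  have h2 := Real.rpow_nonneg h0 (2 / 3)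
  rw [mul_one_div, le_div_iff₀ (by positivity)]
  calc ‖g ξ‖ * (1 + euclNorm ξ ^ (2 / 3 : ℝ)) ≤ ‖g ξ‖ * (2 * (1 + euclNorm ξ)) := by
        gcongr
        linarith
    _ = 2 * (‖g ξ‖ * (1 + euclNorm ξ)) := by ring
    _ ≤ 2 * C := by linarith [hC ξ]

/-- The product fη is integrable for a bump function η equal to 1 on the ball. This controls the
possible singularity of f at the origin. -/
theorem integrableOn_closedBall_of_isSpectralMeasure (hμ : IsSpectralMeasure f μ) (N : ℝ) :
    IntegrableOn f (Metric.closedBall 0 N) := by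
  let φ : ContDiffBump (0 : ℝ × ℝ) := ⟨|N| + 1, |N| + 2, by positivity, by linarith⟩
  have hs : ContDiff ℝ (⊤ : ℕ∞) fun x => ((φ x : ℝ) : ℂ) :=
    Complex.ofRealCLM.contDiff.comp φ.contDiff
  have hc : HasCompactSupport fun x => ((φ x : ℝ) : ℂ) :=
    φ.hasCompactSupport.comp_left (g := Complex.ofReal) Complex.ofReal_zero
  have h := (hμ.integrable (hc.toSchwartzMap hs)).re.integrableOn (s := Metric.closedBall 0 N)
  refine h.congr_fun (fun x hx => ?_) Metric.isClosed_closedBall.measurableSet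
  have h1 : φ x = 1 := φ.one_of_mem_closedBall (Metric.closedBall_subset_closedBall
    (by change N ≤ |N| + 1; linarith [le_abs_self N]) hx)
  have h2 : (hc.toSchwartzMap hs) x = ((φ x : ℝ) : ℂ) := rfl
  simp [h2, h1]

theorem aestronglyMeasurable_of_isSpectralMeasure (hμ : IsSpectralMeasure f μ) :
    AEStronglyMeasurable f volume := by
  have h : LocallyIntegrable f volume := fun x => by
    refine ⟨Metric.closedBall 0 (‖x‖ + 1), ?_, integrableOn_closedBall_of_isSpectralMeasure hμ _⟩
    refine mem_of_superset (Metric.ball_mem_nhds x one_pos) fun y hy => ?_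
    rw [mem_closedBall_zero_iff]
    rw [Metric.mem_ball, dist_eq_norm] at hy
    linarith [norm_le_norm_add_norm_sub' y x]
  exact h.aestronglyMeasurable

/-! ### Correlations and the covariance in Fourier variables -/

/-- The correlation `z ↦ ∫ a(x) b(x - z) dx`. -/
def corr (a b : ℝ × ℝ → ℝ) : ℝ × ℝ → ℝ :=
  a ⋆[ContinuousLinearMap.lsmul ℝ ℝ, volume] fun x => b (-x)

theorem corr_apply (a b : ℝ × ℝ → ℝ) (z : ℝ × ℝ) : corr a b z = ∫ x, a x * b (x - z) := by
  simp [corr, convolution_def]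

theorem hasCompactSupport_comp_neg {b : ℝ × ℝ → ℝ} (hb : HasCompactSupport b) :
    HasCompactSupport fun x => b (-x) := hb.comp_homeomorph (Homeomorph.neg (ℝ × ℝ))

section Smooth
variable {a b : ℝ × ℝ → ℝ}

theorem contDiff_corr (sa : ContDiff ℝ (⊤ : ℕ∞) a) (ca : HasCompactSupport a)
    (sb : ContDiff ℝ (⊤ : ℕ∞) b) : ContDiff ℝ (⊤ : ℕ∞) (corr a b) :=
  ca.contDiff_convolution_left _ sa (sb.comp contDiff_neg).continuous.locallyIntegrable

theorem hasCompactSupport_corr (ca : HasCompactSupport a) (cb : HasCompactSupport b) : HasCompactSupport (corr a b) :=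
  ca.convolution _ (hasCompactSupport_comp_neg cb)

theorem fourierR_corr (sa : ContDiff ℝ (⊤ : ℕ∞) a) (ca : HasCompactSupport a)
    (sb : ContDiff ℝ (⊤ : ℕ∞) b) (cb : HasCompactSupport b)
    (ξ : ℝ × ℝ) :
    fourierR (corr a b) ξ = fourierR a ξ * (starRingEnd ℂ) (fourierR b ξ) := by
  have ib := sb.continuous.integrable_of_hasCompactSupport (μ := volume) cb
  rw [corr, fourierR_convolution (sa.continuous.integrable_of_hasCompactSupport ca) ib.comp_neg,
    fourierR_comp_neg]

theorem integrable_fourierR_mul_conj (sa : ContDiff ℝ (⊤ : ℕ∞) a) (ca : HasCompactSupport a)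
    (sb : ContDiff ℝ (⊤ : ℕ∞) b) (cb : HasCompactSupport b)
    (hSC : Integrable (fun ξ => 1 / (1 + euclNorm ξ ^ (2 / 3 : ℝ))) μ) :
    Integrable (fun ξ => fourierR a ξ * (starRingEnd ℂ) (fourierR b ξ)) μ := by
  have h := exists_norm_fourierR_mul_le (contDiff_corr sa ca sb) (hasCompactSupport_corr ca cb)
  obtain ⟨C, -, hC⟩ := h
  simp_rw [fourierR_corr sa ca sb cb] at hC
  refine integrable_of_decay hSC ?_ hC
  exact (measurable_fourierR sa.continuous.measurable).mul
    (Complex.continuous_conj.measurable.comp (measurable_fourierR sb.continuous.measurable))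

/-- The correlation is smooth with compact support, hence a legitimate argument of the spectral
identity, and its Fourier transform is 𝓕a times the conjugate of 𝓕b. -/
theorem integral_mul_corr (sa : ContDiff ℝ (⊤ : ℕ∞) a) (ca : HasCompactSupport a)
    (sb : ContDiff ℝ (⊤ : ℕ∞) b) (cb : HasCompactSupport b)
    (hμ : IsSpectralMeasure f μ) :
    ((∫ z, f z * corr a b z : ℝ) : ℂ)
      = ∫ ξ, fourierR a ξ * (starRingEnd ℂ) (fourierR b ξ) ∂μ := by
  have hs : ContDiff ℝ (⊤ : ℕ∞) fun x => ((corr a b x : ℝ) : ℂ) :=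
    Complex.ofRealCLM.contDiff.comp (contDiff_corr sa ca sb)
  have hc : HasCompactSupport fun x => ((corr a b x : ℝ) : ℂ) :=
    (hasCompactSupport_corr ca cb).comp_left (g := Complex.ofReal) Complex.ofReal_zero
  have h := hμ.identity (hc.toSchwartzMap hs)
  simp_rw [← fourierR_corr sa ca sb cb]
  rw [← integral_complex_ofReal]
  refine Eq.trans ?_ h
  refine integral_congr_ae (Eventually.of_forall fun z => ?_)
  simp

/-- Substitute z = x - y and exchange the integrals. Fubini applies because the supports of a and b
confine z to a ball of radius A + B, on which f is integrable. -/
theorem integral_integral_mul_eq_corr (sa : ContDiff ℝ (⊤ : ℕ∞) a) (ca : HasCompactSupport a)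
    (sb : ContDiff ℝ (⊤ : ℕ∞) b) (cb : HasCompactSupport b)
    (hμ : IsSpectralMeasure f μ) :
    ∫ x, ∫ y, a x * f (x - y) * b y = ∫ z, f z * corr a b z := by
  obtain ⟨A, hA⟩ := ca.isBounded.subset_closedBall (0 : ℝ × ℝ)
  obtain ⟨B, hB⟩ := cb.isBounded.subset_closedBall (0 : ℝ × ℝ)
  obtain ⟨D, hD⟩ := cb.exists_bound_of_continuous sb.continuous
  have hD0 : 0 ≤ D := (norm_nonneg _).trans (hD 0)
  have ia := sa.continuous.integrable_of_hasCompactSupport (μ := volume) ca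
  have hfm := aestronglyMeasurable_of_isSpectralMeasure hμ
  have hint : Integrable (fun p : (ℝ × ℝ) × (ℝ × ℝ) => a p.1 * f p.2 * b (p.1 - p.2))
      (volume.prod volume) := by
    have h1 : Integrable (fun p : (ℝ × ℝ) × (ℝ × ℝ) => a p.1 *
        (Metric.closedBall 0 (A + B)).indicator f p.2) (volume.prod volume) :=
      ia.mul_prod ((integrable_indicator_iff Metric.isClosed_closedBall.measurableSet).2
        (integrableOn_closedBall_of_isSpectralMeasure hμ _))
    refine (h1.norm.const_mul D).mono' ?_ (Eventually.of_forall fun p => ?_)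
    · refine (AEStronglyMeasurable.mul ?_ ?_).mul ?_
      · exact ia.aestronglyMeasurable.comp_fst
      · exact hfm.comp_snd
      · exact (sb.continuous.comp (by fun_prop)).aestronglyMeasurable
    · by_cases hp : a p.1 = 0 ∨ b (p.1 - p.2) = 0
      · have : a p.1 * f p.2 * b (p.1 - p.2) = 0 := by rcases hp with h | h <;> simp [h]
        rw [this, norm_zero]
        positivity
      · push Not at hp
        have e1 := mem_closedBall_zero_iff.1 (hA (subset_tsupport a hp.1))
        have e2 := mem_closedBall_zero_iff.1 (hB (subset_tsupport b hp.2))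
        have e3 : p.2 ∈ Metric.closedBall (0 : ℝ × ℝ) (A + B) := by
          rw [mem_closedBall_zero_iff]
          calc ‖p.2‖ = ‖p.1 - (p.1 - p.2)‖ := by rw [sub_sub_cancel]
            _ ≤ ‖p.1‖ + ‖p.1 - p.2‖ := norm_sub_le _ _
            _ ≤ A + B := add_le_add e1 e2
        rw [Set.indicator_of_mem e3, norm_mul, mul_comm]
        exact mul_le_mul_of_nonneg_right (hD _) (norm_nonneg _)
  calc ∫ x, ∫ y, a x * f (x - y) * b y
      = ∫ x, ∫ z, a x * f z * b (x - z) := by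
        refine integral_congr_ae (Eventually.of_forall fun x => ?_)
        simp only
        rw [← integral_sub_left_eq_self (fun y => a x * f (x - y) * b y) volume x]
        simp only [sub_sub_cancel]
    _ = ∫ z, ∫ x, a x * f z * b (x - z) := integral_integral_swap hint
    _ = ∫ z, f z * corr a b z := by
        refine integral_congr_ae (Eventually.of_forall fun z => ?_)
        simp only
        rw [corr_apply, ← integral_const_mul]
        refine integral_congr_ae (Eventually.of_forall fun x => ?_)
        simp only
        ring

theorem integral_integral_mul_eq_fourierR (sa : ContDiff ℝ (⊤ : ℕ∞) a) (ca : HasCompactSupport a)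
    (sb : ContDiff ℝ (⊤ : ℕ∞) b) (cb : HasCompactSupport b)
    (hμ : IsSpectralMeasure f μ) :
    ((∫ x, ∫ y, a x * f (x - y) * b y : ℝ) : ℂ)
      = ∫ ξ, fourierR a ξ * (starRingEnd ℂ) (fourierR b ξ) ∂μ := by
  rw [integral_integral_mul_eq_corr sa ca sb cb hμ, integral_mul_corr sa ca sb cb hμ]

end Smooth

/-! ### Mollifiers and the energy of bounded functions with bounded support -/

/-- A sequence of bump functions concentrating at the origin. -/
def bump (n : ℕ) : ContDiffBump (0 : ℝ × ℝ) :=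
  ⟨1 / (2 * ((n : ℝ) + 1)), 1 / ((n : ℝ) + 1), by positivity, by
    apply one_div_lt_one_div_of_lt <;> linarith [(Nat.cast_nonneg n : (0 : ℝ) ≤ n)]⟩

theorem bump_rOut_le (n : ℕ) : (bump n).rOut ≤ 1 := by
  change 1 / ((n : ℝ) + 1) ≤ 1
  rw [div_le_one (by positivity)]
  linarith [(Nat.cast_nonneg n : (0 : ℝ) ≤ n)]

theorem tendsto_bump_rOut : Tendsto (fun n => (bump n).rOut) atTop (𝓝 0) :=
  tendsto_one_div_add_atTop_nhds_zero_nat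

/-- The mollifiers. -/
def mollifier (n : ℕ) : ℝ × ℝ → ℝ := (bump n).normed volume

theorem integrable_mollifier (n : ℕ) : Integrable (mollifier n) := (bump n).integrable_normed

theorem mollifier_nonneg (n : ℕ) (x : ℝ × ℝ) : 0 ≤ mollifier n x := (bump n).nonneg_normed x

theorem integral_mollifier (n : ℕ) : ∫ x, mollifier n x = 1 := (bump n).integral_normed

theorem contDiff_mollifier (n : ℕ) : ContDiff ℝ (⊤ : ℕ∞) (mollifier n) := (bump n).contDiff_normed

theorem hasCompactSupport_mollifier (n : ℕ) : HasCompactSupport (mollifier n) :=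
  (bump n).hasCompactSupport_normed

theorem norm_le_one_of_mollifier_ne_zero {n : ℕ} {x : ℝ × ℝ} (h : mollifier n x ≠ 0) :
    ‖x‖ ≤ 1 := by
  have : x ∈ Function.support ((bump n).normed volume) := h
  rw [ContDiffBump.support_normed_eq, mem_ball_zero_iff] at this
  exact this.le.trans (bump_rOut_le n)

theorem norm_fourierR_mollifier_le (n : ℕ) (ξ : ℝ × ℝ) : ‖fourierR (mollifier n) ξ‖ ≤ 1 := by
  refine (norm_fourierR_le _ ξ).trans (le_of_eq ?_)
  rw [← integral_mollifier n]
  exact integral_congr_ae (Eventually.of_forall fun x => Real.norm_of_nonneg (mollifier_nonneg n x))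

theorem tendsto_fourierR_mollifier (ξ : ℝ × ℝ) :
    Tendsto (fun n => fourierR (mollifier n) ξ) atTop (𝓝 1) := by
  have h := ContDiffBump.convolution_tendsto_right_of_continuous (μ := volume) (φ := bump)
    tendsto_bump_rOut (g := fun x => chr ξ (-x)) ((continuous_chr_right ξ).comp continuous_neg) 0
  simp only [neg_zero, chr_zero] at h
  refine h.congr fun n => ?_
  rw [convolution_def, fourierR_eq]
  refine integral_congr_ae (Eventually.of_forall fun x => ?_)
  simp [mollifier, mul_comm]

/-- The convolution with a mollifier. -/
def mollify (n : ℕ) (a : ℝ × ℝ → ℝ) : ℝ × ℝ → ℝ :=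
  mollifier n ⋆[ContinuousLinearMap.lsmul ℝ ℝ, volume] a

theorem mollify_apply (n : ℕ) (a : ℝ × ℝ → ℝ) (x : ℝ × ℝ) :
    mollify n a x = ∫ t, mollifier n t * a (x - t) := by
  simp [mollify, convolution_def]

theorem mollify_eq_zero {n : ℕ} {a : ℝ × ℝ → ℝ} {N : ℝ} (ha : ∀ x, a x ≠ 0 → ‖x‖ ≤ N)
    {x : ℝ × ℝ} (hx : N + 1 < ‖x‖) : mollify n a x = 0 := by
  rw [mollify_apply]
  refine integral_eq_zero_of_ae (Eventually.of_forall fun t => ?_)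
  by_contra h
  have h1 := norm_le_one_of_mollifier_ne_zero (left_ne_zero_of_mul h)
  have h2 := ha _ (right_ne_zero_of_mul h)
  have h3 : ‖x‖ ≤ ‖x - t‖ + ‖t‖ := norm_le_norm_sub_add x t
  linarith

theorem abs_mollify_le {n : ℕ} {a : ℝ × ℝ → ℝ} {c : ℝ} (hc : ∀ x, |a x| ≤ c) (x : ℝ × ℝ) :
    |mollify n a x| ≤ c := by
  rw [mollify_apply]
  refine (norm_integral_le_integral_norm (μ := volume)
    (fun t => mollifier n t * a (x - t))).trans ?_
  calc ∫ t, ‖mollifier n t * a (x - t)‖ ≤ ∫ t, mollifier n t * c := by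
        refine integral_mono_of_nonneg (Eventually.of_forall fun t => norm_nonneg _)
          ((integrable_mollifier n).mul_const c) (Eventually.of_forall fun t => ?_)
        simp only
        rw [norm_mul, Real.norm_of_nonneg (mollifier_nonneg n t)]
        exact mul_le_mul_of_nonneg_left (hc _) (mollifier_nonneg n t)
    _ = c := by rw [integral_mul_const, integral_mollifier, one_mul]

theorem integrable_mollify (n : ℕ) {a : ℝ × ℝ → ℝ} (ha : Integrable a) :
    Integrable (mollify n a) :=
  (integrable_mollifier n).integrable_convolution _ ha

theorem integral_norm_mollify_le (n : ℕ) {a : ℝ × ℝ → ℝ} (ha : Integrable a) :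
    ∫ x, ‖mollify n a x‖ ≤ ∫ x, ‖a x‖ := by
  have h1 : ∫ x, mollify n (fun x => ‖a x‖) x = ∫ x, ‖a x‖ := by
    rw [mollify, integral_convolution (μ := volume) (ν := volume) _ (integrable_mollifier n) ha.norm]
    simp [integral_mollifier]
  rw [← h1]
  refine integral_mono (integrable_mollify n ha).norm (integrable_mollify n ha.norm) fun x => ?_
  simp only [mollify_apply]
  refine (norm_integral_le_integral_norm _).trans (le_of_eq ?_)
  refine integral_congr_ae (Eventually.of_forall fun t => ?_)
  simp only
  rw [norm_mul, Real.norm_of_nonneg (mollifier_nonneg n t)]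

theorem contDiff_mollify (n : ℕ) {a : ℝ × ℝ → ℝ} (ha : Integrable a) :
    ContDiff ℝ (⊤ : ℕ∞) (mollify n a) :=
  (hasCompactSupport_mollifier n).contDiff_convolution_left _ (contDiff_mollifier n)
    ha.locallyIntegrable

theorem fourierR_mollify (n : ℕ) {a : ℝ × ℝ → ℝ} (ha : Integrable a) (ξ : ℝ × ℝ) :
    fourierR (mollify n a) ξ = fourierR (mollifier n) ξ * fourierR a ξ :=
  fourierR_convolution (integrable_mollifier n) ha ξ

theorem integrable_of_bounded_support {a : ℝ × ℝ → ℝ} (hm : Measurable a) {c N : ℝ}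
    (hc : ∀ x, |a x| ≤ c) (hN : ∀ x, a x ≠ 0 → ‖x‖ ≤ N) : Integrable a := by
  have h : IntegrableOn a (Metric.closedBall 0 N) :=
    Measure.integrableOn_of_bounded (M := c) (isCompact_closedBall _ _).measure_lt_top.ne
      hm.aestronglyMeasurable (Eventually.of_forall hc)
  refine (integrableOn_iff_integrable_of_support_subset fun x hx => ?_).1 h
  exact mem_closedBall_zero_iff.2 (hN x hx)

/-- The basic bound for bounded functions with bounded support. -/
theorem exists_lintegral_fourierR_sq_le (hμ : IsSpectralMeasure f μ)
    (hSC : Integrable (fun ξ => 1 / (1 + euclNorm ξ ^ (2 / 3 : ℝ))) μ) (N : ℝ) :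
    ∃ C : ℝ, 0 ≤ C ∧ ∀ (a : ℝ × ℝ → ℝ) (c : ℝ), Measurable a → (∀ x, |a x| ≤ c) →
      (∀ x, a x ≠ 0 → ‖x‖ ≤ N) →
      ∫⁻ ξ, ‖fourierR a ξ‖ₑ ^ 2 ∂μ ≤ ENNReal.ofReal (C * c * ∫ x, ‖a x‖) := by
  set R := 2 * (N + 1) with hR
  -- A mollified function is supported within radius N + 1, so its self-correlation lives in the
  -- ball of radius R = 2(N + 1), where it is at most c ‖a‖₁. Pairing it with f gives this constant.
  refine ⟨∫ z in Metric.closedBall 0 R, ‖f z‖, by positivity, fun a c hm hc hN => ?_⟩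
  have ia := integrable_of_bounded_support hm hc hN
  have hc0 : 0 ≤ c := (abs_nonneg _).trans (hc 0)
  have hIf := integrableOn_closedBall_of_isSpectralMeasure hμ R
  have step : ∀ n, ∫⁻ ξ, ‖fourierR (mollify n a) ξ‖ₑ ^ 2 ∂μ
      ≤ ENNReal.ofReal ((∫ z in Metric.closedBall 0 R, ‖f z‖) * c * ∫ x, ‖a x‖) := by
    intro n
    have sa := contDiff_mollify n ia
    have ca : HasCompactSupport (mollify n a) :=
      HasCompactSupport.intro (isCompact_closedBall 0 (N + 1)) fun x hx =>
        mollify_eq_zero hN (by rwa [mem_closedBall_zero_iff, not_le] at hx)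
    have hI := integrable_fourierR_mul_conj (μ := μ) sa ca sa ca hSC
    have hid := integral_mul_corr sa ca sa ca hμ
    have hnn : ∀ ξ, fourierR (mollify n a) ξ * (starRingEnd ℂ) (fourierR (mollify n a) ξ)
        = ((‖fourierR (mollify n a) ξ‖ ^ 2 : ℝ) : ℂ) := fun ξ => by
      rw [Complex.mul_conj, Complex.normSq_eq_norm_sq]
    simp_rw [hnn] at hid hI
    rw [integral_complex_ofReal] at hid
    have hid' := Complex.ofReal_injective hid
    have hI' : Integrable (fun ξ => ‖fourierR (mollify n a) ξ‖ ^ 2) μ := by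
      have := hI.re
      simpa only [RCLike.re_to_complex, Complex.ofReal_re] using this
    have hl : ∫⁻ ξ, ‖fourierR (mollify n a) ξ‖ₑ ^ 2 ∂μ
        = ENNReal.ofReal (∫ ξ, ‖fourierR (mollify n a) ξ‖ ^ 2 ∂μ) := by
      rw [ofReal_integral_eq_lintegral_ofReal hI' (Eventually.of_forall fun ξ => by positivity)]
      refine lintegral_congr fun ξ => ?_
      rw [ENNReal.ofReal_pow (norm_nonneg _), ofReal_norm]
    rw [hl, ← hid']
    refine ENNReal.ofReal_le_ofReal ?_
    have hcorr : ∀ z, ‖corr (mollify n a) (mollify n a) z‖ ≤ c * ∫ x, ‖a x‖ := by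
      intro z
      rw [corr_apply]
      refine (norm_integral_le_integral_norm _).trans ?_
      calc ∫ x, ‖mollify n a x * mollify n a (x - z)‖ ≤ ∫ x, c * ‖mollify n a x‖ := by
            refine integral_mono_of_nonneg (Eventually.of_forall fun x => norm_nonneg _)
              ((integrable_mollify n ia).norm.const_mul c) (Eventually.of_forall fun x => ?_)
            simp only
            rw [norm_mul, mul_comm]
            exact mul_le_mul_of_nonneg_right (abs_mollify_le hc _) (norm_nonneg _)
        _ ≤ c * ∫ x, ‖a x‖ := by
            rw [integral_const_mul]
            exact mul_le_mul_of_nonneg_left (integral_norm_mollify_le n ia) hc0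
    have hcorr0 : ∀ z, z ∉ Metric.closedBall (0 : ℝ × ℝ) R →
        corr (mollify n a) (mollify n a) z = 0 := by
      intro z hz
      rw [mem_closedBall_zero_iff, not_le] at hz
      rw [corr_apply]
      refine integral_eq_zero_of_ae (Eventually.of_forall fun x => ?_)
      by_contra h
      have e1 : ‖x‖ ≤ N + 1 := not_lt.1 fun h' => left_ne_zero_of_mul h (mollify_eq_zero hN h')
      have e2 : ‖x - z‖ ≤ N + 1 := not_lt.1 fun h' =>
        right_ne_zero_of_mul h (mollify_eq_zero hN h')
      have e3 : ‖z‖ ≤ ‖x‖ + ‖x - z‖ := by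
        calc ‖z‖ = ‖x - (x - z)‖ := by rw [sub_sub_cancel]
          _ ≤ _ := norm_sub_le _ _
      linarith
    have hsupp : ∫ z, f z * corr (mollify n a) (mollify n a) z
        = ∫ z in Metric.closedBall 0 R, f z * corr (mollify n a) (mollify n a) z := by
      symm
      refine setIntegral_eq_integral_of_forall_compl_eq_zero fun z hz => ?_
      rw [hcorr0 z hz, mul_zero]
    rw [hsupp]
    refine (le_abs_self _).trans ((norm_integral_le_integral_norm (μ := volume.restrict
      (Metric.closedBall 0 R)) (fun z => f z * corr (mollify n a) (mollify n a) z)).trans ?_)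
    rw [mul_assoc, ← integral_mul_const]
    refine integral_mono_of_nonneg (Eventually.of_forall fun x => norm_nonneg _)
      (hIf.norm.mul_const _) (Eventually.of_forall fun z => ?_)
    simp only
    rw [norm_mul]
    exact mul_le_mul_of_nonneg_left (hcorr z) (norm_nonneg _)
  have hlim : ∀ ξ, Tendsto (fun n => ‖fourierR (mollify n a) ξ‖ₑ ^ 2) atTop
      (𝓝 (‖fourierR a ξ‖ₑ ^ 2)) := by
    intro ξ
    simp_rw [fourierR_mollify _ ia]
    have := ((tendsto_fourierR_mollifier ξ).mul_const (fourierR a ξ)).enorm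
    rw [one_mul] at this
    exact ENNReal.Tendsto.pow this
  -- The smooth estimate is uniform in n and the transforms converge pointwise, so Fatou's lemma
  -- passes the inequality to a.
  calc ∫⁻ ξ, ‖fourierR a ξ‖ₑ ^ 2 ∂μ
      = ∫⁻ ξ, liminf (fun n => ‖fourierR (mollify n a) ξ‖ₑ ^ 2) atTop ∂μ := by
        refine lintegral_congr fun ξ => ?_
        rw [(hlim ξ).liminf_eq]
    _ ≤ liminf (fun n => ∫⁻ ξ, ‖fourierR (mollify n a) ξ‖ₑ ^ 2 ∂μ) atTop := by
        refine lintegral_liminf_le fun n => ?_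
        exact ((measurable_fourierR (contDiff_mollify n ia).continuous.measurable).enorm.pow_const 2)
    _ ≤ _ := by
        refine liminf_le_of_le (by isBoundedDefault) fun b hb => ?_
        obtain ⟨n, hn⟩ := hb.exists
        exact hn.trans (step n)

end Spectral

/-! ### The space of deterministic integrands -/

/-- The Fourier transform of an integrand in the space variable. -/
def ft (h : ℝ × ℝ × ℝ → ℝ) (q : ℝ × (ℝ × ℝ)) : ℂ := fourierR (fun y => h (q.1, y)) q.2

/-- The measure `ds μ(dξ)` on `(0, ∞) × ℝ²`. -/
def specMeasure (μ : Measure (ℝ × ℝ)) : Measure (ℝ × (ℝ × ℝ)) :=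
  (volume.restrict (Set.Ioi 0)).prod μ

theorem measurable_ft {h : ℝ × ℝ × ℝ → ℝ} (hh : Measurable h) : Measurable (ft h) :=
  measurable_fourierR_slice hh

theorem ft_add {g h : ℝ × ℝ × ℝ → ℝ} (hg : ∀ s, Integrable fun y => g (s, y))
    (hh : ∀ s, Integrable fun y => h (s, y)) : ft (g + h) = ft g + ft h :=
  funext fun q => fourierR_add (hg q.1) (hh q.1) q.2

theorem ft_smul (c : ℝ) (h : ℝ × ℝ × ℝ → ℝ) : ft (c • h) = c • ft h := by
  funext q
  refine (fourierR_const_mul c (fun y => h (q.1, y)) q.2).trans ?_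
  simp [ft]

/-- Integrands with integrable time slices and finite energy. -/
def admissible (μ : Measure (ℝ × ℝ)) : Submodule ℝ (ℝ × ℝ × ℝ → ℝ) where
  carrier := {h | Measurable h ∧ (∀ s, Integrable fun y => h (s, y)) ∧
    MemLp (ft h) 2 (specMeasure μ)}
  zero_mem' := by
    refine ⟨measurable_zero, fun s => integrable_zero _ _ _, ?_⟩
    have : ft 0 = 0 := by
      have := ft_smul 0 0
      simpa using this
    rw [this]
    exact MemLp.zero
  add_mem' := fun {g h} hg hh => by
    refine ⟨hg.1.add hh.1, fun s => (hg.2.1 s).add (hh.2.1 s), ?_⟩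
    rw [ft_add hg.2.1 hh.2.1]
    exact hg.2.2.add hh.2.2
  smul_mem' := fun c h hh => by
    refine ⟨hh.1.const_smul c, fun s => (hh.2.1 s).smul c, ?_⟩
    rw [ft_smul]
    exact hh.2.2.const_smul c

/-- The isometric embedding of the integrands into `L²(ds μ(dξ))`. -/
def spec (μ : Measure (ℝ × ℝ)) : admissible μ →ₗ[ℝ] Lp ℂ 2 (specMeasure μ) where
  toFun h := h.2.2.2.toLp (ft h.1)
  map_add' g h := by
    rw [← MemLp.toLp_add]
    exact MemLp.toLp_congr _ _ (by
      rw [← ft_add g.2.2.1 h.2.2.1]; rfl)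
  map_smul' c h := by
    rw [RingHom.id_apply, ← MemLp.toLp_const_smul]
    exact MemLp.toLp_congr _ _ (by
      rw [← ft_smul]; rfl)

section
variable {μ : Measure (ℝ × ℝ)}

theorem coeFn_spec (h : admissible μ) : spec μ h =ᵐ[specMeasure μ] ft h.1 :=
  MemLp.coeFn_toLp h.2.2.2

theorem lintegral_specMeasure [SigmaFinite μ] {h : ℝ × ℝ × ℝ → ℝ} (hh : Measurable h) :
    ∫⁻ q, ‖ft h q‖ₑ ^ 2 ∂(specMeasure μ)
      = ∫⁻ s in Set.Ioi 0, ∫⁻ ξ, ‖ft h (s, ξ)‖ₑ ^ 2 ∂μ :=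
  lintegral_prod _ ((measurable_ft hh).enorm.pow_const 2).aemeasurable

theorem eLpNorm_two_sq {α : Type*} [MeasurableSpace α] {ν : Measure α} {E : Type*}
    [NormedAddCommGroup E] (g : α → E) : eLpNorm g 2 ν ^ 2 = ∫⁻ x, ‖g x‖ₑ ^ 2 ∂ν := by
  rw [eLpNorm_eq_lintegral_rpow_enorm_toReal (by norm_num) (by norm_num)]
  simp only [ENNReal.toReal_ofNat, ENNReal.rpow_ofNat, one_div]
  rw [← ENNReal.rpow_natCast, ← ENNReal.rpow_mul]
  simp

theorem enorm_spec_sq (h : admissible μ) :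
    ‖spec μ h‖ₑ ^ 2 = ∫⁻ q, ‖ft h.1 q‖ₑ ^ 2 ∂(specMeasure μ) := by
  rw [← eLpNorm_two_sq]
  congr 1
  exact Lp.enorm_toLp h.2.2.2

theorem energy_eq [SigmaFinite μ] (h : admissible μ) : energy μ h.1 = ‖spec μ h‖ₑ ^ 2 := by
  rw [enorm_spec_sq, lintegral_specMeasure h.2.1]
  rfl

/-- The energy integrates over s > 0 only, so values at s ≤ 0 are invisible. -/
theorem spec_congr {g h : admissible μ} (hgh : ∀ s, 0 < s → ∀ y, g.1 (s, y) = h.1 (s, y)) :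
    spec μ g = spec μ h := by
  refine MemLp.toLp_congr g.2.2.2 h.2.2.2 ?_
  have hmem : ∀ᵐ q ∂(specMeasure μ), 0 < q.1 := by
    have h1 : ∀ᵐ s : ℝ ∂(volume.restrict (Set.Ioi 0)), 0 < s := ae_restrict_mem measurableSet_Ioi
    exact Measure.quasiMeasurePreserving_fst.ae h1
  filter_upwards [hmem] with q hq
  simp only [ft, hgh q.1 hq]

/-- `h` is measurable, bounded by `c`, and supported in `[-S, S]` times the ball of radius `N`. -/
structure BddSupp (S N c : ℝ) (h : ℝ × ℝ × ℝ → ℝ) : Prop where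
  measurable : Measurable h
  bound : ∀ p, |h p| ≤ c
  supp : ∀ p, h p ≠ 0 → |p.1| ≤ S ∧ ‖p.2‖ ≤ N

theorem BddSupp.mono {S N c S' N' c' : ℝ} {h : ℝ × ℝ × ℝ → ℝ} (hh : BddSupp S N c h)
    (hS : S ≤ S') (hN : N ≤ N') (hc : c ≤ c') : BddSupp S' N' c' h :=
  ⟨hh.measurable, fun p => (hh.bound p).trans hc, fun p hp =>
    ⟨(hh.supp p hp).1.trans hS, (hh.supp p hp).2.trans hN⟩⟩

theorem BddSupp.sub {S N c c' : ℝ} {g h : ℝ × ℝ × ℝ → ℝ} (hg : BddSupp S N c g)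
    (hh : BddSupp S N c' h) : BddSupp S N (c + c') (g - h) := by
  refine ⟨hg.measurable.sub hh.measurable, fun p =>
    (abs_sub _ _).trans (add_le_add (hg.bound p) (hh.bound p)), fun p hp => ?_⟩
  by_cases h1 : g p = 0
  · exact hh.supp p fun h2 => hp (by simp [h1, h2])
  · exact hg.supp p h1

theorem BddSupp.enorm_le_indicator {S N c : ℝ} {h : ℝ × ℝ × ℝ → ℝ} (hh : BddSupp S N c h)
    (p : ℝ × ℝ × ℝ) : ‖h p‖ₑ ≤ (Set.Icc (-S) S ×ˢ Metric.closedBall (0 : ℝ × ℝ) N).indicator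
      (fun _ => ENNReal.ofReal c) p := by
  by_cases hp : h p = 0
  · rw [hp, enorm_zero]; exact zero_le
  · have := hh.supp p hp
    have hmem : p ∈ Set.Icc (-S) S ×ˢ Metric.closedBall (0 : ℝ × ℝ) N :=
      ⟨abs_le.1 this.1, mem_closedBall_zero_iff.2 this.2⟩
    rw [Set.indicator_of_mem hmem, ← ofReal_norm]
    exact ENNReal.ofReal_le_ofReal (hh.bound p)

theorem lintegral_box_lt_top (S N c : ℝ) :
    ∫⁻ p : ℝ × ℝ × ℝ, (Set.Icc (-S) S ×ˢ Metric.closedBall (0 : ℝ × ℝ) N).indicator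
      (fun _ => ENNReal.ofReal c) p < ∞ := by
  rw [lintegral_indicator (measurableSet_Icc.prod Metric.isClosed_closedBall.measurableSet),
    setLIntegral_const]
  refine ENNReal.mul_lt_top ENNReal.ofReal_lt_top ?_
  exact (isCompact_Icc.prod (isCompact_closedBall _ _)).measure_lt_top

theorem BddSupp.integrable_slice {S N c : ℝ} {h : ℝ × ℝ × ℝ → ℝ} (hh : BddSupp S N c h) (s : ℝ) :
    Integrable fun y => h (s, y) :=
  integrable_of_bounded_support (hh.measurable.comp (f := fun y : ℝ × ℝ => (s, y)) (by fun_prop))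
    (fun y => hh.bound (s, y)) fun y hy => (hh.supp (s, y) hy).2

end

section
variable {f : ℝ × ℝ → ℝ} {μ : Measure (ℝ × ℝ)}

/-- The energy of a bounded integrand with bounded support is controlled by its `L¹` norm. -/
theorem exists_lintegral_ft_sq_le (hμ : IsSpectralMeasure f μ)
    (hSC : Integrable (fun ξ => 1 / (1 + euclNorm ξ ^ (2 / 3 : ℝ))) μ) (N : ℝ) :
    ∃ C : ℝ, 0 ≤ C ∧ ∀ (S c : ℝ) (h : ℝ × ℝ × ℝ → ℝ), BddSupp S N c h →
      ∫⁻ q, ‖ft h q‖ₑ ^ 2 ∂(specMeasure μ) ≤ ENNReal.ofReal (C * c) * ∫⁻ p, ‖h p‖ₑ := by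
  have := sigmaFinite_of_decay hSC
  obtain ⟨C, hC0, hC⟩ := exists_lintegral_fourierR_sq_le hμ hSC N
  refine ⟨C, hC0, fun S c h hh => ?_⟩
  have hc0 : 0 ≤ c := (abs_nonneg _).trans (hh.bound 0)
  rw [lintegral_specMeasure hh.measurable]
  calc ∫⁻ s in Set.Ioi 0, ∫⁻ ξ, ‖ft h (s, ξ)‖ₑ ^ 2 ∂μ
      ≤ ∫⁻ s in Set.Ioi 0, ENNReal.ofReal (C * c) * ∫⁻ y, ‖h (s, y)‖ₑ := by
        refine lintegral_mono fun s => ?_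
        refine (hC (fun y => h (s, y)) c (hh.measurable.comp (f := fun y : ℝ × ℝ => (s, y))
          (by fun_prop)) (fun y => hh.bound (s, y)) fun y hy => (hh.supp (s, y) hy).2).trans ?_
        rw [ENNReal.ofReal_mul (by positivity),
          ofReal_integral_norm_eq_lintegral_enorm (hh.integrable_slice s)]
    _ ≤ ∫⁻ s, ENNReal.ofReal (C * c) * ∫⁻ y, ‖h (s, y)‖ₑ := setLIntegral_le_lintegral _ _
    _ = ENNReal.ofReal (C * c) * ∫⁻ p, ‖h p‖ₑ := by
        rw [lintegral_const_mul' _ _ ENNReal.ofReal_ne_top]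
        exact congrArg _ (lintegral_prod (μ := volume) (ν := volume)
          (fun p : ℝ × (ℝ × ℝ) => ‖h p‖ₑ) hh.measurable.enorm.aemeasurable).symm

theorem BddSupp.mem_admissible (hμ : IsSpectralMeasure f μ)
    (hSC : Integrable (fun ξ => 1 / (1 + euclNorm ξ ^ (2 / 3 : ℝ))) μ) {S N c : ℝ}
    {h : ℝ × ℝ × ℝ → ℝ} (hh : BddSupp S N c h) : h ∈ admissible μ := by
  refine ⟨hh.measurable, hh.integrable_slice, (measurable_ft hh.measurable).aestronglyMeasurable, ?_⟩
  obtain ⟨C, -, hC⟩ := exists_lintegral_ft_sq_le hμ hSC N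
  have h1 : eLpNorm (ft h) 2 (specMeasure μ) ^ 2 < ∞ := by
    rw [eLpNorm_two_sq]
    refine (hC S c h hh).trans_lt (ENNReal.mul_lt_top ENNReal.ofReal_lt_top ?_)
    exact (lintegral_mono hh.enorm_le_indicator).trans_lt (lintegral_box_lt_top S N c)
  exact lt_top_iff_ne_top.2 fun h2 => by simp [h2] at h1

theorem tendsto_zero_of_tendsto_sq_zero {ι : Type*} {l : Filter ι} {a : ι → ℝ≥0∞}
    (ha : Tendsto (fun n => a n ^ 2) l (𝓝 0)) : Tendsto a l (𝓝 0) := by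
  have h4 := ha.ennrpow_const (1 / 2)
  rw [ENNReal.zero_rpow_of_pos (by norm_num)] at h4
  refine h4.congr fun n => ?_
  rw [← ENNReal.rpow_natCast, ← ENNReal.rpow_mul]
  norm_num

/-- Bounded pointwise convergence implies convergence of the spectral images. -/
theorem tendsto_spec_of_bddSupp (hμ : IsSpectralMeasure f μ)
    (hSC : Integrable (fun ξ => 1 / (1 + euclNorm ξ ^ (2 / 3 : ℝ))) μ) {S N c : ℝ}
    {g : ℕ → admissible μ} {h : admissible μ} (hg : ∀ n, BddSupp S N c (g n).1)
    (hh : BddSupp S N c h.1) (hlim : ∀ p, Tendsto (fun n => (g n).1 p) atTop (𝓝 (h.1 p))) :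
    Tendsto (fun n => spec μ (g n)) atTop (𝓝 (spec μ h)) := by
  obtain ⟨C, -, hC⟩ := exists_lintegral_ft_sq_le hμ hSC N
  have hdiff : ∀ n, BddSupp S N (c + c) ((g n).1 - h.1) := fun n => (hg n).sub hh
  have h1 : Tendsto (fun n => ∫⁻ p, ‖(g n).1 p - h.1 p‖ₑ) atTop (𝓝 0) := by
    have := tendsto_lintegral_of_dominated_convergence (μ := volume)
      (F := fun n p => ‖(g n).1 p - h.1 p‖ₑ) (f := fun _ => 0)
      _ (fun n => (hdiff n).measurable.enorm)
      (fun n => Eventually.of_forall (hdiff n).enorm_le_indicator)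
      (lintegral_box_lt_top S N (c + c)).ne
      (Eventually.of_forall fun p => by
        have := ((hlim p).sub_const (h.1 p)).enorm
        simpa using this)
    simpa using this
  have h2 : Tendsto (fun n => ENNReal.ofReal (C * (c + c)) * ∫⁻ p, ‖(g n).1 p - h.1 p‖ₑ) atTop
      (𝓝 0) := by
    have := ENNReal.Tendsto.const_mul (a := ENNReal.ofReal (C * (c + c))) h1
      (Or.inr ENNReal.ofReal_ne_top)
    simpa using this
  have h3 : Tendsto (fun n => ‖spec μ (g n) - spec μ h‖ₑ ^ 2) atTop (𝓝 0) := by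
    refine tendsto_of_tendsto_of_tendsto_of_le_of_le tendsto_const_nhds h2 (fun _ => zero_le)
      fun n => ?_
    rw [← map_sub, enorm_spec_sq]
    exact hC S _ _ (hdiff n)
  rw [tendsto_iff_edist_tendsto_0]
  simp_rw [edist_eq_enorm_sub]
  exact tendsto_zero_of_tendsto_sq_zero h3

theorem exists_bddSupp_testFn (φ : TestFn) : ∃ S N c : ℝ, BddSupp S N c φ := by
  obtain ⟨R, hR⟩ := φ.hasCompactSupport.isBounded.subset_closedBall (0 : ℝ × ℝ × ℝ)
  obtain ⟨c, hc⟩ := φ.hasCompactSupport.exists_bound_of_continuous φ.continuous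
  refine ⟨R, R, c, φ.continuous.measurable, hc, fun p hp => ?_⟩
  have h1 := mem_closedBall_zero_iff.1 (hR (subset_tsupport _ hp))
  exact ⟨(norm_fst_le p).trans h1, (norm_snd_le p).trans h1⟩

/-- Test functions as integrands. -/
def testAdm (hμ : IsSpectralMeasure f μ)
    (hSC : Integrable (fun ξ => 1 / (1 + euclNorm ξ ^ (2 / 3 : ℝ))) μ) :
    TestFn →ₗ[ℝ] admissible μ where
  toFun φ := ⟨φ, by
    obtain ⟨S, N, c, h⟩ := exists_bddSupp_testFn φ
    exact h.mem_admissible hμ hSC⟩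
  map_add' _ _ := rfl
  map_smul' _ _ := rfl

/-- For each t the spectral identity rewrites the spatial double integral as the μ-integral of
𝓕φ(t,·) times the conjugate of 𝓕ψ(t,·). As the left side is real, taking real parts gives the real
inner product on ℂ. -/
theorem covariance_eq_inner (hμ : IsSpectralMeasure f μ)
    (hSC : Integrable (fun ξ => 1 / (1 + euclNorm ξ ^ (2 / 3 : ℝ))) μ) (φ ψ : TestFn) :
    ∫ t in Set.Ioi (0 : ℝ), ∫ x : ℝ × ℝ, ∫ y : ℝ × ℝ, φ (t, x) * f (x - y) * ψ (t, y)
      = inner ℝ (spec μ (testAdm hμ hSC φ)) (spec μ (testAdm hμ hSC ψ)) := by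
  have := sigmaFinite_of_decay hSC
  have hslice : ∀ (χ : TestFn) (t : ℝ), ContDiff ℝ (⊤ : ℕ∞) (fun y : ℝ × ℝ => χ (t, y)) ∧
      HasCompactSupport (fun y : ℝ × ℝ => χ (t, y)) := by
    intro χ t
    obtain ⟨S, N, c, h⟩ := exists_bddSupp_testFn χ
    refine ⟨χ.contDiff.comp (contDiff_prodMk_right t), ?_⟩
    refine HasCompactSupport.intro (isCompact_closedBall 0 N) fun y hy => ?_
    by_contra h0
    exact hy (mem_closedBall_zero_iff.2 (h.supp (t, y) h0).2)
  have hinner : ∀ z w : ℂ, inner ℝ z w = (z * (starRingEnd ℂ) w).re := by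
    intro z w
    rw [Complex.inner]
    simp
    ring
  have hint := L2.integrable_inner (𝕜 := ℝ) (spec μ (testAdm hμ hSC φ))
    (spec μ (testAdm hμ hSC ψ))
  have hae : (fun q => inner ℝ (spec μ (testAdm hμ hSC φ) q) (spec μ (testAdm hμ hSC ψ) q))
      =ᵐ[specMeasure μ] fun q => inner ℝ (ft φ q) (ft ψ q) := by
    filter_upwards [coeFn_spec (testAdm hμ hSC φ), coeFn_spec (testAdm hμ hSC ψ)] with q h1 h2
    rw [h1, h2]
    rfl
  rw [L2.inner_def, integral_congr_ae hae]
  have hp := integral_prod (μ := volume.restrict (Set.Ioi (0 : ℝ))) (ν := μ)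
    (fun q => inner ℝ (ft φ q) (ft ψ q)) (hint.congr hae)
  refine Eq.trans ?_ hp.symm
  refine integral_congr_ae (Eventually.of_forall fun t => ?_)
  obtain ⟨s1, c1⟩ := hslice φ t
  obtain ⟨s2, c2⟩ := hslice ψ t
  have h1 := integral_integral_mul_eq_fourierR s1 c1 s2 c2 hμ
  have h2 := integrable_fourierR_mul_conj (μ := μ) s1 c1 s2 c2 hSC
  have h3 := congrArg Complex.re h1
  rw [Complex.ofReal_re] at h3
  simp only
  rw [h3]
  refine (integral_re h2).symm.trans ?_
  refine integral_congr_ae (Eventually.of_forall fun ξ => ?_)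
  simp only [hinner]
  rfl

end

/-! ### The isometry defined by the noise -/

/-- A map into a Hilbert space with the same Gram matrix as a linear map `e` factors through `e` by
a continuous linear map. -/
theorem exists_clm_of_inner_eq {V E H : Type*} [AddCommGroup V] [Module ℝ V]
    [NormedAddCommGroup E] [InnerProductSpace ℝ E] [CompleteSpace E]
    [NormedAddCommGroup H] [InnerProductSpace ℝ H] [CompleteSpace H] (e : V →ₗ[ℝ] E) (f : V → H)
    (h : ∀ x y, inner ℝ (f x) (f y) = inner ℝ (e x) (e y)) :
    ∃ J : E →L[ℝ] H, ∀ x, J (e x) = f x := by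
  -- The squared norm of f(x + y) - f x - f y expands into Gram entries; the same expansion for the
  -- linear map e is zero.
  have hadd : ∀ x y, f (x + y) = f x + f y := by
    intro x y
    rw [← sub_eq_zero, ← inner_self_eq_zero (𝕜 := ℝ)]
    simp only [inner_sub_left, inner_sub_right, inner_add_left, inner_add_right, h, map_add]
    ring
  have hsmul : ∀ (c : ℝ) x, f (c • x) = c • f x := by
    intro c x
    rw [← sub_eq_zero, ← inner_self_eq_zero (𝕜 := ℝ)]
    simp only [inner_sub_left, inner_sub_right, real_inner_smul_left, real_inner_smul_right, h,
      map_smul]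
    ring
  let fl : V →ₗ[ℝ] H := ⟨⟨f, hadd⟩, hsmul⟩
  let W : Submodule ℝ E := (LinearMap.range e).topologicalClosure
  have hWc : IsClosed (W : Set E) := Submodule.isClosed_topologicalClosure _
  have : CompleteSpace W := hWc.completeSpace_coe
  have hmem : ∀ x, e x ∈ W := fun x =>
    Submodule.le_topologicalClosure _ (LinearMap.mem_range_self e x)
  let e' : V →ₗ[ℝ] W := e.codRestrict W hmem
  have hdense : DenseRange e' := by
    intro w
    rw [closure_subtype]
    have h1 : ((↑) '' Set.range e' : Set E) = Set.range e := by
      rw [← Set.range_comp]; rfl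
    rw [h1]
    exact w.2
  have hnorm : ∃ C, ∀ x, ‖fl x‖ ≤ C * ‖e' x‖ := by
    refine ⟨1, fun x => ?_⟩
    rw [one_mul]
    refine le_of_eq ?_
    change ‖f x‖ = ‖e x‖
    rw [← Real.sqrt_sq (norm_nonneg (f x)), ← Real.sqrt_sq (norm_nonneg (e x)),
      ← real_inner_self_eq_norm_sq, ← real_inner_self_eq_norm_sq, h]
  -- The map extends by density to the closure of the range of e; composing with the orthogonal
  -- projection defines it on all of E.
  refine ⟨(fl.extendOfNorm e').comp W.orthogonalProjectionOnto, fun x => ?_⟩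
  have h2 : W.orthogonalProjectionOnto (e x) = e' x :=
    Submodule.orthogonalProjectionOnto_mem_subspace_eq_self (e' x)
  rw [ContinuousLinearMap.comp_apply, h2, LinearMap.extendOfNorm_eq hdense hnorm]
  rfl

section
variable {f : ℝ × ℝ → ℝ} {μ : Measure (ℝ × ℝ)}

theorem IsColouredNoise.memLp {Ω : Type*} [MeasurableSpace Ω] {P : Measure Ω}
    {F : TestFn → Ω → ℝ} (hF : IsColouredNoise P f F) (φ : TestFn) : MemLp (F φ) 2 P :=
  (hF.gaussian.hasGaussianLaw_eval φ).memLp_two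

/-- The noise is not assumed linear in the test function: almost sure linearity is forced by the
covariance. -/
theorem IsColouredNoise.exists_clm {Ω : Type*} [MeasurableSpace Ω] {P : Measure Ω}
    {F : TestFn → Ω → ℝ} (hF : IsColouredNoise P f F) (hμ : IsSpectralMeasure f μ)
    (hSC : Integrable (fun ξ => 1 / (1 + euclNorm ξ ^ (2 / 3 : ℝ))) μ) :
    ∃ J : Lp ℂ 2 (specMeasure μ) →L[ℝ] Lp ℝ 2 P,
      ∀ φ, J (spec μ (testAdm hμ hSC φ)) = (hF.memLp φ).toLp (F φ) := by
  refine exists_clm_of_inner_eq ((spec μ).comp (testAdm hμ hSC)) (fun φ => (hF.memLp φ).toLp (F φ))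
    fun φ ψ => ?_
  rw [LinearMap.comp_apply, LinearMap.comp_apply, ← covariance_eq_inner hμ hSC φ ψ,
    ← hF.covariance, L2.inner_def]
  refine integral_congr_ae ?_
  filter_upwards [(hF.memLp φ).coeFn_toLp, (hF.memLp ψ).coeFn_toLp] with ω h1 h2
  rw [h1, h2]
  simp [mul_comm]

/-! ### Density of test functions and of elementary functions -/

/-- The integrands whose spectral image lies in `W`. -/
def specPreimage (μ : Measure (ℝ × ℝ)) (W : Submodule ℝ (Lp ℂ 2 (specMeasure μ))) :
    Submodule ℝ (ℝ × ℝ × ℝ → ℝ) :=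
  (W.comap (spec μ)).map (admissible μ).subtype

theorem mem_specPreimage {W : Submodule ℝ (Lp ℂ 2 (specMeasure μ))} {h : ℝ × ℝ × ℝ → ℝ} :
    h ∈ specPreimage μ W ↔ ∃ hh : h ∈ admissible μ, spec μ ⟨h, hh⟩ ∈ W := by
  constructor
  · rintro ⟨g, hg, rfl⟩
    exact ⟨g.2, hg⟩
  · rintro ⟨hh, hW⟩
    exact ⟨⟨h, hh⟩, hW, rfl⟩

theorem mem_specPreimage_of_tendsto (hμ : IsSpectralMeasure f μ)
    (hSC : Integrable (fun ξ => 1 / (1 + euclNorm ξ ^ (2 / 3 : ℝ))) μ)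
    {W : Submodule ℝ (Lp ℂ 2 (specMeasure μ))} (hW : IsClosed (W : Set (Lp ℂ 2 (specMeasure μ))))
    {S N c : ℝ} {g : ℕ → ℝ × ℝ × ℝ → ℝ} {h : ℝ × ℝ × ℝ → ℝ} (hg : ∀ n, BddSupp S N c (g n))
    (hgW : ∀ n, g n ∈ specPreimage μ W) (hlim : ∀ p, Tendsto (fun n => g n p) atTop (𝓝 (h p))) :
    h ∈ specPreimage μ W := by
  have hh : BddSupp S N c h := by
    refine ⟨measurable_of_tendsto_metrizable (fun n => (hg n).measurable)
      (tendsto_pi_nhds.2 hlim), fun p => ?_, fun p hp => ?_⟩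
    · exact le_of_tendsto (hlim p).abs (Eventually.of_forall fun n => (hg n).bound p)
    · obtain ⟨n, hn⟩ := ((hlim p).eventually_ne hp).exists
      exact (hg n).supp p hn
  choose hgA hgS using fun n => mem_specPreimage.1 (hgW n)
  refine mem_specPreimage.2 ⟨hh.mem_admissible hμ hSC, ?_⟩
  exact hW.mem_of_tendsto (tendsto_spec_of_bddSupp hμ hSC (g := fun n => ⟨g n, hgA n⟩)
    (h := ⟨h, hh.mem_admissible hμ hSC⟩) hg hh hlim) (Eventually.of_forall hgS)

theorem bddSupp_indicator {A : Set (ℝ × ℝ × ℝ)} (hA : MeasurableSet A) {S N : ℝ}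
    (hAS : ∀ p ∈ A, |p.1| ≤ S ∧ ‖p.2‖ ≤ N) (c : ℝ) :
    BddSupp S N |c| (A.indicator fun _ => c) := by
  refine ⟨measurable_const.indicator hA, fun p => ?_, fun p hp =>
    hAS p (Set.mem_of_indicator_ne_zero hp)⟩
  by_cases h : p ∈ A <;> simp [h]

/-- A monotone class theorem for closed spaces of integrands. -/
theorem mem_specPreimage_of_generateFrom (hμ : IsSpectralMeasure f μ)
    (hSC : Integrable (fun ξ => 1 / (1 + euclNorm ξ ^ (2 / 3 : ℝ))) μ)
    {W : Submodule ℝ (Lp ℂ 2 (specMeasure μ))} (hW : IsClosed (W : Set (Lp ℂ 2 (specMeasure μ))))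
    {Q : Set (ℝ × ℝ × ℝ)} (hQ : MeasurableSet Q) {S N : ℝ} (hQS : ∀ p ∈ Q, |p.1| ≤ S ∧ ‖p.2‖ ≤ N)
    {C : Set (Set (ℝ × ℝ × ℝ))} 
    (hC : (Prod.instMeasurableSpace : MeasurableSpace (ℝ × ℝ × ℝ)) = .generateFrom C)
    (hpi : IsPiSystem C) (hQW : (Q.indicator fun _ => (1 : ℝ)) ∈ specPreimage μ W)
    (hCW : ∀ A ∈ C, ((A ∩ Q).indicator fun _ => (1 : ℝ)) ∈ specPreimage μ W)
    {c : ℝ} {h : ℝ × ℝ × ℝ → ℝ} (hh : BddSupp S N c h) (hhQ : ∀ p ∉ Q, h p = 0) :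
    h ∈ specPreimage μ W := by
  have hset : ∀ A, MeasurableSet A →
      ((A ∩ Q).indicator fun _ => (1 : ℝ)) ∈ specPreimage μ W := by
    intro A hA
    induction A, hA using MeasurableSpace.induction_on_inter hC hpi with
    | empty =>
      rw [Set.empty_inter, Set.indicator_empty]
      exact Submodule.zero_mem _
    | basic t ht => exact hCW t ht
    | compl t ht ih =>
      have : ((tᶜ ∩ Q).indicator fun _ => (1 : ℝ))
          = (Q.indicator fun _ => (1 : ℝ)) - ((t ∩ Q).indicator fun _ => (1 : ℝ)) := by
        funext p
        by_cases h1 : p ∈ t <;> by_cases h2 : p ∈ Q <;> simp [h1, h2]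
      rw [this]
      exact Submodule.sub_mem _ hQW ih
    | iUnion t hd ht ih =>
      refine mem_specPreimage_of_tendsto hμ hSC hW (S := S) (N := N) (c := |1|)
        (g := fun n => ((⋃ i ∈ Finset.range n, t i) ∩ Q).indicator fun _ => (1 : ℝ)) (fun n => ?_)
        (fun n => ?_) fun p => ?_
      · exact bddSupp_indicator ((Finset.measurableSet_biUnion _ fun i _ => ht i).inter hQ)
          (fun p hp => hQS p hp.2) 1
      · induction n with
        | zero =>
          simp only [Finset.range_zero, Finset.notMem_empty, Set.iUnion_of_empty, Set.iUnion_empty,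
            Set.empty_inter, Set.indicator_empty]
          exact Submodule.zero_mem _
        | succ n ihn =>
          have : (((⋃ i ∈ Finset.range (n + 1), t i) ∩ Q).indicator fun _ => (1 : ℝ))
              = ((t n ∩ Q).indicator fun _ => (1 : ℝ))
                + (((⋃ i ∈ Finset.range n, t i) ∩ Q).indicator fun _ => (1 : ℝ)) := by
            rw [Finset.range_add_one, Finset.set_biUnion_insert, Set.union_inter_distrib_right]
            rw [Set.indicator_union_of_disjoint]
            · rfl
            · refine Disjoint.mono Set.inter_subset_left Set.inter_subset_left ?_
              simp only [Set.disjoint_iUnion_right]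
              intro i hi
              exact hd (Finset.mem_range.1 hi).ne'
          rw [this]
          exact Submodule.add_mem _ (ih n) ihn
      · refine tendsto_const_nhds.congr' ?_
        by_cases hp : p ∈ (⋃ i, t i) ∩ Q
        · obtain ⟨i, hi⟩ := Set.mem_iUnion.1 hp.1
          filter_upwards [eventually_gt_atTop i] with n hn
          rw [Set.indicator_of_mem hp, Set.indicator_of_mem]
          exact ⟨Set.mem_biUnion (Finset.mem_range.2 hn) hi, hp.2⟩
        · refine Eventually.of_forall fun n => ?_
          rw [Set.indicator_of_notMem hp]
          refine (Set.indicator_of_notMem ?_ _).symm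
          rintro ⟨h1, h2⟩
          obtain ⟨i, -, hi⟩ := Set.mem_iUnion₂.1 h1
          exact hp ⟨Set.mem_iUnion.2 ⟨i, hi⟩, h2⟩
  -- These simple functions satisfy |s n| ≤ 2|h|: they vanish wherever h does and are bounded by c +
  -- c.
  let s : ℕ → SimpleFunc (ℝ × ℝ × ℝ) ℝ := fun n =>
    SimpleFunc.approxOn h hh.measurable Set.univ 0 (Set.mem_univ _) n
  have hs0 : ∀ n p, h p = 0 → s n p = 0 := by
    intro n p hp
    have := SimpleFunc.norm_approxOn_zero_le hh.measurable (Set.mem_univ (0 : ℝ)) p n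
    rw [hp, norm_zero, add_zero] at this
    exact norm_le_zero_iff.1 this
  refine mem_specPreimage_of_tendsto hμ hSC hW (S := S) (N := N) (c := c + c) (g := fun n => s n)
    (fun n => ⟨(s n).measurable, fun p => ?_, fun p hp => ?_⟩) (fun n => ?_) fun p => ?_
  · exact (SimpleFunc.norm_approxOn_zero_le hh.measurable (Set.mem_univ (0 : ℝ)) p n).trans
      (add_le_add (hh.bound p) (hh.bound p))
  · exact hh.supp p fun h0 => hp (hs0 n p h0)
  · have : (s n : ℝ × ℝ × ℝ → ℝ)
        = ∑ a ∈ (s n).range, a • ((s n ⁻¹' {a} ∩ Q).indicator fun _ => (1 : ℝ)) := by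
      funext p
      rw [Finset.sum_apply]
      by_cases hp : p ∈ Q
      · rw [Finset.sum_eq_single (s n p)]
        · simp [hp]
        · intro b _ hb
          simp [Ne.symm hb]
        · intro hb
          exact absurd (SimpleFunc.mem_range_self _ p) hb
      · simp [hp, hs0 n p (hhQ p hp)]
    rw [this]
    exact Submodule.sum_mem _ fun a _ => Submodule.smul_mem _ _
      (hset _ ((s n).measurableSet_preimage _))
  · exact SimpleFunc.tendsto_approxOn _ _ (by simp)

/-- An open set U is the support of a smooth nonnegative b. The cut-offs of n b by a smooth step are
test functions that vanish off U and eventually equal 1 at each point of U, so bounded convergence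
applies. -/
theorem indicator_mem_specPreimage_of_isOpen (hμ : IsSpectralMeasure f μ)
    (hSC : Integrable (fun ξ => 1 / (1 + euclNorm ξ ^ (2 / 3 : ℝ))) μ) {S N : ℝ}
    {U : Set (ℝ × ℝ × ℝ)} (hU : IsOpen U) (hUS : ∀ p ∈ U, |p.1| ≤ S ∧ ‖p.2‖ ≤ N) :
    (U.indicator fun _ => (1 : ℝ)) ∈ specPreimage μ
      (LinearMap.range ((spec μ).comp (testAdm hμ hSC))).topologicalClosure := by
  obtain ⟨b, hbU, hbs, hbr⟩ := hU.exists_contDiff_support_eq (n := (⊤ : ℕ∞))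
  have hb0 : ∀ p, 0 ≤ b p := fun p => (hbr ⟨p, rfl⟩).1
  let φ : ℕ → ℝ × ℝ × ℝ → ℝ := fun n p => Real.smoothTransition (n * b p)
  have hφs : ∀ n p, φ n p ≠ 0 → p ∈ U := by
    intro n p hp
    rw [← hbU]
    intro h0
    exact hp (by simp [φ, h0])
  have hcomp : ∀ n, HasCompactSupport (φ n) := fun n => by
    refine HasCompactSupport.intro (K := Set.Icc (-S) S ×ˢ Metric.closedBall (0 : ℝ × ℝ) N)
      (isCompact_Icc.prod (isCompact_closedBall _ _)) fun p hp => ?_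
    by_contra h0
    have := hUS p (hφs n p h0)
    exact hp ⟨abs_le.1 this.1, mem_closedBall_zero_iff.2 this.2⟩
  have hsm : ∀ n, ContDiff ℝ ((⊤ : ℕ∞) : WithTop ℕ∞) (φ n) := fun n =>
    Real.smoothTransition.contDiff.comp (contDiff_const.mul hbs)
  let T : ℕ → TestFn := fun n => ⟨φ n, hsm n, hcomp n, fun _ _ => trivial⟩
  refine mem_specPreimage_of_tendsto hμ hSC (Submodule.isClosed_topologicalClosure _)
    (S := S) (N := N) (c := 1) (g := φ) (fun n => ⟨(hsm n).continuous.measurable, fun p => ?_,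
      fun p hp => hUS p (hφs n p hp)⟩) (fun n => ?_) fun p => ?_
  · rw [abs_of_nonneg (Real.smoothTransition.nonneg _)]
    exact Real.smoothTransition.le_one _
  · exact mem_specPreimage.2 ⟨(testAdm hμ hSC (T n)).2,
      Submodule.le_topologicalClosure _ ⟨T n, rfl⟩⟩
  · by_cases hp : p ∈ U
    · rw [Set.indicator_of_mem hp]
      have hpos : 0 < b p := lt_of_le_of_ne (hb0 p) (by rw [← hbU] at hp; exact Ne.symm hp)
      refine tendsto_const_nhds.congr' ?_
      have ht : Tendsto (fun n : ℕ => (n : ℝ) * b p) atTop atTop :=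
        tendsto_natCast_atTop_atTop.atTop_mul_const hpos
      filter_upwards [ht.eventually_ge_atTop 1] with n hn
      exact (Real.smoothTransition.one_of_one_le hn).symm
    · rw [Set.indicator_of_notMem hp]
      refine tendsto_const_nhds.congr fun n => ?_
      by_contra h0
      exact hp (hφs n p (Ne.symm h0))

/-- Test functions are dense in the bounded integrands with bounded support. -/
theorem BddSupp.mem_specPreimage_testFn (hμ : IsSpectralMeasure f μ)
    (hSC : Integrable (fun ξ => 1 / (1 + euclNorm ξ ^ (2 / 3 : ℝ))) μ) {S N c : ℝ}
    {h : ℝ × ℝ × ℝ → ℝ} (hh : BddSupp S N c h) :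
    h ∈ specPreimage μ
      (LinearMap.range ((spec μ).comp (testAdm hμ hSC))).topologicalClosure := by
  -- The box is enlarged by 1 so that an open set contains the support; its intersections with open
  -- sets then stay open and bounded.
  let Q : Set (ℝ × ℝ × ℝ) := Set.Ioo (-(S + 1)) (S + 1) ×ˢ Metric.ball (0 : ℝ × ℝ) (N + 1)
  have hQo : IsOpen Q := isOpen_Ioo.prod Metric.isOpen_ball
  have hQS : ∀ p ∈ Q, |p.1| ≤ S + 1 ∧ ‖p.2‖ ≤ N + 1 := fun p hp =>
    ⟨(abs_lt.2 hp.1).le, (mem_ball_zero_iff.1 hp.2).le⟩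
  refine mem_specPreimage_of_generateFrom hμ hSC (Submodule.isClosed_topologicalClosure _)
    hQo.measurableSet hQS (C := {U | IsOpen U}) BorelSpace.measurable_eq isPiSystem_isOpen
    (indicator_mem_specPreimage_of_isOpen hμ hSC hQo hQS)
    (fun U hU => indicator_mem_specPreimage_of_isOpen hμ hSC (IsOpen.inter hU hQo)
      fun p hp => hQS p hp.2)
    (hh.mono (by linarith) (by linarith) le_rfl) fun p hp => ?_
  by_contra h0
  have := hh.supp p h0
  exact hp ⟨abs_lt.1 (by linarith), mem_ball_zero_iff.2 (by linarith)⟩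

/-! ### Elementary functions -/

theorem elemFun_append (L₁ L₂ : List Box) : elemFun (L₁ ++ L₂) = elemFun L₁ + elemFun L₂ := by
  funext p
  simp [elemFun]

/-- Multiplication of a weighted box by a scalar. -/
def Box.scale (a : ℝ) (e : Box) : Box := { e with c := a * e.c }

theorem elemFun_scale (a : ℝ) (L : List Box) : elemFun (L.map (Box.scale a)) = a • elemFun L := by
  funext p
  simp only [elemFun, List.map_map, Pi.smul_apply, smul_eq_mul, ← List.sum_map_mul_left]
  congr 2
  funext e
  simp only [Function.comp, Box.scale]
  by_cases hp : p ∈ Set.Ioc e.a e.b ×ˢ e.B <;> simp only [Set.indicator_of_mem, Set.indicator_of_notMem, hp, not_false_eq_true, mul_zero]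

theorem elemFun_nil : elemFun [] = 0 := by
  funext p
  simp [elemFun]

theorem elemFun_cons (e : Box) (L : List Box) :
    elemFun (e :: L) = ((Set.Ioc e.a e.b ×ˢ e.B).indicator fun _ => e.c) + elemFun L := by
  funext p
  simp [elemFun]

theorem Box.exists_bddSupp (e : Box) :
    ∃ S N c : ℝ, BddSupp S N c ((Set.Ioc e.a e.b ×ˢ e.B).indicator fun _ => e.c) := by
  obtain ⟨N, hN⟩ := e.bounded_B.subset_closedBall (0 : ℝ × ℝ)
  refine ⟨e.b, N, |e.c|, bddSupp_indicator (measurableSet_Ioc.prod e.measurable_B)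
    (fun p hp => ⟨?_, mem_closedBall_zero_iff.1 (hN hp.2)⟩) _⟩
  rw [abs_of_nonneg (e.a_nonneg.trans hp.1.1.le)]
  exact hp.1.2

theorem elemFun_mem_admissible (hμ : IsSpectralMeasure f μ)
    (hSC : Integrable (fun ξ => 1 / (1 + euclNorm ξ ^ (2 / 3 : ℝ))) μ) (L : List Box) :
    elemFun L ∈ admissible μ := by
  induction L with
  | nil => rw [elemFun_nil]; exact Submodule.zero_mem _
  | cons e L ih =>
    rw [elemFun_cons]
    obtain ⟨S, N, c, h⟩ := e.exists_bddSupp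
    exact Submodule.add_mem _ (h.mem_admissible hμ hSC) ih

/-- The elementary functions, as a space of integrands. -/
def elemSubmodule (hμ : IsSpectralMeasure f μ)
    (hSC : Integrable (fun ξ => 1 / (1 + euclNorm ξ ^ (2 / 3 : ℝ))) μ) :
    Submodule ℝ (admissible μ) where
  carrier := Set.range fun L => ⟨elemFun L, elemFun_mem_admissible hμ hSC L⟩
  zero_mem' := ⟨[], Subtype.ext elemFun_nil⟩
  add_mem' := by
    rintro _ _ ⟨L₁, rfl⟩ ⟨L₂, rfl⟩
    exact ⟨L₁ ++ L₂, Subtype.ext (elemFun_append L₁ L₂)⟩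
  smul_mem' := by
    rintro a _ ⟨L, rfl⟩
    exact ⟨L.map (Box.scale a), Subtype.ext (elemFun_scale a L)⟩

/-- Elementary functions are dense in the bounded integrands with bounded support. -/
theorem BddSupp.mem_specPreimage_elem (hμ : IsSpectralMeasure f μ)
    (hSC : Integrable (fun ξ => 1 / (1 + euclNorm ξ ^ (2 / 3 : ℝ))) μ) {S N c : ℝ}
    {h : ℝ × ℝ × ℝ → ℝ} (hh : BddSupp S N c h) :
    h ∈ specPreimage μ ((elemSubmodule hμ hSC).map (spec μ)).topologicalClosure := by
  have hbox : ∀ (b : ℝ) (B : Set (ℝ × ℝ)), 0 ≤ b → MeasurableSet B → Bornology.IsBounded B →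
      ((Set.Ioc 0 b ×ˢ B).indicator fun _ => (1 : ℝ)) ∈
        specPreimage μ ((elemSubmodule hμ hSC).map (spec μ)).topologicalClosure := by
    intro b B hb hB hBb
    let e : Box := ⟨1, 0, b, B, le_rfl, hb, hB, hBb⟩
    have he : elemFun [e] = (Set.Ioc 0 b ×ˢ B).indicator fun _ => (1 : ℝ) := by
      rw [elemFun_cons, elemFun_nil, add_zero]
    rw [← he]
    exact mem_specPreimage.2 ⟨elemFun_mem_admissible hμ hSC _,
      Submodule.le_topologicalClosure _ (Submodule.mem_map_of_mem ⟨[e], rfl⟩)⟩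
  have hpos : ∀ p : ℝ × ℝ × ℝ, p ∈ Set.Ioi (0 : ℝ) ×ˢ (Set.univ : Set (ℝ × ℝ)) ↔ 0 < p.1 := by
    simp
  -- Elementary functions vanish for s ≤ 0, so h is first truncated to s > 0, which does not change
  -- its spectral image.
  let h' : ℝ × ℝ × ℝ → ℝ := (Set.Ioi (0 : ℝ) ×ˢ (Set.univ : Set (ℝ × ℝ))).indicator h
  have hh' : BddSupp (max S 0) N c h' := by
    refine ⟨hh.measurable.indicator (measurableSet_Ioi.prod MeasurableSet.univ), fun p => ?_,
      fun p hp => ?_⟩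
    · refine le_trans ?_ (hh.bound p)
      exact norm_indicator_le_norm_self h p
    · have := hh.supp p (fun h0 => hp (by simp [h', Set.indicator_apply, h0]))
      exact ⟨this.1.trans (le_max_left _ _), this.2⟩
  let Q : Set (ℝ × ℝ × ℝ) := Set.Ioc 0 (max S 0) ×ˢ Metric.closedBall (0 : ℝ × ℝ) N
  have hQS : ∀ p ∈ Q, |p.1| ≤ max S 0 ∧ ‖p.2‖ ≤ N := fun p hp =>
    ⟨by rw [abs_of_pos hp.1.1]; exact hp.1.2, mem_closedBall_zero_iff.1 hp.2⟩
  have hball : MeasurableSet (Metric.closedBall (0 : ℝ × ℝ) N) :=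
    Metric.isClosed_closedBall.measurableSet
  have key : h' ∈ specPreimage μ ((elemSubmodule hμ hSC).map (spec μ)).topologicalClosure := by
    refine mem_specPreimage_of_generateFrom hμ hSC (Submodule.isClosed_topologicalClosure _)
      (measurableSet_Ioc.prod hball) hQS
      (C := Set.image2 (· ×ˢ ·) (Set.range Set.Iic) {B : Set (ℝ × ℝ) | MeasurableSet B})
      ?_ ?_ ?_ ?_ hh' fun p hp => ?_
    · have h1 : IsCountablySpanning (Set.range (Set.Iic : ℝ → Set ℝ)) := by
        refine ⟨fun n : ℕ => Set.Iic (n : ℝ), fun n => ⟨n, rfl⟩, ?_⟩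
        refine Set.eq_univ_of_forall fun x => Set.mem_iUnion.2 ?_
        exact exists_nat_ge x
      rw [← generateFrom_prod_eq h1 isCountablySpanning_measurableSet]
      rw [MeasurableSpace.generateFrom_measurableSet, ← borel_eq_generateFrom_Iic,
        ← BorelSpace.measurable_eq]
    · exact isPiSystem_Iic.prod MeasurableSpace.isPiSystem_measurableSet
    · exact hbox _ _ (le_max_right _ _) hball Metric.isBounded_closedBall
    · rintro _ ⟨_, ⟨a, rfl⟩, B, hB, rfl⟩
      -- The outer maximum with 0 covers a < 0: the time interval degenerates to the empty ]0, 0],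
      -- still an allowed box.
      have : (Set.Iic a ×ˢ B) ∩ Q = Set.Ioc 0 (max 0 (min a (max S 0)))
          ×ˢ (B ∩ Metric.closedBall (0 : ℝ × ℝ) N) := by
        ext p
        simp only [Q, Set.mem_inter_iff, Set.mem_prod, Set.mem_Iic, Set.mem_Ioc]
        constructor
        · rintro ⟨⟨h1, h2⟩, ⟨h3, h4⟩, h5⟩
          exact ⟨⟨h3, le_max_of_le_right (le_min h1 h4)⟩, h2, h5⟩
        · rintro ⟨⟨h3, h4⟩, h2, h5⟩
          rcases le_max_iff.1 h4 with h | h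
          · exact absurd h3 (not_lt.2 h)
          · exact ⟨⟨(le_min_iff.1 h).1, h2⟩, ⟨h3, (le_min_iff.1 h).2⟩, h5⟩
      rw [this]
      exact hbox _ _ (le_max_left _ _) (MeasurableSet.inter hB hball)
        (Metric.isBounded_closedBall.subset Set.inter_subset_right)
    · by_contra h0
      have h1 := hh'.supp p h0
      have h2 : 0 < p.1 := (hpos p).1 (Set.mem_of_indicator_ne_zero h0)
      exact hp ⟨⟨h2, (le_abs_self _).trans h1.1⟩, mem_closedBall_zero_iff.2 h1.2⟩
  obtain ⟨hA', hW'⟩ := mem_specPreimage.1 key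
  have hA := hh.mem_admissible hμ hSC
  refine mem_specPreimage.2 ⟨hA, ?_⟩
  rwa [spec_congr (g := ⟨h, hA⟩) (h := ⟨h', hA'⟩) fun s hs y => ?_]
  exact (Set.indicator_of_mem ((hpos _).2 hs) h).symm

end

/-! ### Regularization of integrands in the space variable -/

theorem ft_sub {g h : ℝ × ℝ × ℝ → ℝ} (hg : ∀ s, Integrable fun y => g (s, y))
    (hh : ∀ s, Integrable fun y => h (s, y)) : ft (g - h) = ft g - ft h := by
  have := ft_add (g := g - h) (h := h) (fun s => (hg s).sub (hh s)) hh
  rw [sub_add_cancel] at this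
  rw [this, add_sub_cancel_right]

theorem exists_abs_mollify_le (n : ℕ) : ∃ c : ℝ, 0 ≤ c ∧ ∀ a : ℝ × ℝ → ℝ, Integrable a → ∀ x,
    |mollify n a x| ≤ c * ∫ y, ‖a y‖ := by
  obtain ⟨c, hc⟩ := (hasCompactSupport_mollifier n).exists_bound_of_continuous
    (contDiff_mollifier n).continuous
  refine ⟨c, (norm_nonneg _).trans (hc 0), fun a ha x => ?_⟩
  rw [mollify_apply]
  refine (norm_integral_le_integral_norm (μ := volume)
    (fun t => mollifier n t * a (x - t))).trans ?_
  have h1 : ∫ t, c * ‖a (x - t)‖ = c * ∫ y, ‖a y‖ := by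
    rw [integral_const_mul, integral_sub_left_eq_self (fun y => ‖a y‖) volume x]
  rw [← h1]
  refine integral_mono_of_nonneg (Eventually.of_forall fun t => norm_nonneg _)
    ((ha.comp_sub_left x).norm.const_mul c) (Eventually.of_forall fun t => ?_)
  simp only [norm_mul]
  exact mul_le_mul_of_nonneg_right (hc t) (norm_nonneg _)

theorem measurable_mollify_slice (n : ℕ) {g : ℝ × ℝ × ℝ → ℝ} (hg : Measurable g) :
    Measurable fun p : ℝ × ℝ × ℝ => mollify n (fun y => g (p.1, y)) p.2 := by
  simp_rw [mollify_apply]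
  have : Measurable fun q : (ℝ × ℝ × ℝ) × (ℝ × ℝ) => mollifier n q.2 * g (q.1.1, q.1.2 - q.2) :=
    ((contDiff_mollifier n).continuous.measurable.comp measurable_snd).mul
      (hg.comp (by fun_prop))
  exact (this.stronglyMeasurable.integral_prod_right').measurable

section
variable {f : ℝ × ℝ → ℝ} {μ : Measure (ℝ × ℝ)}

/-- Elementary functions approximate every integrand of finite energy that has bounded support and
time slices bounded in `L¹`. -/
theorem mem_specPreimage_elem_of_slices (hμ : IsSpectralMeasure f μ)
    (hSC : Integrable (fun ξ => 1 / (1 + euclNorm ξ ^ (2 / 3 : ℝ))) μ) {g : ℝ × ℝ × ℝ → ℝ}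
    (hg : g ∈ admissible μ) {S N K : ℝ} (hsupp : ∀ p, g p ≠ 0 → |p.1| ≤ S ∧ ‖p.2‖ ≤ N)
    (hK : ∀ s, ∫ y, ‖g (s, y)‖ ≤ K) :
    g ∈ specPreimage μ ((elemSubmodule hμ hSC).map (spec μ)).topologicalClosure := by
  -- Mollification acts in space only. It makes the integrand bounded because the L¹ norms of the
  -- slices are bounded by K uniformly in s.
  let G : ℕ → ℝ × ℝ × ℝ → ℝ := fun n p => mollify n (fun y => g (p.1, y)) p.2
  have hG : ∀ n, ∃ c, BddSupp S (N + 1) c (G n) := by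
    intro n
    obtain ⟨c, hc0, hc⟩ := exists_abs_mollify_le n
    refine ⟨c * K, measurable_mollify_slice n hg.1, fun p => (hc _ (hg.2.1 p.1) p.2).trans
      (mul_le_mul_of_nonneg_left (hK p.1) hc0), fun p hp => ⟨?_, ?_⟩⟩
    · by_contra hS
      refine hp ?_
      have h0 : ∀ y, g (p.1, y) = 0 := fun y => by
        by_contra h
        exact hS (hsupp (p.1, y) h).1
      simp only [G, mollify_apply, h0, mul_zero, integral_zero]
    · by_contra hN
      exact hp (mollify_eq_zero (fun y hy => (hsupp (p.1, y) hy).2) (not_le.1 hN))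
  choose c hc using hG
  choose hGA hGW using fun n => mem_specPreimage.1 ((hc n).mem_specPreimage_elem hμ hSC)
  refine mem_specPreimage.2 ⟨hg, ?_⟩
  refine (Submodule.isClosed_topologicalClosure _).mem_of_tendsto (b := atTop) (f := fun n =>
    spec μ ⟨G n, hGA n⟩) ?_ (Eventually.of_forall hGW)
  rw [tendsto_iff_edist_tendsto_0]
  simp_rw [edist_eq_enorm_sub, ← map_sub]
  refine tendsto_zero_of_tendsto_sq_zero ?_
  simp_rw [enorm_spec_sq]
  -- In Fourier variables the error is g multiplied by a factor of modulus at most 2 that tends to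
  -- 0, so dominated convergence needs only the finite energy of g.
  have hft : ∀ n q, ft (G n - g) q = (fourierR (mollifier n) q.2 - 1) * ft g q := by
    intro n q
    rw [ft_sub (hGA n).2.1 hg.2.1, Pi.sub_apply, sub_mul, one_mul]
    congr 1
    exact fourierR_mollify n (hg.2.1 q.1) q.2
  have hlt : ∫⁻ q, (2 * ‖ft g q‖ₑ) ^ 2 ∂(specMeasure μ) ≠ ∞ := by
    simp_rw [mul_pow]
    rw [lintegral_const_mul' _ _ (by finiteness), ← eLpNorm_two_sq]
    have := hg.2.2.2
    finiteness
  have h := tendsto_lintegral_of_dominated_convergence (μ := specMeasure μ)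
    (F := fun n q => ‖ft (G n - g) q‖ₑ ^ 2) (f := fun _ => 0) (fun q => (2 * ‖ft g q‖ₑ) ^ 2)
    (fun n => (measurable_ft ((hGA n).1.sub hg.1)).enorm.pow_const 2)
    (fun n => Eventually.of_forall fun q => ?_) hlt (Eventually.of_forall fun q => ?_)
  · simpa using h
  · simp only [hft, enorm_mul]
    gcongr
    refine (enorm_sub_le).trans ?_
    rw [← one_add_one_eq_two]
    refine add_le_add ?_ (by simp)
    rw [← ofReal_norm, ← ENNReal.ofReal_one]
    exact ENNReal.ofReal_le_ofReal (norm_fourierR_mollifier_le n q.2)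
  · simp only [hft]
    have h1 := (((tendsto_fourierR_mollifier q.2).sub_const 1).mul_const (ft g q)).enorm
    rw [sub_self, zero_mul, enorm_zero] at h1
    simpa using ENNReal.Tendsto.pow (n := 2) h1

end

/-! ### The kernel as an integrand -/

/-- The kernel at time `r` as a function of its source point. -/
def gamSlice (r : ℝ) (x y : ℝ × ℝ) : ℝ := Gam r x.1 y.1 (x.2 - y.2)

theorem measurable_gamSlice (r : ℝ) (x : ℝ × ℝ) : Measurable (gamSlice r x) :=
  measurable_Gam.comp (f := fun y : ℝ × ℝ => (r, x.1, y.1, x.2 - y.2)) (by fun_prop)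

theorem lintegral_gamSlice (r : ℝ) (x : ℝ × ℝ) :
    ∫⁻ y, ‖gamSlice r x y‖ₑ = ENNReal.ofReal r := by
  have h1 := lintegral_prod (μ := volume) (ν := volume) (fun y : ℝ × ℝ => ‖gamSlice r x y‖ₑ)
    (measurable_gamSlice r x).enorm.aemeasurable
  refine h1.trans ?_
  have h2 : ∀ y₁, ∫⁻ y₂, ‖gamSlice r x (y₁, y₂)‖ₑ
      = (Set.Ioo x.1 (x.1 + 2 * r)).indicator (fun _ => ENNReal.ofReal (1 / 2)) y₁ := fun y₁ => by
    rw [← lintegral_Gam]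
    exact lintegral_sub_left_eq_self (fun z => ‖Gam r x.1 y₁ z‖ₑ) x.2
  simp_rw [h2]
  rw [lintegral_indicator measurableSet_Ioo, setLIntegral_const, Real.volume_Ioo,
    ← ENNReal.ofReal_mul (by norm_num)]
  congr 1
  ring

theorem integrable_gamSlice (r : ℝ) (x : ℝ × ℝ) : Integrable (gamSlice r x) :=
  ⟨(measurable_gamSlice r x).aestronglyMeasurable, by
    rw [hasFiniteIntegral_iff_enorm, lintegral_gamSlice]
    exact ENNReal.ofReal_lt_top⟩

theorem integral_norm_gamSlice_le (r : ℝ) (x : ℝ × ℝ) : ∫ y, ‖gamSlice r x y‖ ≤ |r| := by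
  rw [integral_norm_eq_lintegral_enorm (measurable_gamSlice r x).aestronglyMeasurable,
    lintegral_gamSlice]
  refine ENNReal.toReal_le_of_le_ofReal (abs_nonneg r) (ENNReal.ofReal_le_ofReal (le_abs_self r))

theorem gamSlice_of_nonpos {r : ℝ} (hr : r ≤ 0) (x y : ℝ × ℝ) : gamSlice r x y = 0 :=
  Gam_eq_zero_of_not (by rintro ⟨h1, h2⟩; linarith) _

/-- The arcsine substitution in the second variable produces the Bessel integral at ξ₂ rad together
with the phase exp(-i ξ₂ x₂); the remaining integral in y₁ is `oscInt`. -/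
theorem fourierR_gamSlice {r : ℝ} (hr : 0 ≤ r) (x ξ : ℝ × ℝ) :
    fourierR (gamSlice r x) ξ = Complex.exp (-Complex.I * ((ξ.2 * x.2 : ℝ) : ℂ)) *
      ((2 * Real.pi)⁻¹ : ℝ) * oscInt r x.1 ξ := by
  have h1 := integral_prod (μ := (volume : Measure ℝ)) (ν := (volume : Measure ℝ))
    (fun y : ℝ × ℝ => chr ξ y * (gamSlice r x y : ℂ))
    (integrable_chr_mul (integrable_gamSlice r x) ξ)
  have h2 : ∀ y₁, ∫ y₂, chr ξ (y₁, y₂) * (gamSlice r x (y₁, y₂) : ℂ)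
      = (Set.Ioo x.1 (x.1 + 2 * r)).indicator (fun y =>
        (Complex.exp (-Complex.I * ((ξ.2 * x.2 : ℝ) : ℂ)) * ((2 * Real.pi)⁻¹ : ℝ)) *
          (Complex.exp (-Complex.I * ((ξ.1 * y : ℝ) : ℂ)) *
            besselInt (ξ.2 * rad r x.1 y))) y₁ := by
    intro y₁
    by_cases hy : y₁ ∈ Set.Ioo x.1 (x.1 + 2 * r)
    · rw [Set.indicator_of_mem hy]
      have h3 : ∫ y₂, chr ξ (y₁, y₂) * (gamSlice r x (y₁, y₂) : ℂ)
          = ∫ z, Gam r x.1 y₁ z • chr ξ (y₁, x.2 - z) := by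
        rw [← integral_sub_left_eq_self (fun z => Gam r x.1 y₁ z • chr ξ (y₁, x.2 - z)) volume x.2]
        refine integral_congr_ae (Eventually.of_forall fun y₂ => ?_)
        simp only [gamSlice, sub_sub_cancel, Complex.real_smul]
        rw [mul_comm]
      rw [h3, integral_Gam_smul hy.1 hy.2]
      have h4 : ∀ θ : ℝ, chr ξ (y₁, x.2 - rad r x.1 y₁ * Real.cos θ)
          = (Complex.exp (-Complex.I * ((ξ.2 * x.2 : ℝ) : ℂ)) *
            Complex.exp (-Complex.I * ((ξ.1 * y₁ : ℝ) : ℂ))) *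
            Complex.exp (Complex.I * ((ξ.2 * rad r x.1 y₁ * Real.cos θ : ℝ) : ℂ)) := by
        intro θ
        rw [← Complex.exp_add, ← Complex.exp_add, chr]
        congr 1
        push_cast
        ring
      simp_rw [h4]
      rw [integral_const_mul, besselInt, Complex.real_smul]
      ring
    · rw [Set.indicator_of_notMem hy]
      have : ∀ y₂, gamSlice r x (y₁, y₂) = 0 := fun y₂ => Gam_eq_zero_of_not hy _
      simp [this]
  rw [fourierR_eq]
  refine h1.trans ?_
  simp_rw [h2]
  rw [integral_indicator measurableSet_Ioo, integral_const_mul, oscInt,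
    intervalIntegral.integral_of_le (by linarith), integral_Ioc_eq_integral_Ioo]

theorem norm_fourierR_gamSlice_le {r : ℝ} (hr : 0 ≤ r) (x ξ : ℝ × ℝ) :
    ‖fourierR (gamSlice r x) ξ‖ ≤ ‖oscInt r x.1 ξ‖ := by
  have hpi := Real.pi_gt_three
  rw [fourierR_gamSlice hr, norm_mul, norm_mul, norm_cexp_neg_I_mul, one_mul, Complex.norm_real,
    Real.norm_of_nonneg (by positivity)]
  refine mul_le_of_le_one_left (norm_nonneg _) (inv_le_one_of_one_le₀ (by linarith))

/-- On the support |x₁| and |y₁| are at most Y = |x₁| + 2T, hence 3(x₂ - y₂)² < 4 Y³ T. The term 1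
in the bound avoids a square root: a² ≤ m implies |a| ≤ 1 + m. -/
theorem gamSlice_supp {r T : ℝ} (hrT : r ≤ T) {x y : ℝ × ℝ} (h : gamSlice r x y ≠ 0) :
    ‖y‖ ≤ (|x.1| + 2 * T) + |x.2| + 1 + 4 * (|x.1| + 2 * T) ^ 3 * T := by
  have hr : 0 < r := not_le.1 fun hr => h (gamSlice_of_nonpos hr x y)
  have hy : x.1 < y.1 ∧ y.1 < x.1 + 2 * r := by
    by_contra h0
    exact h (Gam_eq_zero_of_not h0 _)
  have hq : 0 < (y.1 ^ 3 - x.1 ^ 3) * (2 * r + x.1 - y.1) - 3 * (x.2 - y.2) ^ 2 := by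
    by_contra h0
    exact h (if_neg fun h1 => h0 h1.2.2)
  set Y := |x.1| + 2 * T with hY
  have hx1 := abs_le.1 (le_refl |x.1|)
  have hT : 0 ≤ T := by linarith
  have hY0 : 0 ≤ Y := by positivity
  have hy1 : |y.1| ≤ Y := abs_le.2 ⟨by linarith, by linarith⟩
  have hcy : y.1 ^ 3 ≤ Y ^ 3 := by
    refine (le_abs_self _).trans ?_
    rw [abs_pow]
    exact pow_le_pow_left₀ (abs_nonneg _) hy1 3
  have hcx : -x.1 ^ 3 ≤ Y ^ 3 := by
    refine (neg_le_abs _).trans ?_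
    rw [abs_pow]
    exact pow_le_pow_left₀ (abs_nonneg _) (by linarith) 3
  have hY3 : 0 ≤ Y ^ 3 := by positivity
  have hprod : (y.1 ^ 3 - x.1 ^ 3) * (2 * r + x.1 - y.1) ≤ (2 * Y ^ 3) * (2 * T) :=
    mul_le_mul (by linarith) (by linarith) (by linarith) (by positivity)
  have hz : |x.2 - y.2| ≤ 1 + 4 * Y ^ 3 * T := by
    have : 0 ≤ 4 * Y ^ 3 * T := by positivity
    refine abs_le_of_sq_le_sq ?_ (by linarith)
    nlinarith [sq_nonneg (x.2 - y.2)]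
  have hy2 : |y.2| ≤ |x.2| + |x.2 - y.2| := by
    have := abs_sub x.2 (x.2 - y.2)
    rwa [sub_sub_cancel] at this
  have hpos : 0 ≤ 4 * Y ^ 3 * T := by positivity
  refine max_le ?_ ?_
  · rw [Real.norm_eq_abs]
    linarith [abs_nonneg x.2]
  · rw [Real.norm_eq_abs]
    linarith

theorem solIntegrand_Gam (t : ℝ) (x : ℝ × ℝ) (s : ℝ) (y : ℝ × ℝ) :
    solIntegrand Gam t x (s, y) = if s ∈ Set.Icc 0 t then gamSlice (t - s) x y else 0 := by
  simp [solIntegrand, Set.indicator_apply, gamSlice]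

theorem measurable_solIntegrand : Measurable fun q : (ℝ × (ℝ × ℝ)) × (ℝ × ℝ × ℝ) =>
    solIntegrand Gam q.1.1 q.1.2 q.2 := by
  have h : ∀ q : (ℝ × (ℝ × ℝ)) × (ℝ × ℝ × ℝ), solIntegrand Gam q.1.1 q.1.2 q.2
      = {q : (ℝ × (ℝ × ℝ)) × (ℝ × ℝ × ℝ) | 0 ≤ q.2.1 ∧ q.2.1 ≤ q.1.1}.indicator
        (fun q => Gam (q.1.1 - q.2.1) q.1.2.1 q.2.2.1 (q.1.2.2 - q.2.2.2)) q := by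
    intro q
    simp [solIntegrand, Set.indicator_apply]
  simp_rw [h]
  refine Measurable.indicator (measurable_Gam.comp (f := fun q : (ℝ × (ℝ × ℝ)) × (ℝ × ℝ × ℝ) =>
    (q.1.1 - q.2.1, q.1.2.1, q.2.2.1, q.1.2.2 - q.2.2.2)) (by fun_prop)) ?_
  have h1 : MeasurableSet {q : (ℝ × (ℝ × ℝ)) × (ℝ × ℝ × ℝ) | 0 ≤ q.2.1} :=
    measurableSet_le (by fun_prop) (by fun_prop)
  have h2 : MeasurableSet {q : (ℝ × (ℝ × ℝ)) × (ℝ × ℝ × ℝ) | q.2.1 ≤ q.1.1} :=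
    measurableSet_le (by fun_prop) (by fun_prop)
  exact h1.inter h2

theorem solIntegrand_supp (t : ℝ) (x : ℝ × ℝ) {p : ℝ × ℝ × ℝ} (hp : solIntegrand Gam t x p ≠ 0) :
    |p.1| ≤ t ∧ ‖p.2‖ ≤ (|x.1| + 2 * t) + |x.2| + 1 + 4 * (|x.1| + 2 * t) ^ 3 * t := by
  obtain ⟨s, y⟩ := p
  rw [solIntegrand_Gam] at hp
  split_ifs at hp with hs
  · exact ⟨by rw [abs_of_nonneg hs.1]; exact hs.2, gamSlice_supp (by linarith [hs.1]) hp⟩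
  · exact absurd rfl hp

theorem solIntegrand_slice (t : ℝ) (x : ℝ × ℝ) (s : ℝ) :
    (fun y => solIntegrand Gam t x (s, y)) = if s ∈ Set.Icc 0 t then gamSlice (t - s) x else 0 := by
  funext y
  rw [solIntegrand_Gam]
  split_ifs <;> rfl

theorem integrable_solIntegrand (t : ℝ) (x : ℝ × ℝ) (s : ℝ) :
    Integrable fun y => solIntegrand Gam t x (s, y) := by
  rw [solIntegrand_slice]
  split_ifs
  · exact integrable_gamSlice _ _
  · exact integrable_zero _ _ _

theorem integral_norm_solIntegrand_le (t : ℝ) (x : ℝ × ℝ) (s : ℝ) :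
    ∫ y, ‖solIntegrand Gam t x (s, y)‖ ≤ |t| := by
  have h := solIntegrand_slice t x s
  split_ifs at h with hs
  · have h' : ∀ y, solIntegrand Gam t x (s, y) = gamSlice (t - s) x y := congrFun h
    simp_rw [h']
    refine (integral_norm_gamSlice_le _ _).trans ?_
    rw [abs_of_nonneg (by linarith [hs.2]), abs_of_nonneg (hs.1.trans hs.2)]
    linarith [hs.1]
  · have h' : ∀ y, solIntegrand Gam t x (s, y) = 0 := congrFun h
    simp [h']

/-- Here the full strength of the hypothesis on μ enters: the decay estimate, uniform in 0 < r ≤ t,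
dominates the energy density by C / (1 + |ξ|^(2/3)) on the finite time interval [0, t]. -/
theorem solIntegrand_mem_admissible {μ : Measure (ℝ × ℝ)}
    (hSC : Integrable (fun ξ => 1 / (1 + euclNorm ξ ^ (2 / 3 : ℝ))) μ) (t : ℝ) (x : ℝ × ℝ) :
    solIntegrand Gam t x ∈ admissible μ := by
  have := sigmaFinite_of_decay hSC
  have hm : Measurable (solIntegrand Gam t x) :=
    measurable_solIntegrand.comp (f := fun p => ((t, x), p)) (by fun_prop)
  refine ⟨hm, integrable_solIntegrand t x, (measurable_ft hm).aestronglyMeasurable, ?_⟩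
  obtain ⟨C, hC⟩ := exists_norm_oscInt_sq_mul_le x.1 t
  have hb : ∀ s ξ, ‖ft (solIntegrand Gam t x) (s, ξ)‖ₑ ^ 2 ≤ (Set.Icc 0 t).indicator
      (fun _ => ENNReal.ofReal (C * (1 / (1 + euclNorm ξ ^ (2 / 3 : ℝ))))) s := by
    intro s ξ
    have h0 : ∀ ξ : ℝ × ℝ, fourierR (fun _ => (0 : ℝ)) ξ = 0 := fun ξ => by simp [fourierR_eq]
    rw [ft, solIntegrand_slice]
    split_ifs with hs
    · rw [Set.indicator_of_mem hs]
      -- At s = t the kernel time is 0, outside the range of the decay estimate; the slice vanishes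
      -- there.
      rcases hs.2.eq_or_lt with h1 | h1
      · have : gamSlice (t - s) x = fun _ => (0 : ℝ) :=
          funext fun y => gamSlice_of_nonpos (by linarith) x y
        simp only
        rw [this, h0]
        simp
      · have h2 := hC (t - s) (by linarith) (by linarith [hs.1]) ξ
        have hpos : 0 < 1 + euclNorm ξ ^ (2 / 3 : ℝ) := by
          have := euclNorm_nonneg ξ
          positivity
        rw [← ofReal_norm, ← ENNReal.ofReal_pow (norm_nonneg _)]
        refine ENNReal.ofReal_le_ofReal ?_
        rw [mul_one_div, le_div_iff₀ hpos]
        refine le_trans (mul_le_mul_of_nonneg_right ?_ hpos.le) h2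
        exact pow_le_pow_left₀ (norm_nonneg _) (norm_fourierR_gamSlice_le (by linarith) x ξ) 2
    · rw [Set.indicator_of_notMem hs]
      have : (0 : ℝ × ℝ → ℝ) = fun _ => 0 := rfl
      rw [this, h0]
      simp
  have h1 : eLpNorm (ft (solIntegrand Gam t x)) 2 (specMeasure μ) ^ 2 < ∞ := by
    rw [eLpNorm_two_sq, lintegral_specMeasure hm]
    calc ∫⁻ s in Set.Ioi 0, ∫⁻ ξ, ‖ft (solIntegrand Gam t x) (s, ξ)‖ₑ ^ 2 ∂μ
        ≤ ∫⁻ s in Set.Ioi 0, (Set.Icc 0 t).indicator (fun _ =>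
          ∫⁻ ξ, ENNReal.ofReal (C * (1 / (1 + euclNorm ξ ^ (2 / 3 : ℝ)))) ∂μ) s := by
          refine lintegral_mono fun s => ?_
          by_cases hs : s ∈ Set.Icc 0 t
          · rw [Set.indicator_of_mem hs]
            refine lintegral_mono fun ξ => (hb s ξ).trans ?_
            rw [Set.indicator_of_mem hs]
          · rw [Set.indicator_of_notMem hs]
            refine le_of_eq_of_le (lintegral_congr fun ξ => le_antisymm ((hb s ξ).trans ?_) zero_le)
              (le_of_eq lintegral_zero)
            rw [Set.indicator_of_notMem hs]
      _ ≤ ∫⁻ s, (Set.Icc 0 t).indicator (fun _ =>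
          ∫⁻ ξ, ENNReal.ofReal (C * (1 / (1 + euclNorm ξ ^ (2 / 3 : ℝ)))) ∂μ) s :=
          setLIntegral_le_lintegral _ _
      _ < ∞ := by
          rw [lintegral_indicator measurableSet_Icc, setLIntegral_const]
          refine ENNReal.mul_lt_top ?_ measure_Icc_lt_top
          exact (hSC.const_mul C).lintegral_lt_top
  exact lt_top_iff_ne_top.2 fun h2 => by simp [h2] at h1

/-! ### The martingale measure and the stochastic integral -/

theorem tendsto_sq_zero_iff {ι : Type*} {l : Filter ι} {a : ι → ℝ≥0∞} :
    Tendsto (fun n => a n ^ 2) l (𝓝 0) ↔ Tendsto a l (𝓝 0) :=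
  ⟨tendsto_zero_of_tendsto_sq_zero, fun h => by simpa using ENNReal.Tendsto.pow (n := 2) h⟩

theorem tendsto_energy_sub_iff {μ : Measure (ℝ × ℝ)} [SigmaFinite μ] {g : ℕ → admissible μ}
    {h : admissible μ} :
    Tendsto (fun n => energy μ fun p => (g n).1 p - h.1 p) atTop (𝓝 0) ↔
      Tendsto (fun n => spec μ (g n)) atTop (𝓝 (spec μ h)) := by
  have h1 : ∀ n, energy μ (fun p => (g n).1 p - h.1 p) = ‖spec μ (g n) - spec μ h‖ₑ ^ 2 :=
    fun n => by rw [← map_sub, ← energy_eq]; rfl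
  simp_rw [h1]
  rw [tendsto_sq_zero_iff, tendsto_iff_edist_tendsto_0]
  simp_rw [edist_eq_enorm_sub]

theorem eLpNorm_sub_eq_edist {Ω : Type*} [MeasurableSpace Ω] {P : Measure Ω} {X Y : Ω → ℝ}
    {x y : Lp ℝ 2 P} (hX : X =ᵐ[P] x) (hY : Y =ᵐ[P] y) :
    eLpNorm (fun ω => X ω - Y ω) 2 P = edist x y := by
  rw [Lp.edist_def]
  exact eLpNorm_congr_ae (hX.sub hY)

theorem tendsto_eLpNorm_sub_iff {Ω : Type*} [MeasurableSpace Ω] {P : Measure Ω} {X : ℕ → Ω → ℝ}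
    {Y : Ω → ℝ} {x : ℕ → Lp ℝ 2 P} {y : Lp ℝ 2 P} (hX : ∀ n, X n =ᵐ[P] x n) (hY : Y =ᵐ[P] y) :
    Tendsto (fun n => eLpNorm (fun ω => X n ω - Y ω) 2 P) atTop (𝓝 0) ↔
      Tendsto x atTop (𝓝 y) := by
  rw [tendsto_iff_edist_tendsto_0]
  simp_rw [fun n => eLpNorm_sub_eq_edist (hX n) hY]

section
variable {f : ℝ × ℝ → ℝ} {μ : Measure (ℝ × ℝ)} {Ω : Type*} [MeasurableSpace Ω] {P : Measure Ω}
  {F : TestFn → Ω → ℝ}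

theorem isNoiseOfSet_clm {hμ : IsSpectralMeasure f μ}
    {hSC : Integrable (fun ξ => 1 / (1 + euclNorm ξ ^ (2 / 3 : ℝ))) μ}
    {J : Lp ℂ 2 (specMeasure μ) →L[ℝ] Lp ℝ 2 P}
    (hJ : ∀ φ, F φ =ᵐ[P] J (spec μ (testAdm hμ hSC φ))) {A : Set (ℝ × ℝ × ℝ)}
    {S N c : ℝ} (hA : BddSupp S N c (A.indicator fun _ => (1 : ℝ))) (h : admissible μ)
    (hh : h.1 = A.indicator fun _ => (1 : ℝ)) : IsNoiseOfSet P μ F A (J (spec μ h)) := by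
  have := sigmaFinite_of_decay hSC
  refine ⟨Lp.memLp _, ?_⟩
  rw [← hh] at hA
  obtain ⟨_, hmem⟩ := mem_specPreimage.1 (hA.mem_specPreimage_testFn hμ hSC)
  obtain ⟨z, hz, hlim⟩ := mem_closure_iff_seq_limit.1 hmem
  choose φ hφ using hz
  have hlim' : Tendsto (fun n => spec μ (testAdm hμ hSC (φ n))) atTop (𝓝 (spec μ h)) :=
    hlim.congr fun n => (hφ n).symm
  refine ⟨φ, ?_, ?_⟩
  · rw [← hh]
    exact (tendsto_energy_sub_iff (g := fun n => testAdm hμ hSC (φ n)) (h := h)).2 hlim'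
  · exact (tendsto_eLpNorm_sub_iff (fun n => hJ (φ n)) EventuallyEq.rfl).2
      ((J.continuous.tendsto _).comp hlim')

/-- Limits in L² are unique, so the value on a set does not depend on the approximating test
functions. This is what makes the result valid for every version of M. -/
theorem IsNoiseOfSet.ae_eq_clm {hμ : IsSpectralMeasure f μ}
    {hSC : Integrable (fun ξ => 1 / (1 + euclNorm ξ ^ (2 / 3 : ℝ))) μ}
    {J : Lp ℂ 2 (specMeasure μ) →L[ℝ] Lp ℝ 2 P}
    (hJ : ∀ φ, F φ =ᵐ[P] J (spec μ (testAdm hμ hSC φ))) {A : Set (ℝ × ℝ × ℝ)}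
    {X : Ω → ℝ} (hX : IsNoiseOfSet P μ F A X) (h : admissible μ)
    (hh : h.1 = A.indicator fun _ => (1 : ℝ)) : X =ᵐ[P] J (spec μ h) := by
  have := sigmaFinite_of_decay hSC
  obtain ⟨hX2, φ, h1, h2⟩ := hX
  rw [← hh] at h1
  have h3 : Tendsto (fun n => spec μ (testAdm hμ hSC (φ n))) atTop (𝓝 (spec μ h)) :=
    (tendsto_energy_sub_iff (g := fun n => testAdm hμ hSC (φ n)) (h := h)).1 h1
  have h4 := (tendsto_eLpNorm_sub_iff (fun n => hJ (φ n)) hX2.coeFn_toLp.symm).1 h2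
  rw [tendsto_nhds_unique ((J.continuous.tendsto _).comp h3) h4]
  exact hX2.coeFn_toLp.symm

theorem exists_bddSupp_Icc_prod {t : ℝ} {B : Set (ℝ × ℝ)} (hB : MeasurableSet B)
    (hBb : Bornology.IsBounded B) :
    ∃ S N c : ℝ, BddSupp S N c ((Set.Icc 0 t ×ˢ B).indicator fun _ => (1 : ℝ)) := by
  obtain ⟨N, hN⟩ := hBb.subset_closedBall (0 : ℝ × ℝ)
  refine ⟨t, N, _, bddSupp_indicator (measurableSet_Icc.prod hB)
    (fun p hp => ⟨?_, mem_closedBall_zero_iff.1 (hN hp.2)⟩) _⟩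
  rw [abs_of_nonneg hp.1.1]
  exact hp.1.2

open Classical in
theorem exists_isNoiseMartingaleMeasure {hμ : IsSpectralMeasure f μ}
    {hSC : Integrable (fun ξ => 1 / (1 + euclNorm ξ ^ (2 / 3 : ℝ))) μ}
    {J : Lp ℂ 2 (specMeasure μ) →L[ℝ] Lp ℝ 2 P}
    (hJ : ∀ φ, F φ =ᵐ[P] J (spec μ (testAdm hμ hSC φ))) :
    ∃ M : ℝ → Set (ℝ × ℝ) → Ω → ℝ, IsNoiseMartingaleMeasure P μ F M := by
  have h : ∀ (t : ℝ) (B : Set (ℝ × ℝ)), ∃ X : Ω → ℝ, MeasurableSet B → Bornology.IsBounded B →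
      IsNoiseOfSet P μ F (Set.Icc 0 t ×ˢ B) X := by
    intro t B
    by_cases hB : MeasurableSet B ∧ Bornology.IsBounded B
    · obtain ⟨S, N, c, hA⟩ := exists_bddSupp_Icc_prod (t := t) hB.1 hB.2
      exact ⟨_, fun _ _ => isNoiseOfSet_clm hJ hA ⟨_, hA.mem_admissible hμ hSC⟩ rfl⟩
    · exact ⟨0, fun h1 h2 => absurd ⟨h1, h2⟩ hB⟩
  choose M hM using h
  exact ⟨M, fun t _ B hB hBb => hM t B hB hBb⟩

/-- Elementary functions as integrands. -/
def elemAdm (hμ : IsSpectralMeasure f μ)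
    (hSC : Integrable (fun ξ => 1 / (1 + euclNorm ξ ^ (2 / 3 : ℝ))) μ) (L : List Box) :
    admissible μ := ⟨elemFun L, elemFun_mem_admissible hμ hSC L⟩

theorem elemInt_ae_eq_clm {hμ : IsSpectralMeasure f μ}
    {hSC : Integrable (fun ξ => 1 / (1 + euclNorm ξ ^ (2 / 3 : ℝ))) μ}
    {J : Lp ℂ 2 (specMeasure μ) →L[ℝ] Lp ℝ 2 P}
    (hJ : ∀ φ, F φ =ᵐ[P] J (spec μ (testAdm hμ hSC φ)))
    {M : ℝ → Set (ℝ × ℝ) → Ω → ℝ} (hM : IsNoiseMartingaleMeasure P μ F M) (L : List Box) :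
    elemInt M L =ᵐ[P] J (spec μ (elemAdm hμ hSC L)) := by
  induction L with
  | nil =>
    have h0 : elemAdm hμ hSC [] = 0 :=
      Subtype.ext elemFun_nil
    rw [h0, map_zero, map_zero]
    filter_upwards [Lp.coeFn_zero ℝ 2 P] with ω hω
    rw [hω]
    simp [elemInt]
  | cons e L ih =>
    have hAdm : ∀ t : ℝ, ((Set.Icc 0 t ×ˢ e.B).indicator fun _ => (1 : ℝ)) ∈ admissible μ := by
      intro t
      obtain ⟨S, N, c, h⟩ := exists_bddSupp_Icc_prod (t := t) e.measurable_B e.bounded_B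
      exact h.mem_admissible hμ hSC
    let I : ℝ → admissible μ := fun t => ⟨_, hAdm t⟩
    -- Since 0 ≤ a ≤ b, removing [0, a] from [0, b] leaves exactly ]a, b], so the increments of M
    -- match the half-open boxes.
    have hdec : elemAdm hμ hSC (e :: L)
        = e.c • (I e.b - I e.a) + elemAdm hμ hSC L := by
      refine Subtype.ext ?_
      change elemFun (e :: L) = e.c • (((Set.Icc 0 e.b ×ˢ e.B).indicator fun _ => (1 : ℝ))
        - ((Set.Icc 0 e.a ×ˢ e.B).indicator fun _ => (1 : ℝ))) + elemFun L
      rw [elemFun_cons]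
      congr 1
      classical
      funext p
      have ha := e.a_nonneg
      have hab := e.a_le_b
      simp only [Pi.smul_apply, Pi.sub_apply, smul_eq_mul]
      rw [Set.indicator_apply, Set.indicator_apply, Set.indicator_apply]
      simp only [Set.mem_prod, Set.mem_Ioc, Set.mem_Icc]
      by_cases h1 : p.2 ∈ e.B
      · rcases le_or_gt p.1 e.a with h2 | h2
        · by_cases h3 : 0 ≤ p.1
          · simp [h1, h2, h3, not_lt.2 h2, h2.trans hab]
          · simp [h1, h3, not_lt.2 h2]
        · simp [h1, h2, not_le.2 h2, (ha.trans_lt h2).le]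
      · simp [h1]
    have hb := (hM e.b (e.a_nonneg.trans e.a_le_b) e.B e.measurable_B e.bounded_B).ae_eq_clm hJ
      (I e.b) rfl
    have ha := (hM e.a e.a_nonneg e.B e.measurable_B e.bounded_B).ae_eq_clm hJ (I e.a) rfl
    rw [hdec, map_add, map_smul, map_sub, map_add, map_smul, map_sub]
    filter_upwards [ih, ha, hb, Lp.coeFn_add (e.c • (J (spec μ (I e.b)) - J (spec μ (I e.a))))
      (J (spec μ (elemAdm hμ hSC L))),
      Lp.coeFn_smul e.c (J (spec μ (I e.b)) - J (spec μ (I e.a))),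
      Lp.coeFn_sub (J (spec μ (I e.b))) (J (spec μ (I e.a)))] with ω h1 h2 h3 h4 h5 h6
    rw [h4, Pi.add_apply, h5, Pi.smul_apply, h6, Pi.sub_apply, ← h1]
    simp only [elemInt, List.map_cons, List.sum_cons, smul_eq_mul]
    rw [h2, h3]

theorem hasStochIntegral_clm {hμ : IsSpectralMeasure f μ}
    {hSC : Integrable (fun ξ => 1 / (1 + euclNorm ξ ^ (2 / 3 : ℝ))) μ}
    {J : Lp ℂ 2 (specMeasure μ) →L[ℝ] Lp ℝ 2 P}
    (hJ : ∀ φ, F φ =ᵐ[P] J (spec μ (testAdm hμ hSC φ)))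
    {M : ℝ → Set (ℝ × ℝ) → Ω → ℝ} (hM : IsNoiseMartingaleMeasure P μ F M) (g : admissible μ)
    (hgW : g.1 ∈ specPreimage μ ((elemSubmodule hμ hSC).map (spec μ)).topologicalClosure)
    {X : Ω → ℝ} (hX : X =ᵐ[P] J (spec μ g)) : HasStochIntegral P μ M g.1 X := by
  have := sigmaFinite_of_decay hSC
  refine ⟨g.2.1, Eventually.of_forall g.2.2.1, ?_, (memLp_congr_ae hX).2 (Lp.memLp _), ?_⟩
  · rw [energy_eq g]
    exact ENNReal.pow_lt_top enorm_lt_top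
  · obtain ⟨_, hmem⟩ := mem_specPreimage.1 hgW
    obtain ⟨z, hz, hlim⟩ := mem_closure_iff_seq_limit.1 hmem
    have hz' : ∀ n, ∃ L : List Box, spec μ (elemAdm hμ hSC L) = z n := by
      intro n
      obtain ⟨_, ⟨L, rfl⟩, hL⟩ := hz n
      exact ⟨L, hL⟩
    choose L hL using hz'
    have hlim' : Tendsto (fun n => spec μ (elemAdm hμ hSC (L n))) atTop (𝓝 (spec μ g)) :=
      hlim.congr fun n => (hL n).symm
    refine ⟨L, ?_, ?_⟩
    · exact (tendsto_energy_sub_iff (g := fun n => elemAdm hμ hSC (L n))).2 hlim'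
    · exact (tendsto_eLpNorm_sub_iff (fun n => elemInt_ae_eq_clm hJ hM (L n)) hX).2
        ((J.continuous.tendsto _).comp hlim')

end

/-! ### Measurable versions -/

/-- The squared errors have a finite sum in expectation, so almost surely their series converges and
its terms tend to 0. -/
theorem ae_tendsto_of_edist_le {Ω : Type*} [MeasurableSpace Ω] {P : Measure Ω}
    {x : ℕ → Lp ℝ 2 P} {y : Lp ℝ 2 P} {c : ℝ≥0∞} (hc : c ≠ ∞)
    (h : ∀ n, edist (x n) y ^ 2 ≤ c * 4⁻¹ ^ n) : ∀ᵐ ω ∂P, Tendsto (fun n => x n ω) atTop (𝓝 (y ω)) := by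
  have h1 : ∀ n, edist (x n) y ^ 2 = ∫⁻ ω, ‖x n ω - y ω‖ₑ ^ 2 ∂P := fun n => by
    rw [Lp.edist_def, eLpNorm_two_sq]
    rfl
  have hm : ∀ n, AEMeasurable (fun ω => ‖x n ω - y ω‖ₑ ^ 2) P := fun n =>
    (((Lp.aestronglyMeasurable (x n)).sub (Lp.aestronglyMeasurable y)).enorm).pow_const 2
  have h2 : ∫⁻ ω, ∑' n, ‖x n ω - y ω‖ₑ ^ 2 ∂P ≠ ∞ := by
    rw [lintegral_tsum hm]
    refine ne_top_of_le_ne_top ?_ (ENNReal.tsum_le_tsum fun n => (h1 n).symm.trans_le (h n))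
    rw [ENNReal.tsum_mul_left, ENNReal.tsum_geometric]
    refine ENNReal.mul_ne_top hc (ENNReal.inv_ne_top.2 ?_)
    refine (tsub_pos_of_lt ?_).ne'
    exact ENNReal.inv_lt_one.2 (by norm_num)
  filter_upwards [ae_lt_top' (AEMeasurable.tsum hm) h2] with ω hω
  have h3 := tendsto_zero_of_tendsto_sq_zero (ENNReal.tendsto_atTop_zero_of_tsum_ne_top hω.ne)
  rw [tendsto_iff_edist_tendsto_0]
  simpa [edist_eq_enorm_sub] using h3

/-- If the distances of a family `Φ q` in a separable space `H` to fixed points are measurable in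
`q`, then its image under a continuous linear map into `L²` has a jointly measurable version. -/
theorem exists_measurable_version {α Ω H : Type*} [MeasurableSpace α] [MeasurableSpace Ω]
    {P : Measure Ω} [NormedAddCommGroup H] [NormedSpace ℝ H] [TopologicalSpace.SeparableSpace H]
    (J : H →L[ℝ] Lp ℝ 2 P) (Φ : α → H) (hΦ : ∀ d, Measurable fun q => edist d (Φ q) ^ 2) :
    ∃ u : α × Ω → ℝ, Measurable u ∧ ∀ q, (fun ω => u (q, ω)) =ᵐ[P] J (Φ q) := by
  classical
  let d : ℕ → H := TopologicalSpace.denseSeq H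
  -- Squared distances below 4⁻ⁿ are summable, which gives almost sure convergence along the whole
  -- sequence for every fixed q.
  have hex : ∀ (n : ℕ) (q : α), ∃ k, edist (d k) (Φ q) ^ 2 < 4⁻¹ ^ n := by
    intro n q
    have hpos : (0 : ℝ≥0∞) < 2⁻¹ ^ n := ENNReal.pow_pos (by simp) n
    obtain ⟨_, ⟨k, rfl⟩, hk⟩ := EMetric.mem_closure_iff.1
      ((TopologicalSpace.denseRange_denseSeq H) (Φ q)) _ hpos
    refine ⟨k, ?_⟩
    rw [edist_comm]
    have h4 : (4⁻¹ : ℝ≥0∞) ^ n = (2⁻¹ ^ n) ^ 2 := by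
      have h5 : (4 : ℝ≥0∞)⁻¹ = 2⁻¹ ^ 2 := by rw [← ENNReal.inv_pow]; norm_num
      rw [h5, ← pow_mul, ← pow_mul, mul_comm]
    rw [h4]
    exact ENNReal.pow_lt_pow_left two_ne_zero hk
  -- The least admissible index depends measurably on q and takes countably many values, so gluing
  -- the representatives v stays jointly measurable.
  let k : ℕ → α → ℕ := fun n q => Nat.find (hex n q)
  have hk : ∀ n, Measurable (k n) := fun n =>
    measurable_find (hex n) fun j => measurableSet_lt (hΦ (d j)) measurable_const
  have hv : ∀ j, ∃ v : Ω → ℝ, Measurable v ∧ J (d j) =ᵐ[P] v := fun j =>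
    ⟨_, (Lp.stronglyMeasurable (J (d j))).measurable, EventuallyEq.rfl⟩
  choose v hvm hvJ using hv
  let Y : ℕ → α × Ω → ℝ := fun n p => v (k n p.1) p.2
  have hY : ∀ n, Measurable (Y n) := fun n => by
    have h1 : Measurable fun p : ℕ × Ω => v p.1 p.2 := measurable_from_prod_countable_right hvm
    exact h1.comp (((hk n).comp measurable_fst).prodMk measurable_snd)
  -- Where no limit exists `limUnder` takes a default value; measurability on the whole product is
  -- kept, and for each q this concerns only a null set.
  refine ⟨fun p => limUnder atTop fun n => Y n p,
    (StronglyMeasurable.limUnder fun n => (hY n).stronglyMeasurable).measurable, fun q => ?_⟩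
  have hlim := ae_tendsto_of_edist_le (P := P) (x := fun n => J (d (k n q))) (y := J (Φ q))
    (c := ‖J‖ₑ ^ 2) (by finiteness) fun n => by
      rw [edist_eq_enorm_sub, ← map_sub]
      refine (pow_le_pow_left' (J.le_opENorm _) 2).trans ?_
      rw [mul_pow]
      refine mul_le_mul' le_rfl ?_
      rw [← edist_eq_enorm_sub]
      exact (Nat.find_spec (hex n q)).le
  filter_upwards [hlim, ae_all_iff.2 hvJ] with ω h1 h2
  refine Tendsto.limUnder_eq (h1.congr fun n => h2 _)

theorem sigmaFinite_specMeasure {μ : Measure (ℝ × ℝ)} [SigmaFinite μ] :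
    SigmaFinite (specMeasure μ) := by
  unfold specMeasure
  infer_instance

theorem separableSpace_Lp_specMeasure {μ : Measure (ℝ × ℝ)} [SigmaFinite μ] :
    TopologicalSpace.SeparableSpace (Lp ℂ 2 (specMeasure μ)) := by
  have := sigmaFinite_specMeasure (μ := μ)
  have : Fact ((2 : ℝ≥0∞) ≠ ∞) := ⟨by norm_num⟩
  have : SecondCountableTopology (Lp ℂ 2 (specMeasure μ)) := Lp.SecondCountableTopology
  infer_instance

/-- A jointly measurable family of integrands depends measurably on its parameter. -/
theorem measurable_edist_spec {α : Type*} [MeasurableSpace α] {μ : Measure (ℝ × ℝ)} [SigmaFinite μ]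
    {g : α → admissible μ} (hg : Measurable fun p : α × (ℝ × ℝ × ℝ) => (g p.1).1 p.2)
    (d : Lp ℂ 2 (specMeasure μ)) : Measurable fun q => edist d (spec μ (g q)) ^ 2 := by
  have := sigmaFinite_specMeasure (μ := μ)
  have hft : Measurable fun p : α × (ℝ × (ℝ × ℝ)) => ft (g p.1).1 p.2 := by
    have h1 : Measurable fun p : (α × ℝ) × (ℝ × ℝ) => (g p.1.1).1 (p.1.2, p.2) :=
      hg.comp (f := fun p : (α × ℝ) × (ℝ × ℝ) => (p.1.1, (p.1.2, p.2))) (by fun_prop)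
    exact (measurable_fourierR_slice h1).comp
      (f := fun p : α × (ℝ × (ℝ × ℝ)) => ((p.1, p.2.1), p.2.2)) (by fun_prop)
  have h2 : ∀ q, edist d (spec μ (g q)) ^ 2
      = ∫⁻ p, ‖d p - ft (g q).1 p‖ₑ ^ 2 ∂(specMeasure μ) := by
    intro q
    rw [Lp.edist_def, eLpNorm_two_sq]
    refine lintegral_congr_ae ?_
    filter_upwards [coeFn_spec (g q)] with p hp
    rw [Pi.sub_apply, hp]
  simp_rw [h2]
  have hd : Measurable d := (Lp.stronglyMeasurable d).measurable
  exact Measurable.lintegral_prod_right'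
    (f := fun p : α × (ℝ × (ℝ × ℝ)) => ‖d p.2 - ft (g p.1).1 p.2‖ₑ ^ 2)
    (((hd.comp measurable_snd).sub hft).enorm.pow_const 2)

end DoubleChar

end

/-! ### Assembly of the random field solution -/

theorem theorem1p1 {Ω : Type*} [MeasurableSpace Ω] (P : Measure Ω) [IsProbabilityMeasure P]
    (f : ℝ × ℝ → ℝ) (hf : ContinuousOn f {0}ᶜ) (hf_even : ∀ x, f (-x) = f x)
    (F : DoubleChar.TestFn → Ω → ℝ) (hF : DoubleChar.IsColouredNoise P f F)
    (μ : Measure (ℝ × ℝ)) (hμ : DoubleChar.IsSpectralMeasure f μ)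
    (hSC : Integrable (fun ξ => 1 / (1 + DoubleChar.euclNorm ξ ^ (2 / 3 : ℝ))) μ) :
    (∃ M : ℝ → Set (ℝ × ℝ) → Ω → ℝ, DoubleChar.IsNoiseMartingaleMeasure P μ F M) ∧
      ∀ M : ℝ → Set (ℝ × ℝ) → Ω → ℝ, DoubleChar.IsNoiseMartingaleMeasure P μ F M →
        ∃ u : ℝ≥0 → ℝ × ℝ → Ω → ℝ,
          DoubleChar.IsRandomFieldSolution P μ M DoubleChar.Gam u := by
  open DoubleChar in
  have := sigmaFinite_of_decay hSC
  have := separableSpace_Lp_specMeasure (μ := μ)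
  obtain ⟨J, hJF⟩ := hF.exists_clm hμ hSC
  have hJ : ∀ φ, F φ =ᵐ[P] J (spec μ (testAdm hμ hSC φ)) := fun φ => by
    rw [hJF]
    exact (hF.memLp φ).coeFn_toLp.symm
  refine ⟨exists_isNoiseMartingaleMeasure hJ, fun M hM => ?_⟩
  let g : ℝ≥0 × (ℝ × ℝ) → admissible μ := fun q =>
    ⟨solIntegrand Gam q.1 q.2, solIntegrand_mem_admissible hSC q.1 q.2⟩
  have hg : Measurable fun p : (ℝ≥0 × (ℝ × ℝ)) × (ℝ × ℝ × ℝ) => (g p.1).1 p.2 :=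
    measurable_solIntegrand.comp
      (f := fun p : (ℝ≥0 × (ℝ × ℝ)) × (ℝ × ℝ × ℝ) => (((p.1.1 : ℝ), p.1.2), p.2)) (by fun_prop)
  obtain ⟨u, hu, huJ⟩ := exists_measurable_version J (fun q => spec μ (g q))
    (measurable_edist_spec hg)
  refine ⟨fun t x ω => u ((t, x), ω), isFundamentalSolution_Gam, fun t x => ?_, hu⟩
  exact hasStochIntegral_clm hJ hM (g (t, x)) (mem_specPreimage_elem_of_slices hμ hSC (g (t, x)).2
    (fun _ hp => solIntegrand_supp t x hp) (integral_norm_solIntegrand_le t x)) (huJ (t, x))
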